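/- **Depth composability of MSSP-Regime-II.** *Network.* Fix a depth $K\ge 1$. For widths $D,N,M,N_e$ and an input $x\in\mathbb R^D$ put $h^{3,(0)}:=h^1=W^1x$, and for $k=1,\dots,K$ $$\psi^{(k)}=Q^{(k)}h^{3,(k-1)},\quad \phi^{(k)}_i=\sigma(\psi^{(k)}_i),\quad h^{2,i,(k)}=W^{2,i,(k)}h^{3,(k-1)},\quad h^{3,i,(k)}=W^{3,i,(k)}h^{2,i,(k)},\quad h^{3,(k)}=\frac1M\sum_{i=1}^M\phi_i^{(k)}h^{3,i,(k)},$$ with the sigmoid $\sigma(u)=(1+e^{-u})^{-1}$, and $f=W^4h^{3,(K)}\in\mathbb R$. Here $W^1\in\mathbb R^{N\times D}$, $Q^{(k)}\in\mathbb R^{M\times N}$, $W^{2,i,(k)}\in\mathbb R^{N_e\times N}$, $W^{3,i,(k)}\in\mathbb R^{N\times N_e}$, $W^4\in\mathbb R^{1\times N}$. *Parameterization.* At initialization ($t=0$) all entries are independent centered Gaussians with variances $1/D$ ($W^1$), $1/N$ ($Q^{(k)}$ and $W^{2,i,(k)}$), $M/N_e$ ($W^{3,i,(k)}$), and $W^4_0=0$.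 The network is trained by SGD on $\ell(f)$, for the one input $x$ and a differentiable loss $\ell:\mathbb R\to\mathbb R$, with learning rates $\eta_1=\eta N$, $\eta_Q=\eta_2=\eta M/N$, $\eta_3=\eta MN$, $\eta_4=\eta/N$, where $\eta>0$ is fixed. A subscript $t$ denotes values after $t$ steps, and $\chi_t=\ell'(f_t)$. *Regime.* $N,M,N_e,D\ge1$ and $x$ vary along a sequence with $N\to\infty$, $M=\Theta(N)$, $N_e=\Theta(1)$, $\|x\|^2=\Theta(D)$; $K,\eta,\ell$ are fixed. *Scales.* A random tensor $X$ is $\Theta(\alpha)$ if for every $\varepsilon>0$ there are constants $c,C>0$ such that for all large members of the sequence, for each single entry $X_j$, $c\alpha\le|X_j|\le C\alpha$ with probability at least $1-\varepsilon$, and $c\alpha\le\|X\|_{\mathrm{RMS}}\le C\alpha$ with probability at least $1-\varepsilon$, where $\|X\|_{\mathrm{RMS}}$ is the root mean square of the entries. The constants do not depend on the entry, nor, for tensors that carry an expert index $i$, on $i$. Assume $\chi_0,\chi_1$ are $\Theta(1)$. *Claim.* For every $K\ge1$ and every block $k\in\{1,\dots,K\}$, with scales that depend neither on $K$ nor on $k$: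 1. (Forward, $t=0$.) $h^{3,(0)}_0$ and $h^{3,(k)}_0$, $\psi^{(k)}_0$, $\phi^{(k)}_0$ and $h^{2,i,(k)}_0$ are $\Theta(1)$; $h^{3,i,(k)}_0$ is $\Theta(\sqrt N)$; $Q^{(k)}_0$ and $W^{2,i,(k)}_0$ are $\Theta(1/\sqrt N)$; $W^{3,i,(k)}_0$ is $\Theta(\sqrt N)$; and $W_0^4=0$, $f_0=0$ almost surely. 2. (Backward, $t=1$.) Almost surely the first step changes only $W^4$, and $W^4_1=-\eta_4\chi_0(h_0^{3,(K)})^\top$; $W_1^4$ is $\Theta(1/N)$ and $f_1$ is $\Theta(1)$. The gradients $\partial f_1/\partial h^{3,(j)}$, $j=0,\dots,K$, are $\Theta(1/N)$, and so are the expert part (gates held fixed) and the router part (expert outputs held fixed) of the gradient at the input $h^{3,(k-1)}$ of block $k$. Moreover $\partial f_1/\partial h^{3,i,(k)}$ is $\Theta(1/N^2)$; $\partial f_1/\partial h^{2,i,(k)}$, $\partial f_1/\partial\phi^{(k)}$ and $\partial f_1/\partial\psi^{(k)}$ are $\Theta(1/N)$; $\partial f_1/\partial Q^{(k)}$ and $\partial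 f_1/\partial W^{2,i,(k)}$ are $\Theta(1/N)$, $\partial f_1/\partial W^{3,i,(k)}$ is $\Theta(1/N^2)$, $\partial f_1/\partial W^4$ is $\Theta(1)$. The SGD updates $\Delta_2=(\cdot)_2-(\cdot)_1$ satisfy $\Delta_2Q^{(k)},\Delta_2W^{2,i,(k)}=\Theta(1/N)$ and $\Delta_2W^{3,i,(k)}=\Theta(1)$. 3. (Bypassing $h^{3,i,(k)}$.) For all parameter values and all $v\in\mathbb R^N$, $(h^{3,i,(k)})^\top v=(v^\top W^{3,i,(k)})\,h^{2,i,(k)}$; in particular $\partial f/\partial\phi^{(k)}_i=\frac1M\big((\partial f/\partial h^{3,(k)})^\top W^{3,i,(k)}\big)h^{2,i,(k)}$. The intermediate $v^\top W_0^{3,i,(k)}\in\mathbb R^{N_e}$ is $\Theta(1)$ for $v=\partial f_1/\partial h^{3,(k)}$, and for every (deterministic or random) $v$ that is $\Theta(1/N)$ and independent of $W_0^{3,i,(k)}$. -/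

import Mathlib

open MeasureTheory ProbabilityTheory Filter Asymptotics Topology
open scoped Matrix NNReal ENNReal

noncomputable section

namespace MoE

/-! ### Coordinate scales of random tensors -/

/-- The root-mean-square entry size of a tensor. -/
def rms {ι : Type*} [Fintype ι] (v : ι → ℝ) : ℝ :=
  Real.sqrt ((∑ j, v j ^ 2) / Fintype.card ι)

/-- For each `n`, `X n ω i` (with `i : κ n`) is a family of random tensors with entries indexed by
`ι n`. The family has coordinate scale `Θ(α)`, uniformly over the family, if, with probability
arbitrarily close to one, each single entry and the root mean square of all the entries lie between
constant positive multiples of `α n`. The constants depend on the probability level only: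
not on `n`, not on the member of the family and not on the entry. -/
def UniformCoordScale {Ω : ℕ → Type*} [∀ n, MeasurableSpace (Ω n)] (μ : ∀ n, Measure (Ω n))
    {κ ι : ℕ → Type} [∀ n, Fintype (ι n)] (X : ∀ n, Ω n → κ n → ι n → ℝ) (α : ℕ → ℝ) : Prop :=
  ∀ ε : ℝ, 0 < ε → ∃ c C : ℝ, 0 < c ∧ 0 < C ∧ ∀ᶠ n in atTop, ∀ i : κ n,
    (∀ j : ι n, μ n {ω | ¬ (c * α n ≤ |X n ω i j| ∧ |X n ω i j| ≤ C * α n)} ≤ ENNReal.ofReal ε) ∧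
    μ n {ω | ¬ (c * α n ≤ rms (X n ω i) ∧ rms (X n ω i) ≤ C * α n)} ≤ ENNReal.ofReal ε

/-- A single sequence of random tensors has coordinate scale `Θ(α)`. -/
def CoordScale {Ω : ℕ → Type*} [∀ n, MeasurableSpace (Ω n)] (μ : ∀ n, Measure (Ω n))
    {ι : ℕ → Type} [∀ n, Fintype (ι n)] (X : ∀ n, Ω n → ι n → ℝ) (α : ℕ → ℝ) : Prop :=
  UniformCoordScale μ (κ := fun _ => Unit) (fun n ω _ => X n ω) α

/-! ### Parameters -/

/-- Input dimension `D`, hidden width `N`, number of experts `M`, expert width `Ne`. -/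
structure Shape where
  D : ℕ
  N : ℕ
  M : ℕ
  Ne : ℕ

/-- The scalar parameters of a stack of `K` blocks: the entries of the input matrix, of the router
matrix and of the two expert matrices of each expert in each block, and of the readout. -/
inductive ParamIdx (s : Shape) (K : ℕ) : Type
  | W1 (a : Fin s.N) (d : Fin s.D)
  | Q (k : Fin K) (i : Fin s.M) (a : Fin s.N)
  | W2 (k : Fin K) (i : Fin s.M) (e : Fin s.Ne) (a : Fin s.N)
  | W3 (k : Fin K) (i : Fin s.M) (a : Fin s.N) (e : Fin s.Ne)
  | W4 (a : Fin s.N)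
  deriving DecidableEq

abbrev Params (s : Shape) (K : ℕ) : Type := ParamIdx s K → ℝ

/-- Variances of the centered Gaussian initialization; `W4` is initialized at zero. -/
def initVar {s : Shape} {K : ℕ} : ParamIdx s K → ℝ≥0
  | .W1 _ _ => 1 / (s.D : ℝ≥0)
  | .Q _ _ _ => 1 / (s.N : ℝ≥0)
  | .W2 _ _ _ _ => 1 / (s.N : ℝ≥0)
  | .W3 _ _ _ _ => (s.M : ℝ≥0) / (s.Ne : ℝ≥0)
  | .W4 _ => 0

/-- SGD learning rates. -/
def lr (η : ℝ) {s : Shape} {K : ℕ} : ParamIdx s K → ℝ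
  | .W1 _ _ => η * s.N
  | .Q _ _ _ => η * s.M / s.N
  | .W2 _ _ _ _ => η * s.M / s.N
  | .W3 _ _ _ _ => η * s.M * s.N
  | .W4 _ => η / s.N

section Network

variable {s : Shape} {K : ℕ}

def matW1 (θ : Params s K) : Matrix (Fin s.N) (Fin s.D) ℝ := Matrix.of fun a d => θ (.W1 a d)

def matQ (θ : Params s K) (k : Fin K) : Matrix (Fin s.M) (Fin s.N) ℝ :=
  Matrix.of fun i a => θ (.Q k i a)

def matW2 (θ : Params s K) (k : Fin K) (i : Fin s.M) : Matrix (Fin s.Ne) (Fin s.N) ℝ :=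
  Matrix.of fun e a => θ (.W2 k i e a)

def matW3 (θ : Params s K) (k : Fin K) (i : Fin s.M) : Matrix (Fin s.N) (Fin s.Ne) ℝ :=
  Matrix.of fun a e => θ (.W3 k i a e)

def vecW4 (θ : Params s K) : Fin s.N → ℝ := fun a => θ (.W4 a)

/-! ### One block -/

def router (θ : Params s K) (k : Fin K) (h : Fin s.N → ℝ) : Fin s.M → ℝ := matQ θ k *ᵥ h

def gate (ψ : Fin s.M → ℝ) : Fin s.M → ℝ := fun i => Real.sigmoid (ψ i)

def expertIn (θ : Params s K) (k : Fin K) (h : Fin s.N → ℝ) : Fin s.M → Fin s.Ne → ℝ :=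
  fun i => matW2 θ k i *ᵥ h

def expertOut (θ : Params s K) (k : Fin K) (z : Fin s.M → Fin s.Ne → ℝ) :
    Fin s.M → Fin s.N → ℝ :=
  fun i => matW3 θ k i *ᵥ z i

def aggregate (φ : Fin s.M → ℝ) (u : Fin s.M → Fin s.N → ℝ) : Fin s.N → ℝ :=
  (1 / (s.M : ℝ)) • ∑ i, φ i • u i

def block (θ : Params s K) (k : Fin K) (h : Fin s.N → ℝ) : Fin s.N → ℝ :=
  aggregate (gate (router θ k h)) (expertOut θ k (expertIn θ k h))

/-! ### Forward pass. Block `k : Fin K` has input `agg k.castSucc` and output `agg k.succ`. -/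

/-- The inter-block aggregates; `agg 0` is the embedding `W1 x`. -/
def agg (θ : Params s K) (x : Fin s.D → ℝ) : Fin (K + 1) → Fin s.N → ℝ :=
  Fin.induction (motive := fun _ => Fin s.N → ℝ) (matW1 θ *ᵥ x) (fun k h => block θ k h)

def psi (θ : Params s K) (x : Fin s.D → ℝ) (k : Fin K) : Fin s.M → ℝ :=
  router θ k (agg θ x k.castSucc)

def phi (θ : Params s K) (x : Fin s.D → ℝ) (k : Fin K) : Fin s.M → ℝ := gate (psi θ x k)

def h2 (θ : Params s K) (x : Fin s.D → ℝ) (k : Fin K) : Fin s.M → Fin s.Ne → ℝ :=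
  expertIn θ k (agg θ x k.castSucc)

def h3 (θ : Params s K) (x : Fin s.D → ℝ) (k : Fin K) : Fin s.M → Fin s.N → ℝ :=
  expertOut θ k (h2 θ x k)

/-- The scalar output of the network. -/
def output (θ : Params s K) (x : Fin s.D → ℝ) : ℝ := vecW4 θ ⬝ᵥ agg θ x (Fin.last K)

/-- The output as a function of the aggregate number `k`: the part of the network that
comes after this aggregate. -/
def tail (θ : Params s K) : Fin (K + 1) → (Fin s.N → ℝ) → ℝ :=
  Fin.reverseInduction (motive := fun _ => (Fin s.N → ℝ) → ℝ)
    (fun h => vecW4 θ ⬝ᵥ h) (fun k F h => F (block θ k h))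

/-! ### Backward pass -/

/-- The vector of partial derivatives of `F` at `y`. -/
def pgrad {ι : Type*} [DecidableEq ι] (F : (ι → ℝ) → ℝ) (y : ι → ℝ) : ι → ℝ :=
  fun j => deriv (fun r => F (Function.update y j r)) (y j)

/-- Gradient of the output at the aggregate number `k`. -/
def gradAgg (θ : Params s K) (x : Fin s.D → ℝ) (k : Fin (K + 1)) : Fin s.N → ℝ :=
  pgrad (tail θ k) (agg θ x k)

/-- Gradient of the output at the output state of expert `i`. -/
def gradH3 (θ : Params s K) (x : Fin s.D → ℝ) (k : Fin K) (i : Fin s.M) : Fin s.N → ℝ :=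
  pgrad (fun u => tail θ k.succ (aggregate (phi θ x k) (Function.update (h3 θ x k) i u)))
    (h3 θ x k i)

/-- Gradient of the output at the hidden state of expert `i`. -/
def gradH2 (θ : Params s K) (x : Fin s.D → ℝ) (k : Fin K) (i : Fin s.M) : Fin s.Ne → ℝ :=
  pgrad (fun z => tail θ k.succ
      (aggregate (phi θ x k) (expertOut θ k (Function.update (h2 θ x k) i z))))
    (h2 θ x k i)

/-- Gradient of the output at the gates. -/
def gradPhi (θ : Params s K) (x : Fin s.D → ℝ) (k : Fin K) : Fin s.M → ℝ :=
  pgrad (fun φ => tail θ k.succ (aggregate φ (h3 θ x k))) (phi θ x k)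

/-- Gradient of the output at the router logits. -/
def gradPsi (θ : Params s K) (x : Fin s.D → ℝ) (k : Fin K) : Fin s.M → ℝ :=
  pgrad (fun ψ => tail θ k.succ (aggregate (gate ψ) (h3 θ x k))) (psi θ x k)

/-- The part of the gradient at the input of block `k` that flows through the experts
(gates held fixed). -/
def gradExpert (θ : Params s K) (x : Fin s.D → ℝ) (k : Fin K) : Fin s.N → ℝ :=
  pgrad (fun h => tail θ k.succ (aggregate (phi θ x k) (expertOut θ k (expertIn θ k h))))
    (agg θ x k.castSucc)

/-- The part of the gradient at the input of block `k` that flows through the router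
(expert outputs held fixed). -/
def gradRouter (θ : Params s K) (x : Fin s.D → ℝ) (k : Fin K) : Fin s.N → ℝ :=
  pgrad (fun h => tail θ k.succ (aggregate (gate (router θ k h)) (h3 θ x k)))
    (agg θ x k.castSucc)

/-- Gradient of the output at the parameters. -/
def gradParam (θ : Params s K) (x : Fin s.D → ℝ) : ParamIdx s K → ℝ :=
  pgrad (fun θ' => output θ' x) θ

/-! ### Training -/

/-- The derivative of the loss at the current output. -/
def lossDeriv (ℓ : ℝ → ℝ) (θ : Params s K) (x : Fin s.D → ℝ) : ℝ := deriv ℓ (output θ x)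

/-- SGD on the loss `ℓ (output θ x)` with parameter-wise learning rates. -/
def sgd (η : ℝ) (ℓ : ℝ → ℝ) (x : Fin s.D → ℝ) (θ₀ : Params s K) : ℕ → Params s K
  | 0 => θ₀
  | t + 1 => fun p => sgd η ℓ x θ₀ t p -
      lr η p * pgrad (fun θ' => ℓ (output θ' x)) (sgd η ℓ x θ₀ t) p

end Network

end MoE

end

/-! Every tensor in the claim is, up to explicit factors, a contraction of a Gaussian weight matrix
with other vectors. In the forward direction the matrices of a block are independent of its input.
Given that input, logits and hidden states are centered Gaussians; given the hidden states and
gates, so are the expert outputs and the next aggregate. The variances are root mean squares of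
quantities already controlled, so induction over the blocks gives `agg_scale` and the other forward
scales.

The backward direction has no such independence. After the first step the readout is a multiple of
the last aggregate, so the gradient at the output of a block depends on the very matrices with which
it is contracted. The dependence passes only through the forward pass, however: the gradient sees
the `W3` matrices of the block only through their product with the gated hidden states, and the
coefficients of `Q` and `W2` in the gradient at the block input see these matrices only through
their product with that input. For a Gaussian row, the components along a direction and orthogonal
to it are independent. Hence the orthogonal part can be redrawn without changing the law of the
parameters or the coefficients of the contraction (`gaussPi_prod_map_mixRows`,
`measurePreserving_resample`). Conditionally, the contraction becomes Gaussian, with a mean carried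
by the kept direction and a variance carried by the redrawn part.

Lower bounds need no control of the mean, because a Gaussian density of variance `v` is at most
`(2πv)^(-1/2)` (`gaussianReal_abs_lt_le`). A single coordinate vector has only a fraction of order
`1/N` of its squared length along the kept direction, so the variance has the full scale. Upper
bounds follow from conditional second moments and Markov's inequality; the means are controlled by
Cauchy–Schwarz and, for the router, by the boundedness of the product of the gate derivative and the
logit (`abs_dphi_mul_psi_le_one`). Lower bounds on root mean squares follow from those on single
entries (`LowP.rms`). The root mean square of the gate gradient also uses fourth moments of the
hidden states (`h2_pow_four_bdd`).

The backward induction rests on `bwdP_full_scale`, `bwdQ_scale` and `gradMix_scale`. Since the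
initial output vanishes almost surely, the first loss derivative is the constant `deriv ℓ 0`,
nonzero by the scale hypothesis, so the readout coefficient is deterministic. The remaining
gradients are scalar multiples or outer products of tensors with known scales, and the updates
multiply them by a rate and a loss derivative; bounds in probability multiply without independence.
-/

noncomputable section

set_option linter.unusedSectionVars false

namespace MoE

/-! ### Product Gaussian measures and their linear functionals -/

section GaussPi

variable {ι β : Type*} [Fintype ι] [Fintype β]

/-- The law of a vector of independent centered Gaussians with variances `v`. -/
def gaussPi (v : ι → ℝ≥0) : Measure (ι → ℝ) := Measure.pi fun i => gaussianReal 0 (v i)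

instance (v : ι → ℝ≥0) : IsProbabilityMeasure (gaussPi v) := by
  unfold gaussPi; infer_instance

/-- A linear functional of a product Gaussian vector is Gaussian. -/
theorem gaussPi_map_linear (v : ι → ℝ≥0) (a : ι → ℝ) :
    (gaussPi v).map (fun x => ∑ i, a i * x i) =
      gaussianReal 0 (∑ i, a i ^ 2 * (v i : ℝ)).toNNReal := by
  have hm : Measurable fun x : ι → ℝ => ∑ i, a i * x i := by fun_prop
  have : IsProbabilityMeasure ((gaussPi v).map (fun x => ∑ i, a i * x i)) :=
    Measure.isProbabilityMeasure_map hm.aemeasurable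
  refine Measure.ext_of_charFun ?_
  ext t
  have hV : 0 ≤ ∑ i, a i ^ 2 * (v i : ℝ) := Finset.sum_nonneg fun i _ => by positivity
  rw [charFun_gaussianReal, charFun_apply_real, integral_map hm.aemeasurable (by fun_prop)]
  have h1 : ∀ x : ι → ℝ, Complex.exp (t * ((∑ i, a i * x i : ℝ) : ℂ) * Complex.I) =
      ∏ i, Complex.exp (((t * a i : ℝ) : ℂ) * (x i : ℂ) * Complex.I) := by
    intro x
    rw [← Complex.exp_sum]
    congr 1
    push_cast
    rw [Finset.mul_sum, Finset.sum_mul]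
    exact Finset.sum_congr rfl fun i _ => by ring
  simp_rw [h1]
  rw [gaussPi, integral_fintype_prod_eq_prod
    (f := fun i (y : ℝ) => Complex.exp (((t * a i : ℝ) : ℂ) * (y : ℂ) * Complex.I))]
  simp_rw [← charFun_apply_real, charFun_gaussianReal]
  rw [← Complex.exp_sum]
  congr 1
  rw [Real.coe_toNNReal _ hV]
  push_cast
  simp only [mul_zero, zero_mul, zero_sub]
  rw [Finset.sum_neg_distrib, ← Finset.sum_div, Finset.sum_mul]
  congr 2
  exact Finset.sum_congr rfl fun i _ => by ring

/-- Two finite measures on a finite product of lines agree if all linear functionals have the same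
law under both. -/
theorem measure_ext_of_linear {μ ν : Measure (ι → ℝ)} [IsFiniteMeasure μ] [IsFiniteMeasure ν]
    (h : ∀ a : ι → ℝ, μ.map (fun x => ∑ i, a i * x i) = ν.map (fun x => ∑ i, a i * x i)) :
    μ = ν := by
  classical
  refine Measure.ext_of_charFunDual ?_
  ext L
  have hL : (L : (ι → ℝ) → ℝ) = fun x => ∑ i, L (Pi.single i 1) * x i := by
    ext x
    conv_lhs => rw [pi_eq_sum_univ' x]
    simp only [map_sum, map_smul, smul_eq_mul]
    exact Finset.sum_congr rfl fun i _ => by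
      rw [mul_comm]
  rw [charFunDual_eq_charFun_map_one, charFunDual_eq_charFun_map_one, hL, h]

/-- The sum of linear functionals of two independent product Gaussian vectors is Gaussian. -/
theorem gaussPi_prod_map_linear (v : ι → ℝ≥0) (w : β → ℝ≥0) (a : ι → ℝ) (b : β → ℝ) :
    ((gaussPi v).prod (gaussPi w)).map (fun z => ∑ i, a i * z.1 i + ∑ j, b j * z.2 j) =
      gaussianReal 0 (∑ i, a i ^ 2 * (v i : ℝ) + ∑ j, b j ^ 2 * (w j : ℝ)).toNNReal := by
  have ha : Measurable fun x : ι → ℝ => ∑ i, a i * x i := by fun_prop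
  have hb : Measurable fun x : β → ℝ => ∑ i, b i * x i := by fun_prop
  rw [Real.toNNReal_add (Finset.sum_nonneg fun i _ => by positivity)
    (Finset.sum_nonneg fun i _ => by positivity)]
  have h := gaussianReal_conv_gaussianReal (m₁ := 0) (m₂ := 0)
    (v₁ := (∑ i, a i ^ 2 * (v i : ℝ)).toNNReal) (v₂ := (∑ j, b j ^ 2 * (w j : ℝ)).toNNReal)
  rw [zero_add] at h
  rw [← h, ← gaussPi_map_linear, ← gaussPi_map_linear, Measure.conv,
    Measure.map_prod_map _ _ ha hb, Measure.map_map (by fun_prop) (by fun_prop)]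
  rfl

/-- Replacing some coordinates of a product Gaussian vector by fresh ones keeps the law. -/
theorem measurePreserving_extend (v : ι → ℝ≥0) {e : β → ι} (he : Function.Injective e) :
    MeasurePreserving (fun z : (ι → ℝ) × (β → ℝ) => Function.extend e z.2 z.1)
      ((gaussPi v).prod (gaussPi fun b => v (e b))) (gaussPi v) := by
  classical
  have hm : Measurable fun z : (ι → ℝ) × (β → ℝ) => Function.extend e z.2 z.1 := by
    refine measurable_pi_lambda _ fun p => ?_
    by_cases hp : ∃ b, e b = p
    · obtain ⟨b, rfl⟩ := hp
      simp only [he.extend_apply]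
      fun_prop
    · simp only [Function.extend_apply' _ _ _ hp]
      fun_prop
  have hsum : ∀ (F : ι → ℝ), ∑ p, F p =
      ∑ p, (if ∃ b, e b = p then 0 else F p) + ∑ b, F (e b) := by
    intro F
    have h1 : ∑ b, F (e b) = ∑ p, if ∃ b, e b = p then F p else 0 := by
      rw [← Finset.sum_filter]
      refine (Finset.sum_map Finset.univ ⟨e, he⟩ F).symm.trans
        (Finset.sum_congr ?_ fun _ _ => rfl)
      ext p; simp
    rw [h1, ← Finset.sum_add_distrib]
    exact Finset.sum_congr rfl fun p _ => by split_ifs <;> simp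
  refine ⟨hm, ?_⟩
  have : IsProbabilityMeasure (((gaussPi v).prod (gaussPi fun b => v (e b))).map
      fun z => Function.extend e z.2 z.1) := Measure.isProbabilityMeasure_map hm.aemeasurable
  -- Both laws are Gaussian with the same variance: each coefficient `a p` is charged either to the
  -- old coordinate or to the fresh one that replaces it.
  refine measure_ext_of_linear fun a => ?_
  rw [Measure.map_map (by fun_prop) hm, gaussPi_map_linear]
  have hf : (fun x : ι → ℝ => ∑ i, a i * x i) ∘
      (fun z : (ι → ℝ) × (β → ℝ) => Function.extend e z.2 z.1) =
      fun z => ∑ i, (if ∃ b, e b = i then 0 else a i) * z.1 i + ∑ b, a (e b) * z.2 b := by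
    ext z
    simp only [Function.comp]
    rw [hsum]
    congr 1
    · refine Finset.sum_congr rfl fun p _ => ?_
      split_ifs with hp
      · simp
      · rw [Function.extend_apply' _ _ _ hp]
    · exact Finset.sum_congr rfl fun b _ => by rw [he.extend_apply]
  rw [hf, gaussPi_prod_map_linear, hsum fun i => a i ^ 2 * (v i : ℝ)]
  congr 3
  exact Finset.sum_congr rfl fun p _ => by split_ifs <;> simp

end GaussPi

/-! ### Resampling a Gaussian matrix orthogonally to a direction -/

section Resample

variable {ι R C : Type*} [Fintype ι] [Fintype R] [Fintype C]

/-- The matrix with the part of the rows of `X` along `u` and the part of the rows of `Y`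
orthogonal to `u`. -/
def mixRows (u : C → ℝ) (X Y : R × C → ℝ) : R × C → ℝ := fun p =>
  (∑ c, X (p.1, c) * u c) / (∑ c, u c ^ 2) * u p.2 +
    (Y p - (∑ c, Y (p.1, c) * u c) / (∑ c, u c ^ 2) * u p.2)

/-- The rows `X` keep their component along `u` when they are mixed. -/
theorem mixRows_mul (u : C → ℝ) (X Y : R × C → ℝ) (r : R) :
    ∑ c, mixRows u X Y (r, c) * u c = ∑ c, X (r, c) * u c := by
  -- For `u = 0` division by zero gives zero, so `mixRows` returns `Y` itself. The zero direction
  -- therefore serves later as full resampling.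
  by_cases hu : ∑ c, u c ^ 2 = 0
  · have : ∀ c, u c = 0 := fun c => by
      have := (Finset.sum_eq_zero_iff_of_nonneg fun c _ => sq_nonneg (u c)).1 hu c
        (Finset.mem_univ c)
      simpa using this
    simp [this]
  · simp only [mixRows, add_mul, sub_mul, Finset.sum_add_distrib, Finset.sum_sub_distrib]
    have : ∀ A : ℝ, ∑ c, A / (∑ c, u c ^ 2) * u c * u c = A := fun A => by
      have h : ∀ c, A / (∑ c, u c ^ 2) * u c * u c = A / (∑ c, u c ^ 2) * u c ^ 2 :=
        fun c => by ring
      simp_rw [h, ← Finset.mul_sum]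
      field_simp
    rw [this, this]
    ring

/-- A rank one functional of mixed rows. -/
theorem sum_mixRows (u : C → ℝ) (X Y : R × C → ℝ) (ρ : R → ℝ) (κ : C → ℝ) :
    ∑ p : R × C, ρ p.1 * κ p.2 * mixRows u X Y p =
      (∑ c, κ c * u c) / (∑ c, u c ^ 2) * ∑ r, ρ r * ∑ c, X (r, c) * u c +
        ∑ p : R × C, ρ p.1 * (κ p.2 - (∑ c, κ c * u c) / (∑ c, u c ^ 2) * u p.2) * Y p := by
  have key : ∀ Z : R × C → ℝ, ∑ p : R × C, ρ p.1 * κ p.2 *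
      ((∑ c, Z (p.1, c) * u c) / (∑ c, u c ^ 2) * u p.2) =
      (∑ c, κ c * u c) / (∑ c, u c ^ 2) * ∑ r, ρ r * ∑ c, Z (r, c) * u c := by
    intro Z
    rw [Fintype.sum_prod_type, Finset.mul_sum]
    refine Finset.sum_congr rfl fun r _ => ?_
    rw [Finset.sum_div, Finset.sum_mul]
    exact Finset.sum_congr rfl fun c _ => by ring
  have h2 : ∑ p : R × C, ρ p.1 * (∑ c, κ c * u c) / (∑ c, u c ^ 2) * u p.2 * Y p =
      (∑ c, κ c * u c) / (∑ c, u c ^ 2) * ∑ r, ρ r * ∑ c, Y (r, c) * u c := by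
    rw [Fintype.sum_prod_type, Finset.mul_sum]
    refine Finset.sum_congr rfl fun r _ => ?_
    rw [Finset.mul_sum, Finset.mul_sum]
    exact Finset.sum_congr rfl fun c _ => by ring
  have h3 : ∀ p : R × C, ρ p.1 * κ p.2 * mixRows u X Y p = ρ p.1 * κ p.2 *
      ((∑ c, X (p.1, c) * u c) / (∑ c, u c ^ 2) * u p.2) + (ρ p.1 * κ p.2 * Y p - ρ p.1 * κ p.2 *
      ((∑ c, Y (p.1, c) * u c) / (∑ c, u c ^ 2) * u p.2)) := fun p => by
    rw [mixRows]; ring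
  have h4 : ∀ p : R × C, ρ p.1 * (κ p.2 - (∑ c, κ c * u c) / (∑ c, u c ^ 2) * u p.2) * Y p =
      ρ p.1 * κ p.2 * Y p - ρ p.1 * (∑ c, κ c * u c) / (∑ c, u c ^ 2) * u p.2 * Y p :=
    fun p => by ring
  simp_rw [h3, h4, Finset.sum_add_distrib, Finset.sum_sub_distrib]
  rw [key, key, h2]

/-- The squared length of the component of `κ` orthogonal to `u`. -/
def perpSq (u κ : C → ℝ) : ℝ := ∑ c, κ c ^ 2 - (∑ c, κ c * u c) ^ 2 / ∑ c, u c ^ 2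

/-- Pythagoras. For `u = 0` the projection is zero by the convention on division. -/
theorem sum_perp_sq (u κ : C → ℝ) :
    ∑ c, (κ c - (∑ c, κ c * u c) / (∑ c, u c ^ 2) * u c) ^ 2 = perpSq u κ := by
  have h : ∀ c, (κ c - (∑ c, κ c * u c) / (∑ c, u c ^ 2) * u c) ^ 2 =
      κ c ^ 2 - 2 * ((∑ c, κ c * u c) / (∑ c, u c ^ 2)) * (κ c * u c) +
      ((∑ c, κ c * u c) / (∑ c, u c ^ 2)) ^ 2 * u c ^ 2 := fun c => by ring
  simp_rw [h, Finset.sum_add_distrib, Finset.sum_sub_distrib, ← Finset.mul_sum]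
  by_cases hu : ∑ c, u c ^ 2 = 0
  · simp [perpSq, hu]
  · rw [perpSq]
    field_simp
    ring

theorem perpSq_nonneg (u κ : C → ℝ) : 0 ≤ perpSq u κ := by
  rw [← sum_perp_sq]; positivity

theorem perpSq_le (u κ : C → ℝ) : perpSq u κ ≤ ∑ c, κ c ^ 2 :=
  sub_le_self _ (div_nonneg (sq_nonneg _) (Finset.sum_nonneg fun _ _ => sq_nonneg _))

@[simp] theorem perpSq_zero (κ : C → ℝ) : perpSq 0 κ = ∑ c, κ c ^ 2 := by simp [perpSq]

/-- The components of a Gaussian row along `u` and orthogonal to `u` are independent, so the second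
may come from an independent copy. In terms of linear functionals: the coefficients split into a
part along `u`, tested on `X`, and a part orthogonal to `u`, tested on `Y`, and their squared
lengths add up row by row. -/
theorem gaussPi_prod_map_mixRows (σ : ℝ≥0) (u : C → ℝ) :
    ((gaussPi fun _ : R × C => σ).prod (gaussPi fun _ : R × C => σ)).map
      (fun z => mixRows u z.1 z.2) = gaussPi fun _ => σ := by
  have hm : Measurable fun z : (R × C → ℝ) × (R × C → ℝ) => mixRows u z.1 z.2 := by
    unfold mixRows; fun_prop
  have : IsProbabilityMeasure (((gaussPi fun _ : R × C => σ).prod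
      (gaussPi fun _ : R × C => σ)).map (fun z => mixRows u z.1 z.2)) :=
    Measure.isProbabilityMeasure_map hm.aemeasurable
  refine measure_ext_of_linear fun a => ?_
  rw [Measure.map_map (by fun_prop) hm, gaussPi_map_linear]
  set m : R → ℝ := fun r => (∑ c, a (r, c) * u c) / (∑ c, u c ^ 2) with hmdef
  have key : ∀ Z : R × C → ℝ, ∑ p : R × C, a p *
      ((∑ c, Z (p.1, c) * u c) / (∑ c, u c ^ 2) * u p.2) = ∑ p : R × C, m p.1 * u p.2 * Z p := by
    intro Z
    rw [Fintype.sum_prod_type, Fintype.sum_prod_type]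
    refine Finset.sum_congr rfl fun r _ => ?_
    simp only [hmdef]
    have h1 : ∀ c, a (r, c) * ((∑ c, Z (r, c) * u c) / (∑ c, u c ^ 2) * u c) =
      a (r, c) * u c * ((∑ c, Z (r, c) * u c) / (∑ c, u c ^ 2)) := fun c => by ring
    have h2 : ∀ c, (∑ c, a (r, c) * u c) / (∑ c, u c ^ 2) * u c * Z (r, c) =
      (∑ c, a (r, c) * u c) / (∑ c, u c ^ 2) * (Z (r, c) * u c) := fun c => by ring
    simp_rw [h1, h2, ← Finset.sum_mul, ← Finset.mul_sum]
    ring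
  have hf : (fun x : R × C → ℝ => ∑ i, a i * x i) ∘
      (fun z : (R × C → ℝ) × (R × C → ℝ) => mixRows u z.1 z.2) =
      fun z => ∑ p, (m p.1 * u p.2) * z.1 p + ∑ p, (a p - m p.1 * u p.2) * z.2 p := by
    ext z
    simp only [Function.comp, mixRows, mul_add, mul_sub, sub_mul, Finset.sum_add_distrib,
      Finset.sum_sub_distrib]
    rw [key, key]
  rw [hf, gaussPi_prod_map_linear]
  congr 2
  rw [← Finset.sum_add_distrib, Fintype.sum_prod_type, Fintype.sum_prod_type]
  refine Finset.sum_congr rfl fun r _ => ?_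
  simp_rw [← add_mul, ← Finset.sum_mul]
  congr 1
  rw [Finset.sum_add_distrib]
  have h1 := sum_perp_sq u fun c => a (r, c)
  rw [h1]
  simp_rw [hmdef, mul_pow, ← Finset.mul_sum]
  by_cases hu : ∑ c, u c ^ 2 = 0
  · simp [perpSq, hu]
  · rw [perpSq]
    field_simp
    ring

variable (e : R × C → ι) (u : (ι → ℝ) → C → ℝ)

/-- Resample the block of coordinates in the range of `e`, a matrix, orthogonally to the
direction `u`. -/
def resample (z : (ι → ℝ) × (R × C → ℝ)) : ι → ℝ :=
  Function.extend e (mixRows (u z.1) (fun p => z.1 (e p)) z.2) z.1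

variable {e u}

theorem resample_apply (he : Function.Injective e) (z : (ι → ℝ) × (R × C → ℝ)) (p : R × C) :
    resample e u z (e p) = mixRows (u z.1) (fun p => z.1 (e p)) z.2 p := he.extend_apply _ _ _

theorem resample_apply_of_notMem (z : (ι → ℝ) × (R × C → ℝ)) {p : ι} (hp : ∀ q, e q ≠ p) :
    resample e u z p = z.1 p := Function.extend_apply' _ _ _ (by simpa using hp)

/-- The direction is random, but by `hue` it is a function of the coordinates outside the block.
Given these coordinates it is fixed and the block is still Gaussian, so the statement for a fixed
direction applies conditionally. -/
theorem measurePreserving_resample (v : ι → ℝ≥0) (σ : ℝ≥0) (he : Function.Injective e)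
    (hv : ∀ p, v (e p) = σ) (hu : Measurable u)
    (hue : ∀ θ y, u (Function.extend e y θ) = u θ) :
    MeasurePreserving (resample e u) ((gaussPi v).prod (gaussPi fun _ => σ)) (gaussPi v) := by
  have hm : Measurable (resample e u) := by
    refine measurable_pi_lambda _ fun p => ?_
    by_cases hp : ∃ b, e b = p
    · obtain ⟨b, rfl⟩ := hp
      simp only [resample_apply he, mixRows]
      fun_prop
    · have hp' : ∀ q, e q ≠ p := by simpa using hp
      simp only [resample_apply_of_notMem _ hp']
      fun_prop
  have hΦ := measurePreserving_extend v he
  simp_rw [hv] at hΦ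
  set γ : Measure (R × C → ℝ) := gaussPi fun _ => σ
  -- With `θ` fixed the direction `u θ` is fixed, so mixing two independent copies of the block
  -- gives one copy.
  have hskew : MeasurePreserving
      (fun z : (ι → ℝ) × ((R × C → ℝ) × (R × C → ℝ)) => (z.1, mixRows (u z.1) z.2.1 z.2.2))
      ((gaussPi v).prod (γ.prod γ)) ((gaussPi v).prod γ) := by
    refine (MeasurePreserving.id _).skew_product 
      (g := fun θ (y : (R × C → ℝ) × (R × C → ℝ)) => mixRows (u θ) y.1 y.2) ?_
      (ae_of_all _ fun θ => gaussPi_prod_map_mixRows σ (u θ))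
    unfold mixRows Function.uncurry
    fun_prop
  have h3 := (hΦ.comp hskew).comp (measurePreserving_prodAssoc (gaussPi v) γ γ)
  have h4 := hΦ.prod (MeasurePreserving.id γ)
  refine ⟨hm, ?_⟩
  -- The base vector is represented as `θ` with its block replaced by a fresh `y`. Resampling this
  -- vector amounts to mixing `y` with `Y` first and inserting the result into `θ` afterwards.
  rw [← h4.map_eq, Measure.map_map hm h4.measurable]
  convert h3.map_eq using 2
  ext ⟨⟨θ, y⟩, Y⟩ p
  simp only [Function.comp, resample, Prod.map, MeasurableEquiv.prodAssoc, hue, id,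
    MeasurableEquiv.coe_mk, Equiv.prodAssoc_apply, he.extend_apply]
  by_cases hp : ∃ b, e b = p
  · obtain ⟨b, rfl⟩ := hp
    simp only [he.extend_apply]
  · simp only [Function.extend_apply' _ _ _ hp]

end Resample

end MoE

end

noncomputable section

namespace MoE

/-! ### Gaussian estimates -/

/-- Small ball estimate for a real Gaussian. -/
theorem gaussianReal_abs_lt_le (b : ℝ) {v δ : ℝ} (hv : 0 < v) :
    gaussianReal b v.toNNReal {x | |x| < δ} ≤ ENNReal.ofReal (δ / √v) := by
  have hv' : v.toNNReal ≠ 0 := by simpa using hv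
  rw [gaussianReal_apply _ hv']
  -- The bound on the density is uniform in the mean `b`; this is why lower bounds never require
  -- information on conditional means.
  have hpdf : ∀ x, gaussianPDF b v.toNNReal x ≤ ENNReal.ofReal ((√(2 * Real.pi * v))⁻¹) := by
    intro x
    rw [gaussianPDF, gaussianPDFReal, Real.coe_toNNReal _ hv.le]
    refine ENNReal.ofReal_le_ofReal (mul_le_of_le_one_right (by positivity) ?_)
    rw [Real.exp_le_one_iff, neg_div]
    exact neg_nonpos.2 (by positivity)
  have hs : {x : ℝ | |x| < δ} = Set.Ioo (-δ) δ := by ext; simp [abs_lt]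
  calc _ ≤ ∫⁻ _ in {x : ℝ | |x| < δ}, ENNReal.ofReal ((√(2 * Real.pi * v))⁻¹) :=
        lintegral_mono fun x => hpdf x
    _ = ENNReal.ofReal ((√(2 * Real.pi * v))⁻¹) * ENNReal.ofReal (2 * δ) := by
        rw [lintegral_const, Measure.restrict_apply_univ, hs, Real.volume_Ioo]
        ring_nf
    _ = ENNReal.ofReal ((√(2 * Real.pi * v))⁻¹ * (2 * δ)) :=
        (ENNReal.ofReal_mul (by positivity)).symm
    _ ≤ ENNReal.ofReal (δ / √v) := by
        rcases le_or_gt δ 0 with hδ | hδ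
        · rw [ENNReal.ofReal_of_nonpos]
          · simp
          · exact mul_nonpos_of_nonneg_of_nonpos (by positivity) (by linarith)
        refine ENNReal.ofReal_le_ofReal ?_
        -- Absorbs the length `2 * δ` of the interval, leaving `δ / √v`.
        have h2 : 2 ≤ √(2 * Real.pi) := by
          rw [Real.le_sqrt (by norm_num) (by positivity)]
          nlinarith [Real.pi_gt_three]
        have hsv : 0 < √v := Real.sqrt_pos.2 hv
        rw [Real.sqrt_mul (by positivity), inv_mul_eq_div, div_le_div_iff₀ (by positivity) hsv]
        nlinarith [mul_pos hδ hsv]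

theorem lintegral_sq_gaussianReal (b : ℝ) {v : ℝ} (hv : 0 ≤ v) :
    ∫⁻ x, ENNReal.ofReal (x ^ 2) ∂gaussianReal b v.toNNReal = ENNReal.ofReal (b ^ 2 + v) := by
  have hmem : MemLp id 2 (gaussianReal b v.toNNReal) := memLp_id_gaussianReal' 2 (by simp)
  have hInt : Integrable (fun x : ℝ => x ^ 2) (gaussianReal b v.toNNReal) := hmem.integrable_sq
  rw [← ofReal_integral_eq_lintegral_ofReal hInt (ae_of_all _ fun x => sq_nonneg _)]
  congr 1
  have h := variance_eq_sub hmem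
  rw [variance_id_gaussianReal] at h
  simp only [id, integral_id_gaussianReal, Real.coe_toNNReal _ hv, Pi.pow_apply] at h
  linarith

/-- The fourth moment of a standard Gaussian. -/
def fourthMoment : ℝ := ∫ x, x ^ 4 ∂gaussianReal 0 1

theorem fourthMoment_nonneg : 0 ≤ fourthMoment := integral_nonneg fun x => by positivity

theorem lintegral_pow_four_gaussianReal {v : ℝ} (hv : 0 ≤ v) :
    ∫⁻ x, ENNReal.ofReal (x ^ 4) ∂gaussianReal 0 v.toNNReal =
      ENNReal.ofReal (fourthMoment * v ^ 2) := by
  have h := gaussianReal_map_const_mul (μ := 0) (v := 1) (√v)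
  have hv' : NNReal.mk (√v ^ 2) (sq_nonneg _) * 1 = v.toNNReal := by
    ext; simp [Real.sq_sqrt hv, hv]
  rw [mul_zero, hv'] at h
  have hmem : MemLp id 4 (gaussianReal 0 1) := memLp_id_gaussianReal' 4 (by simp)
  have hInt : Integrable (fun x : ℝ => x ^ 4) (gaussianReal 0 1) := by
    have := hmem.integrable_norm_pow (p := 4) (by norm_num)
    refine this.congr (ae_of_all _ fun x => ?_)
    simp only [id, Real.norm_eq_abs]
    exact Even.pow_abs (by decide) x
  rw [← h, lintegral_map (by fun_prop) (by fun_prop), fourthMoment,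
    ← integral_mul_const, ofReal_integral_eq_lintegral_ofReal (hInt.mul_const _)
      (ae_of_all _ fun x => by positivity)]
  refine lintegral_congr fun x => ?_
  congr 1
  rw [mul_pow, mul_comm, show (4 : ℕ) = 2 * 2 from rfl, pow_mul (√v), Real.sq_sqrt hv]

/-! ### Conditional small ball and Markov estimates on a product space -/

section Conditional

variable {Ω Γ : Type*} [MeasurableSpace Ω] [MeasurableSpace Γ] {μ : Measure Ω} {γ : Measure Γ}
  [IsProbabilityMeasure μ] [IsProbabilityMeasure γ]

/-- Fubini: a section over `B` has measure at most one, any other at most `r`. Since `B` need not be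
measurable, its measurable hull is integrated instead. -/
theorem prod_measure_le_of_section_le {S : Set (Ω × Γ)} (hS : MeasurableSet S) (B : Set Ω)
    (r : ℝ≥0∞) (h : ∀ ω ∉ B, γ {y | (ω, y) ∈ S} ≤ r) : (μ.prod γ) S ≤ μ B + r := by
  rw [Measure.prod_apply hS]
  calc ∫⁻ ω, γ (Prod.mk ω ⁻¹' S) ∂μ
      ≤ ∫⁻ ω, ((toMeasurable μ B).indicator 1 ω + r) ∂μ := by
        refine lintegral_mono fun ω => ?_
        by_cases hω : ω ∈ toMeasurable μ B
        · simp only [hω, Set.indicator_of_mem, Pi.one_apply]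
          exact prob_le_one.trans le_self_add
        · simp only [hω, not_false_eq_true, Set.indicator_of_notMem, zero_add]
          exact h ω fun hB => hω (subset_toMeasurable μ B hB)
    _ = μ B + r := by
        rw [lintegral_add_right _ measurable_const, lintegral_indicator_one
          (measurableSet_toMeasurable _ _), measure_toMeasurable]
        simp

/-- Small ball estimate for a conditionally Gaussian variable. -/
theorem prod_measure_abs_lt_le {X : Ω × Γ → ℝ} (hX : Measurable X) {b V : Ω → ℝ} (hV0 : ∀ ω, 0 ≤ V ω)
    (hlaw : ∀ ω, γ.map (fun y => X (ω, y)) = gaussianReal (b ω) (V ω).toNNReal)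
    {δ v₀ : ℝ} (hδ : 0 ≤ δ) (hv₀ : 0 < v₀) :
    (μ.prod γ) {z | |X z| < δ} ≤ μ {ω | |V ω| < v₀} + ENNReal.ofReal (δ / √v₀) := by
  refine prod_measure_le_of_section_le (measurableSet_lt (by fun_prop) measurable_const)
    {ω | |V ω| < v₀} _ fun ω hω => ?_
  have hV : v₀ ≤ V ω := by simpa [abs_of_nonneg (hV0 ω)] using hω
  have h := gaussianReal_abs_lt_le (δ := δ) (b ω) (hv₀.trans_le hV)
  rw [← hlaw, Measure.map_apply (by fun_prop) (measurableSet_lt (by fun_prop) measurable_const)]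
    at h
  refine h.trans (ENNReal.ofReal_le_ofReal ?_)
  have := Real.sqrt_pos.2 hv₀
  gcongr

/-- Markov's inequality with a conditional expectation bound. -/
theorem prod_measure_lt_le {F : Ω × Γ → ℝ} (hF : Measurable F) {B : Ω → ℝ}
    (hB : ∀ ω, ∫⁻ y, ENNReal.ofReal (F (ω, y)) ∂γ ≤ ENNReal.ofReal (B ω))
    {β l : ℝ} (hl : 0 < l) :
    (μ.prod γ) {z | l < F z} ≤ μ {ω | β < B ω} + ENNReal.ofReal (β / l) := by
  refine prod_measure_le_of_section_le (measurableSet_lt measurable_const hF)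
    {ω | β < B ω} _ fun ω hω => ?_
  have hω : B ω ≤ β := by simpa using hω
  have h1 : γ {y | l < F (ω, y)} ≤ γ {y | ENNReal.ofReal l ≤ ENNReal.ofReal (F (ω, y))} :=
    measure_mono fun y hy => ENNReal.ofReal_le_ofReal (le_of_lt hy)
  refine h1.trans ((meas_ge_le_lintegral_div (by fun_prop) (by simpa using hl) (by simp)).trans ?_)
  rw [ENNReal.ofReal_div_of_pos hl]
  gcongr
  exact (hB ω).trans (ENNReal.ofReal_le_ofReal hω)

end Conditional

end MoE

end

noncomputable section

namespace MoE

/-! ### Calculus of one-sided orders in probability -/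

section Asymptotic

variable {Ω : ℕ → Type*} [∀ n, MeasurableSpace (Ω n)] {μ : ∀ n, Measure (Ω n)}
  {ι κ : ℕ → Type} {X Y : ∀ n, Ω n → ι n → ℝ} {α β : ℕ → ℝ}

/-- `X` is `O(α)` in probability, uniformly over the index. -/
def BddP (μ : ∀ n, Measure (Ω n)) (X : ∀ n, Ω n → ι n → ℝ) (α : ℕ → ℝ) : Prop :=
  ∀ ε : ℝ, 0 < ε → ∃ C : ℝ, 0 < C ∧ ∀ᶠ n in atTop, ∀ j,
    μ n {ω | C * α n < |X n ω j|} ≤ ENNReal.ofReal ε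

/-- `X` is `Ω(α)` in probability, uniformly over the index. -/
def LowP (μ : ∀ n, Measure (Ω n)) (X : ∀ n, Ω n → ι n → ℝ) (α : ℕ → ℝ) : Prop :=
  ∀ ε : ℝ, 0 < ε → ∃ c : ℝ, 0 < c ∧ ∀ᶠ n in atTop, ∀ j,
    μ n {ω | |X n ω j| < c * α n} ≤ ENNReal.ofReal ε

theorem measure_union_le_ofReal {S : Type*} [MeasurableSpace S] {ν : Measure S} {A B T : Set S}
    {ε : ℝ} (hε : 0 < ε) (h : T ⊆ A ∪ B) (hA : ν A ≤ ENNReal.ofReal (ε / 2))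
    (hB : ν B ≤ ENNReal.ofReal (ε / 2)) : ν T ≤ ENNReal.ofReal ε := by
  calc ν T ≤ ν A + ν B := (measure_mono h).trans (measure_union_le _ _)
    _ ≤ ENNReal.ofReal (ε / 2) + ENNReal.ofReal (ε / 2) := add_le_add hA hB
    _ = ENNReal.ofReal ε := by
      rw [← ENNReal.ofReal_add (by positivity) (by positivity), add_halves]

/-- Deduce a bound in probability from one other bound, by a deterministic inequality. -/
theorem BddP.of_le {Y : ∀ n, Ω n → κ n → ℝ} (hY : BddP μ Y β) (f : ∀ n, ι n → κ n)
    (h : ∀ C, 0 < C → ∃ C', 0 < C' ∧ ∀ᶠ n in atTop, ∀ ω j, |Y n ω (f n j)| ≤ C * β n →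
      |X n ω j| ≤ C' * α n) : BddP μ X α := by
  intro ε hε
  obtain ⟨C, hC, hY⟩ := hY ε hε
  obtain ⟨C', hC', h⟩ := h C hC
  refine ⟨C', hC', ?_⟩
  filter_upwards [hY, h] with n hn hn' j
  refine (measure_mono fun ω hω => ?_).trans (hn (f n j))
  by_contra hcon
  exact absurd (hn' ω j (not_lt.1 hcon)) (not_le.2 hω)

theorem LowP.of_le {Y : ∀ n, Ω n → κ n → ℝ} (hY : LowP μ Y β) (f : ∀ n, ι n → κ n)
    (h : ∀ c, 0 < c → ∃ c', 0 < c' ∧ ∀ᶠ n in atTop, ∀ ω j, c * β n ≤ |Y n ω (f n j)| →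
      c' * α n ≤ |X n ω j|) : LowP μ X α := by
  intro ε hε
  obtain ⟨C, hC, hY⟩ := hY ε hε
  obtain ⟨C', hC', h⟩ := h C hC
  refine ⟨C', hC', ?_⟩
  filter_upwards [hY, h] with n hn hn' j
  refine (measure_mono fun ω hω => ?_).trans (hn (f n j))
  by_contra hcon
  exact absurd (hn' ω j (not_lt.1 hcon)) (not_le.2 hω)

/-- Serves quantities that are bounded below as long as another one stays bounded: sigmoids of
bounded logits, or `1 - Y` for small `Y`. -/
theorem BddP.lowP_of {Y : ∀ n, Ω n → κ n → ℝ} (hY : BddP μ Y β) (f : ∀ n, ι n → κ n)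
    (h : ∀ C, 0 < C → ∃ c', 0 < c' ∧ ∀ᶠ n in atTop, ∀ ω j, |Y n ω (f n j)| ≤ C * β n →
      c' * α n ≤ |X n ω j|) : LowP μ X α := by
  intro ε hε
  obtain ⟨C, hC, hY⟩ := hY ε hε
  obtain ⟨C', hC', h⟩ := h C hC
  refine ⟨C', hC', ?_⟩
  filter_upwards [hY, h] with n hn hn' j
  refine (measure_mono fun ω hω => ?_).trans (hn (f n j))
  by_contra hcon
  exact absurd (hn' ω j (not_lt.1 hcon)) (not_le.2 hω)

theorem BddP.comp {X : ∀ n, Ω n → κ n → ℝ} (h : BddP μ X α) (f : ∀ n, ι n → κ n) :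
    BddP μ (fun n ω j => X n ω (f n j)) α :=
  h.of_le f fun C hC => ⟨C, hC, Eventually.of_forall fun _ _ _ h => h⟩

theorem LowP.comp {X : ∀ n, Ω n → κ n → ℝ} (h : LowP μ X α) (f : ∀ n, ι n → κ n) :
    LowP μ (fun n ω j => X n ω (f n j)) α :=
  h.of_le f fun C hC => ⟨C, hC, Eventually.of_forall fun _ _ _ h => h⟩

theorem BddP.mono (h : BddP μ Y α) (hXY : ∀ᶠ n in atTop, ∀ ω j, |X n ω j| ≤ |Y n ω j|) :
    BddP μ X α :=
  h.of_le (fun _ j => j) fun C hC => ⟨C, hC, hXY.mono fun _ h ω j h' => (h ω j).trans h'⟩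

theorem LowP.mono (h : LowP μ Y α) (hXY : ∀ᶠ n in atTop, ∀ ω j, |Y n ω j| ≤ |X n ω j|) :
    LowP μ X α :=
  h.of_le (fun _ j => j) fun C hC => ⟨C, hC, hXY.mono fun _ h ω j h' => h'.trans (h ω j)⟩

theorem BddP.congr (h : BddP μ Y α) (hXY : ∀ᶠ n in atTop, ∀ ω j, X n ω j = Y n ω j) :
    BddP μ X α := h.mono (hXY.mono fun _ h ω j => (congrArg _ (h ω j)).le)

theorem LowP.congr (h : LowP μ Y α) (hXY : ∀ᶠ n in atTop, ∀ ω j, X n ω j = Y n ω j) :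
    LowP μ X α := h.mono (hXY.mono fun _ h ω j => (congrArg _ (h ω j)).ge)

theorem BddP.scale (h : BddP μ X α) {C : ℝ} (hC : 0 < C) (hαβ : ∀ᶠ n in atTop, α n ≤ C * β n) :
    BddP μ X β :=
  h.of_le (fun _ j => j) fun C' hC' => ⟨C' * C, by positivity, hαβ.mono fun n hn ω j h' => by
    rw [mul_assoc]; exact h'.trans (by gcongr)⟩

theorem LowP.scale (h : LowP μ X α) {C : ℝ} (hC : 0 < C) (hαβ : ∀ᶠ n in atTop, β n ≤ C * α n) :
    LowP μ X β :=
  h.of_le (fun _ j => j) fun c hc => ⟨c / C, by positivity, hαβ.mono fun n hn ω j h' =>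
    le_trans (by
      calc c / C * β n ≤ c / C * (C * α n) := by gcongr
        _ = c * α n := by field_simp) h'⟩

theorem BddP.mul (hX : BddP μ X α) (hY : BddP μ Y β) :
    BddP μ (fun n ω j => X n ω j * Y n ω j) (fun n => α n * β n) := by
  intro ε hε
  obtain ⟨C, hC, hX⟩ := hX (ε / 2) (by positivity)
  obtain ⟨C', hC', hY⟩ := hY (ε / 2) (by positivity)
  refine ⟨C * C', by positivity, ?_⟩
  filter_upwards [hX, hY] with n h1 h2 j
  refine measure_union_le_ofReal hε (fun ω hω => ?_) (h1 j) (h2 j)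
  by_contra hcon
  simp only [Set.mem_union, Set.mem_ofPred_eq, not_or, not_lt, abs_mul] at hcon hω
  have h3 := mul_le_mul hcon.1 hcon.2 (abs_nonneg _) ((abs_nonneg _).trans hcon.1)
  linarith

theorem LowP.mul (hX : LowP μ X α) (hY : LowP μ Y β) (hβ : ∀ᶠ n in atTop, 0 ≤ β n) :
    LowP μ (fun n ω j => X n ω j * Y n ω j) (fun n => α n * β n) := by
  intro ε hε
  obtain ⟨C, hC, hX⟩ := hX (ε / 2) (by positivity)
  obtain ⟨C', hC', hY⟩ := hY (ε / 2) (by positivity)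
  refine ⟨C * C', by positivity, ?_⟩
  filter_upwards [hX, hY, hβ] with n h1 h2 h3 j
  refine measure_union_le_ofReal hε (fun ω hω => ?_) (h1 j) (h2 j)
  by_contra hcon
  simp only [Set.mem_union, Set.mem_ofPred_eq, not_or, not_lt, abs_mul] at hcon hω
  have h4 := mul_le_mul hcon.1 hcon.2 (by positivity) (abs_nonneg _)
  linarith

theorem BddP.add (hX : BddP μ X α) (hY : BddP μ Y α) (hα : ∀ᶠ n in atTop, 0 ≤ α n) :
    BddP μ (fun n ω j => X n ω j + Y n ω j) α := by
  intro ε hε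
  obtain ⟨C, hC, hX⟩ := hX (ε / 2) (by positivity)
  obtain ⟨C', hC', hY⟩ := hY (ε / 2) (by positivity)
  refine ⟨C + C', by positivity, ?_⟩
  filter_upwards [hX, hY, hα] with n h1 h2 h3 j
  refine measure_union_le_ofReal hε (fun ω hω => ?_) (h1 j) (h2 j)
  by_contra hcon
  simp only [Set.mem_union, Set.mem_ofPred_eq, not_or, not_lt] at hcon hω
  have h4 := abs_add_le (X n ω j) (Y n ω j)
  linarith

theorem LowP.inv (hX : LowP μ X α) (hα : ∀ᶠ n in atTop, 0 < α n) :
    BddP μ (fun n ω j => (X n ω j)⁻¹) (fun n => (α n)⁻¹) := by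
  intro ε hε
  obtain ⟨c, hc, hX⟩ := hX ε hε
  refine ⟨c⁻¹, by positivity, ?_⟩
  filter_upwards [hX, hα] with n hn hα j
  refine (measure_mono fun ω hω => ?_).trans (hn j)
  by_contra hcon
  have hcon : c * α n ≤ |X n ω j| := not_lt.1 hcon
  have hω : c⁻¹ * (α n)⁻¹ < |(X n ω j)⁻¹| := hω
  rw [abs_inv, ← mul_inv] at hω
  exact absurd hω (not_lt.2 (inv_anti₀ (by positivity) hcon))

theorem BddP.div (hX : BddP μ X α) (hY : LowP μ Y β) (hβ : ∀ᶠ n in atTop, 0 < β n) :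
    BddP μ (fun n ω j => X n ω j / Y n ω j) (fun n => α n / β n) := by
  simpa only [div_eq_mul_inv] using hX.mul (hY.inv hβ)

theorem bddP_const {a : ℕ → ℝ} {C : ℝ} (hC : 0 < C) (h : ∀ᶠ n in atTop, |a n| ≤ C * α n) :
    BddP μ (fun n _ (_ : ι n) => a n) α := fun ε _ => ⟨C, hC, by
  filter_upwards [h] with n hn j
  simp [not_lt.2 hn]⟩

theorem lowP_const {a : ℕ → ℝ} {c : ℝ} (hc : 0 < c) (h : ∀ᶠ n in atTop, c * α n ≤ |a n|) :
    LowP μ (fun n _ (_ : ι n) => a n) α := fun ε _ => ⟨c, hc, by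
  filter_upwards [h] with n hn j
  simp [not_lt.2 hn]⟩

theorem BddP.of_sq (h : BddP μ (fun n ω j => X n ω j ^ 2) (fun n => α n ^ 2))
    (hα : ∀ᶠ n in atTop, 0 ≤ α n) : BddP μ X α :=
  h.of_le (fun _ j => j) fun C hC => ⟨√C, Real.sqrt_pos.2 hC, hα.mono fun n hn ω j h' => by
    rw [abs_of_nonneg (sq_nonneg _)] at h'
    have : √C * α n = √(C * α n ^ 2) := by rw [Real.sqrt_mul hC.le, Real.sqrt_sq hn]
    rw [this]
    exact Real.abs_le_sqrt h'⟩

theorem BddP.sq (h : BddP μ X α) : BddP μ (fun n ω j => X n ω j ^ 2) (fun n => α n ^ 2) := by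
  simpa only [_root_.sq] using h.mul h

theorem LowP.sq (h : LowP μ X α) (hα : ∀ᶠ n in atTop, 0 ≤ α n) :
    LowP μ (fun n ω j => X n ω j ^ 2) (fun n => α n ^ 2) := by
  simpa only [_root_.sq] using h.mul h hα

/-- If `Y` tends to zero in probability, then `1 - Y` stays away from zero. -/
theorem BddP.one_sub (h : BddP μ Y β) (hβ : Tendsto β atTop (𝓝 0)) :
    LowP μ (fun n ω j => 1 - Y n ω j) (fun _ => 1) :=
  h.lowP_of (fun _ j => j) fun C hC => ⟨1 / 2, by norm_num, by
    have h1 : Tendsto (fun n => C * β n) atTop (𝓝 0) := by simpa using hβ.const_mul C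
    filter_upwards [h1.eventually_lt_const (show (0 : ℝ) < 1 / 2 by norm_num)] with n hn ω j h'
    have h2 := (le_abs_self (Y n ω j)).trans h'
    exact le_trans (by linarith) (le_abs_self (1 - Y n ω j))⟩

theorem BddP.congr_ae (h : BddP μ Y α) (hXY : ∀ n, ∀ᵐ ω ∂μ n, ∀ j, X n ω j = Y n ω j) :
    BddP μ X α := by
  intro ε hε
  obtain ⟨C, hC, h⟩ := h ε hε
  refine ⟨C, hC, h.mono fun n hn j => le_trans (measure_mono_ae ?_) (hn j)⟩
  filter_upwards [hXY n] with ω hω h'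
  have hlt : C * α n < |X n ω j| := h'
  rw [hω j] at hlt
  exact hlt

theorem LowP.congr_ae (h : LowP μ Y α) (hXY : ∀ n, ∀ᵐ ω ∂μ n, ∀ j, X n ω j = Y n ω j) :
    LowP μ X α := by
  intro ε hε
  obtain ⟨C, hC, h⟩ := h ε hε
  refine ⟨C, hC, h.mono fun n hn j => le_trans (measure_mono_ae ?_) (hn j)⟩
  filter_upwards [hXY n] with ω hω h'
  have hlt : |X n ω j| < C * α n := h'
  rw [hω j] at hlt
  exact hlt

/-! ### Root mean squares -/

theorem rms_nonneg {ι : Type*} [Fintype ι] (v : ι → ℝ) : 0 ≤ rms v := Real.sqrt_nonneg _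

theorem rms_sq {ι : Type*} [Fintype ι] (v : ι → ℝ) :
    rms v ^ 2 = (∑ j, v j ^ 2) / Fintype.card ι :=
  Real.sq_sqrt (div_nonneg (Finset.sum_nonneg fun _ _ => sq_nonneg _) (Nat.cast_nonneg _))

theorem card_mul_rms_sq {ι : Type*} [Fintype ι] (v : ι → ℝ) :
    Fintype.card ι * rms v ^ 2 = ∑ j, v j ^ 2 := by
  rw [rms_sq]
  rcases isEmpty_or_nonempty ι with h | h
  · simp
  · field_simp

theorem rms_const_mul {ι : Type*} [Fintype ι] (c : ℝ) (v : ι → ℝ) :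
    rms (fun j => c * v j) = |c| * rms v := by
  rw [rms, rms, ← Real.sqrt_sq_eq_abs, ← Real.sqrt_mul (sq_nonneg _)]
  congr 1
  simp_rw [mul_pow, ← Finset.mul_sum, mul_div_assoc]

theorem rms_outer {ι κ : Type*} [Fintype ι] [Fintype κ] (v : ι → ℝ) (w : κ → ℝ) :
    rms (fun p : ι × κ => v p.1 * w p.2) = rms v * rms w := by
  rw [rms, rms, rms, ← Real.sqrt_mul
    (div_nonneg (Finset.sum_nonneg fun _ _ => sq_nonneg _) (Nat.cast_nonneg _))]
  congr 1
  rw [div_mul_div_comm, Fintype.card_prod, Nat.cast_mul, Fintype.sum_prod_type, Finset.sum_mul_sum]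
  simp_rw [mul_pow]

theorem rms_mono {ι : Type*} [Fintype ι] {v w : ι → ℝ} (h : ∀ j, |v j| ≤ |w j|) :
    rms v ≤ rms w := by
  refine Real.sqrt_le_sqrt (div_le_div_of_nonneg_right ?_ (Nat.cast_nonneg _))
  exact Finset.sum_le_sum fun j _ => sq_le_sq.2 (h j)

theorem measurable_rms {ι : Type*} [Fintype ι] : Measurable (rms : (ι → ℝ) → ℝ) := by
  unfold rms; fun_prop

/-- Families whose single entries stay away from zero in probability have root mean squares that
stay away from zero in probability. -/
theorem LowP.rms [∀ n, Fintype (ι n)] {X : ∀ n, Ω n → κ n → ι n → ℝ}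
    (h : LowP μ (fun n ω (p : κ n × ι n) => X n ω p.1 p.2) α)
    (hι : ∀ᶠ n in atTop, Nonempty (ι n)) (hα : ∀ᶠ n in atTop, 0 ≤ α n) :
    LowP μ (fun n ω i => MoE.rms (X n ω i)) α := by
  intro ε hε
  obtain ⟨c, hc, h⟩ := h (ε / 2) (by positivity)
  refine ⟨c / 2, by positivity, ?_⟩
  filter_upwards [h, hι, hα] with n hn hne hαn i
  set A : ι n → Set (Ω n) := fun j => toMeasurable (μ n) {ω | |X n ω i j| < c * α n} with hA
  have hAm : ∀ j, MeasurableSet (A j) := fun j => measurableSet_toMeasurable _ _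
  -- `F` dominates the number of small entries and has mean at most `J * (ε / 2)`. By Markov,
  -- outside an event of probability `ε` fewer than half of the entries are small, and then the mean
  -- square is at least `(c * α n) ^ 2 / 2`, more than enough for the constant `c / 2`.
  set F : Ω n → ℝ≥0∞ := fun ω => ∑ j, (A j).indicator 1 ω with hF
  set J : ℝ≥0∞ := (Fintype.card (ι n) : ℝ≥0∞) with hJ
  have hJ0 : J ≠ 0 := by simp [hJ]
  have hJt : J ≠ ∞ := by simp [hJ]
  have hFm : Measurable F := by
    refine Finset.measurable_sum _ fun j _ => ?_
    exact measurable_one.indicator (hAm j)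
  have hsub : {ω | |MoE.rms (X n ω i)| < c / 2 * α n} ⊆ {ω | J / 2 ≤ F ω} := by
    intro ω hω
    by_contra hcon
    simp only [Set.mem_ofPred_eq, not_le, abs_of_nonneg (rms_nonneg _)] at hcon hω
    classical
    set B : Finset (ι n) := Finset.univ.filter fun j => |X n ω i j| < c * α n with hB
    have hBF : (B.card : ℝ≥0∞) ≤ F ω := by
      rw [hF, Finset.card_eq_sum_ones, Nat.cast_sum, hB, Finset.sum_filter]
      refine Finset.sum_le_sum fun j _ => ?_
      split_ifs with hj
      · have : ω ∈ A j := subset_toMeasurable _ _ hj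
        simp [this]
      · simp
    have hBJ : (B.card : ℝ≥0∞) < J / 2 := hBF.trans_lt hcon
    have hBJ' : 2 * (B.card : ℝ) < Fintype.card (ι n) := by
      rw [ENNReal.lt_div_iff_mul_lt (by simp) (by simp), hJ] at hBJ
      have : B.card * 2 < Fintype.card (ι n) := by exact_mod_cast hBJ
      rw [mul_comm]
      exact_mod_cast this
    have hcard : (Fintype.card (ι n) : ℝ) = B.card + Bᶜ.card := by
      rw [← Finset.card_add_card_compl B]; push_cast; ring
    have hlow : (Bᶜ.card : ℝ) * (c * α n) ^ 2 ≤ ∑ j, X n ω i j ^ 2 := by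
      calc (Bᶜ.card : ℝ) * (c * α n) ^ 2 = ∑ j ∈ Bᶜ, (c * α n) ^ 2 := by simp
        _ ≤ ∑ j ∈ Bᶜ, X n ω i j ^ 2 := by
          refine Finset.sum_le_sum fun j hj => ?_
          have : c * α n ≤ |X n ω i j| := by
            simpa [hB] using hj
          rw [← sq_abs (X n ω i j)]
          gcongr
        _ ≤ _ := Finset.sum_le_sum_of_subset_of_nonneg (Finset.subset_univ _)
          fun _ _ _ => sq_nonneg _
    rw [← card_mul_rms_sq] at hlow
    have hr : MoE.rms (X n ω i) ^ 2 < (c / 2 * α n) ^ 2 := by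
      have := rms_nonneg (X n ω i)
      gcongr
    have hJpos : (0 : ℝ) < Fintype.card (ι n) := by exact_mod_cast Fintype.card_pos
    nlinarith [mul_lt_mul_of_pos_left hr hJpos, sq_nonneg (c * α n)]
  calc μ n {ω | |MoE.rms (X n ω i)| < c / 2 * α n} ≤ μ n {ω | J / 2 ≤ F ω} := measure_mono hsub
    _ ≤ (∫⁻ ω, F ω ∂μ n) / (J / 2) := meas_ge_le_lintegral_div hFm.aemeasurable
        (by simp [hJ0]) (ENNReal.div_ne_top hJt (by simp))
    _ ≤ (J * ENNReal.ofReal (ε / 2)) / (J / 2) := by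
        gcongr
        rw [hF, lintegral_finsetSum _ fun j _ => measurable_one.indicator (hAm j)]
        calc _ ≤ ∑ j : ι n, ENNReal.ofReal (ε / 2) := by
              refine Finset.sum_le_sum fun j _ => ?_
              rw [lintegral_indicator_one (hAm j), hA, measure_toMeasurable]
              exact hn (i, j)
          _ = _ := by simp [hJ]
    _ = ENNReal.ofReal ε := by
        rw [ENNReal.ofReal_div_of_pos (by norm_num)]
        simp only [ENNReal.ofReal_ofNat, div_eq_mul_inv]
        rw [ENNReal.mul_inv (by simp) (by simp), inv_inv]
        calc J * (ENNReal.ofReal ε * 2⁻¹) * (J⁻¹ * 2)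
            = (J * J⁻¹) * (2⁻¹ * 2) * ENNReal.ofReal ε := by ring
          _ = ENNReal.ofReal ε := by
            rw [ENNReal.mul_inv_cancel hJ0 hJt, ENNReal.inv_mul_cancel (by simp) (by simp)]; simp

/-! ### Coordinate scales from one-sided bounds -/

theorem uniformCoordScale_of [∀ n, Fintype (ι n)] {X : ∀ n, Ω n → κ n → ι n → ℝ}
    (hlow : LowP μ (fun n ω (p : κ n × ι n) => X n ω p.1 p.2) α)
    (hbdd : BddP μ (fun n ω (p : κ n × ι n) => X n ω p.1 p.2) α)
    (hlow' : LowP μ (fun n ω i => rms (X n ω i)) α)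
    (hbdd' : BddP μ (fun n ω i => rms (X n ω i)) α) : UniformCoordScale μ X α := by
  intro ε hε
  obtain ⟨c, hc, h1⟩ := hlow (ε / 2) (by positivity)
  obtain ⟨C, hC, h2⟩ := hbdd (ε / 2) (by positivity)
  obtain ⟨c', hc', h3⟩ := hlow' (ε / 2) (by positivity)
  obtain ⟨C', hC', h4⟩ := hbdd' (ε / 2) (by positivity)
  refine ⟨min c c', max C C', by positivity, by positivity, ?_⟩
  filter_upwards [h1, h2, h3, h4] with n h1 h2 h3 h4 i
  have key : ∀ Z : Ω n → ℝ, (∀ ω, 0 ≤ Z ω) → ∀ d D, min c c' ≤ d → 0 < d → D ≤ max C C' → 0 < D →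
      μ n {ω | Z ω < d * α n} ≤ ENNReal.ofReal (ε / 2) →
      μ n {ω | D * α n < Z ω} ≤ ENNReal.ofReal (ε / 2) →
      μ n {ω | ¬ (min c c' * α n ≤ Z ω ∧ Z ω ≤ max C C' * α n)} ≤ ENNReal.ofReal ε := by
    intro Z hZ d D hd hd0 hD hD0 hA hB
    refine measure_union_le_ofReal hε (fun ω hω => ?_) hA hB
    by_contra hcon
    simp only [Set.mem_union, Set.mem_ofPred_eq, not_or, not_lt] at hcon hω
    -- The sign of `α n` is not assumed: it follows from `0 ≤ Z ω ≤ D * α n`.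
    have hα : 0 ≤ α n := by
      have := (hZ ω).trans hcon.2
      exact nonneg_of_mul_nonneg_right this hD0
    exact hω ⟨le_trans (by gcongr) hcon.1, hcon.2.trans (by gcongr)⟩
  refine ⟨fun j => key _ (fun ω => abs_nonneg _) c C (min_le_left _ _) hc (le_max_left _ _) hC
    (h1 (i, j)) (h2 (i, j)), key _ (fun ω => rms_nonneg _) c' C' (min_le_right _ _) hc'
    (le_max_right _ _) hC' ?_ ?_⟩
  · simpa only [abs_of_nonneg (rms_nonneg _)] using h3 i
  · simpa only [abs_of_nonneg (rms_nonneg _)] using h4 i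

theorem UniformCoordScale.low [∀ n, Fintype (ι n)] {X : ∀ n, Ω n → κ n → ι n → ℝ}
    (h : UniformCoordScale μ X α) : LowP μ (fun n ω (p : κ n × ι n) => X n ω p.1 p.2) α := by
  intro ε hε
  obtain ⟨c, C, hc, hC, h⟩ := h ε hε
  exact ⟨c, hc, h.mono fun n hn p => (measure_mono fun ω hω h' => absurd h'.1 (not_le.2 hω)).trans
    ((hn p.1).1 p.2)⟩

theorem UniformCoordScale.bdd [∀ n, Fintype (ι n)] {X : ∀ n, Ω n → κ n → ι n → ℝ}
    (h : UniformCoordScale μ X α) : BddP μ (fun n ω (p : κ n × ι n) => X n ω p.1 p.2) α := by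
  intro ε hε
  obtain ⟨c, C, hc, hC, h⟩ := h ε hε
  exact ⟨C, hC, h.mono fun n hn p => (measure_mono fun ω hω h' => absurd h'.2 (not_le.2 hω)).trans
    ((hn p.1).1 p.2)⟩

theorem UniformCoordScale.low_rms [∀ n, Fintype (ι n)] {X : ∀ n, Ω n → κ n → ι n → ℝ}
    (h : UniformCoordScale μ X α) : LowP μ (fun n ω i => rms (X n ω i)) α := by
  intro ε hε
  obtain ⟨c, C, hc, hC, h⟩ := h ε hε
  refine ⟨c, hc, h.mono fun n hn i => (measure_mono fun ω hω h' => absurd h'.1 (not_le.2 ?_)).trans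
    (hn i).2⟩
  simpa only [Set.mem_ofPred_eq, abs_of_nonneg (rms_nonneg _)] using hω

theorem UniformCoordScale.bdd_rms [∀ n, Fintype (ι n)] {X : ∀ n, Ω n → κ n → ι n → ℝ}
    (h : UniformCoordScale μ X α) : BddP μ (fun n ω i => rms (X n ω i)) α := by
  intro ε hε
  obtain ⟨c, C, hc, hC, h⟩ := h ε hε
  refine ⟨C, hC, h.mono fun n hn i => (measure_mono fun ω hω h' => absurd h'.2 (not_le.2 ?_)).trans
    (hn i).2⟩
  simpa only [Set.mem_ofPred_eq, abs_of_nonneg (rms_nonneg _)] using hω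

end Asymptotic

end MoE

end

noncomputable section

namespace MoE

/-! ### Orders in probability through measure preserving resampling -/

section SeqResample

variable {Ω Γ : ℕ → Type*} [∀ n, MeasurableSpace (Ω n)] [∀ n, MeasurableSpace (Γ n)]
  {μ : ∀ n, Measure (Ω n)} {γ : ∀ n, Measure (Γ n)} [∀ n, IsProbabilityMeasure (μ n)]
  [∀ n, IsProbabilityMeasure (γ n)] {T : ∀ n, Ω n × Γ n → Ω n} {ι : ℕ → Type} {α : ℕ → ℝ}

/-- As `T` preserves the law, `X` has the same small ball probabilities as `X ∘ T`, which is
Gaussian given the base point. The conditional mean `b` is arbitrary; only the conditional variance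
must stay away from zero. -/
theorem lowP_of_measurePreserving
    (hT : ∀ n, MeasurePreserving (T n) ((μ n).prod (γ n)) (μ n))
    {X b V : ∀ n, Ω n → ι n → ℝ} (hX : ∀ n j, Measurable fun ω => X n ω j)
    (hV0 : ∀ n ω j, 0 ≤ V n ω j)
    (hlaw : ∀ n ω j, (γ n).map (fun y => X n (T n (ω, y)) j) =
      gaussianReal (b n ω j) (V n ω j).toNNReal)
    (hα : ∀ᶠ n in atTop, 0 < α n) (hV : LowP μ V (fun n => α n ^ 2)) : LowP μ X α := by
  intro ε hε
  obtain ⟨c, hc, hV⟩ := hV (ε / 2) (by positivity)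
  -- Chosen so that the radius divided by the standard deviation threshold `√c * α n` equals `ε /
  -- 2`.
  refine ⟨√c * (ε / 2), by positivity, ?_⟩
  filter_upwards [hV, hα] with n hn hαn j
  have hXj := hX n j
  have hTm := (hT n).measurable
  have hS : MeasurableSet {ω | |X n ω j| < √c * (ε / 2) * α n} :=
    measurableSet_lt (by fun_prop) measurable_const
  rw [← (hT n).measure_preimage hS.nullMeasurableSet]
  have h := prod_measure_abs_lt_le (μ := μ n) (γ := γ n) (X := fun z => X n (T n z) j)
    (by fun_prop) (b := fun ω => b n ω j) (V := fun ω => V n ω j) (fun ω => hV0 n ω j)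
    (fun ω => hlaw n ω j) (δ := √c * (ε / 2) * α n) (v₀ := c * α n ^ 2) (by positivity)
    (by positivity)
  refine h.trans ((add_le_add (hn j) le_rfl).trans (le_of_eq ?_))
  rw [Real.sqrt_mul hc.le, Real.sqrt_sq hαn.le,
    ← ENNReal.ofReal_add (by positivity) (by positivity)]
  have := Real.sqrt_pos.2 hc
  congr 1
  field_simp
  ring

/-- Conditional Markov inequality: the conditional expectation only has to be bounded in
probability. Its unconditional mean, which would involve products of many dependent factors, is
never needed. -/
theorem bddP_of_measurePreserving
    (hT : ∀ n, MeasurePreserving (T n) ((μ n).prod (γ n)) (μ n))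
    {F B : ∀ n, Ω n → ι n → ℝ} (hF : ∀ n j, Measurable fun ω => F n ω j)
    (hF0 : ∀ n ω j, 0 ≤ F n ω j)
    (hFB : ∀ n ω j, ∫⁻ y, ENNReal.ofReal (F n (T n (ω, y)) j) ∂γ n ≤ ENNReal.ofReal (B n ω j))
    (hα : ∀ᶠ n in atTop, 0 < α n) (hB : BddP μ B α) : BddP μ F α := by
  intro ε hε
  obtain ⟨C, hC, hB⟩ := hB (ε / 2) (by positivity)
  refine ⟨C * (2 / ε), by positivity, ?_⟩
  filter_upwards [hB, hα] with n hn hαn j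
  have hFj := hF n j
  have hTm := (hT n).measurable
  have hS : MeasurableSet {ω | C * (2 / ε) * α n < |F n ω j|} :=
    measurableSet_lt measurable_const (by fun_prop)
  rw [← (hT n).measure_preimage hS.nullMeasurableSet]
  have h := prod_measure_lt_le (μ := μ n) (γ := γ n) (F := fun z => F n (T n z) j)
    (by fun_prop) (B := fun ω => B n ω j) (fun ω => hFB n ω j) (β := C * α n)
    (l := C * (2 / ε) * α n) (by positivity)
  have heq : T n ⁻¹' {ω | C * (2 / ε) * α n < |F n ω j|} =
      {z | C * (2 / ε) * α n < F n (T n z) j} := by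
    ext z; simp [abs_of_nonneg (hF0 n _ j)]
  rw [heq]
  have h2 : μ n {ω | C * α n < B n ω j} ≤ ENNReal.ofReal (ε / 2) :=
    (measure_mono fun ω (hω : C * α n < B n ω j) =>
      show C * α n < |B n ω j| from hω.trans_le (le_abs_self _)).trans (hn j)
  refine h.trans ((add_le_add h2 le_rfl).trans (le_of_eq ?_))
  rw [← ENNReal.ofReal_add (by positivity) (by positivity)]
  congr 1
  field_simp
  ring

end SeqResample

/-- A block of coordinates of a product Gaussian vector that forms a matrix with independent
entries of equal variance, and a direction in row space that does not depend on the block. -/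
structure GaussBlock {ι : Type} [Fintype ι] (v : ι → ℝ≥0) (R C : Type) [Fintype R] [Fintype C] where
  e : R × C → ι
  u : (ι → ℝ) → C → ℝ
  σ : ℝ≥0
  inj : Function.Injective e
  var : ∀ p, v (e p) = σ
  meas : Measurable u
  inv : ∀ θ y, u (Function.extend e y θ) = u θ

/-! ### Rank one functionals of a resampled matrix -/

namespace GaussBlock

section Single

variable {ι R C : Type} [Fintype ι] [Fintype R] [Fintype C] {v : ι → ℝ≥0} (S : GaussBlock v R C)

def T (z : (ι → ℝ) × (R × C → ℝ)) : ι → ℝ := resample S.e S.u z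

def γ : Measure (R × C → ℝ) := gaussPi fun _ => S.σ

instance : IsProbabilityMeasure S.γ := by unfold γ; infer_instance

theorem measurePreserving : MeasurePreserving S.T ((gaussPi v).prod S.γ) (gaussPi v) :=
  measurePreserving_resample v S.σ S.inj S.var S.meas S.inv

theorem T_apply_of_notMem (z : (ι → ℝ) × (R × C → ℝ)) {p : ι} (hp : ∀ q, S.e q ≠ p) :
    S.T z p = z.1 p := resample_apply_of_notMem z hp

/-- The one trace of the old matrix that survives the resampling. Invariance of the forward pass,
and hence of the gradients above the block, rests on it. -/
theorem T_mul_u (z : (ι → ℝ) × (R × C → ℝ)) (r : R) :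
    ∑ c, S.T z (S.e (r, c)) * S.u z.1 c = ∑ c, z.1 (S.e (r, c)) * S.u z.1 c := by
  simp only [T, resample_apply S.inj]
  rw [mixRows_mul]

/-- The conditional mean of a rank one functional of the resampled block. -/
def mean (θ : ι → ℝ) (ρ : R → ℝ) (κ : C → ℝ) : ℝ :=
  (∑ c, κ c * S.u θ c) / (∑ c, S.u θ c ^ 2) * ∑ r, ρ r * ∑ c, θ (S.e (r, c)) * S.u θ c

/-- The conditional variance of a rank one functional of the resampled block. -/
def cvar (θ : ι → ℝ) (ρ : R → ℝ) (κ : C → ℝ) : ℝ := S.σ * (∑ r, ρ r ^ 2) * perpSq (S.u θ) κ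

theorem cvar_nonneg (θ : ι → ℝ) (ρ : R → ℝ) (κ : C → ℝ) : 0 ≤ S.cvar θ ρ κ :=
  mul_nonneg (mul_nonneg S.σ.2 (Finset.sum_nonneg fun _ _ => sq_nonneg _)) (perpSq_nonneg _ _)

/-- By `sum_mixRows` the functional is a constant determined by `θ` plus a linear functional of the
fresh matrix, whose coefficients are `ρ` times the part of `κ` orthogonal to the direction. -/
theorem map_rankOne (θ : ι → ℝ) (ρ : R → ℝ) (κ : C → ℝ) :
    S.γ.map (fun Y => ∑ p : R × C, ρ p.1 * κ p.2 * S.T (θ, Y) (S.e p)) =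
      gaussianReal (S.mean θ ρ κ) (S.cvar θ ρ κ).toNNReal := by
  simp only [T, resample_apply S.inj]
  simp_rw [sum_mixRows]
  have h := gaussPi_map_linear (fun _ : R × C => S.σ) fun p =>
    ρ p.1 * (κ p.2 - (∑ c, κ c * S.u θ c) / (∑ c, S.u θ c ^ 2) * S.u θ p.2)
  have h2 := gaussianReal_map_const_add (μ := 0) (v := (S.cvar θ ρ κ).toNNReal) (S.mean θ ρ κ)
  rw [zero_add] at h2
  have h3 : (∑ p : R × C, (ρ p.1 * (κ p.2 - (∑ c, κ c * S.u θ c) / (∑ c, S.u θ c ^ 2) *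
      S.u θ p.2)) ^ 2 * (S.σ : ℝ)) = S.cvar θ ρ κ := by
    rw [cvar, ← sum_perp_sq, ← Finset.sum_mul, Fintype.sum_prod_type]
    simp_rw [mul_pow, ← Finset.mul_sum]
    rw [← Finset.sum_mul]
    ring
  rw [h3] at h
  rw [← h2, ← h, Measure.map_map (by fun_prop) (by fun_prop)]
  rfl

end Single

section Seq

variable {I R C κ ι : ℕ → Type} [∀ n, Fintype (I n)] [∀ n, Fintype (R n)] [∀ n, Fintype (C n)]
  {v : ∀ n, I n → ℝ≥0} (S : ∀ n, GaussBlock (v n) (R n) (C n))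
  {α : ℕ → ℝ} (hα : ∀ᶠ n in atTop, 0 < α n)

include hα in
-- In `hrep` the coefficients are evaluated at the base point `θ` and only the matrix at the
-- resampled point. So the coefficients may depend on the matrix, but only through what the
-- resampling preserves.
theorem low {X : ∀ n, (I n → ℝ) → ι n → ℝ} {ρ : ∀ n, (I n → ℝ) → ι n → R n → ℝ}
    {τ : ∀ n, (I n → ℝ) → ι n → C n → ℝ}
    (hX : ∀ n j, Measurable fun θ => X n θ j)
    (hrep : ∀ n θ Y j, X n ((S n).T (θ, Y)) j =
      ∑ p : R n × C n, ρ n θ j p.1 * τ n θ j p.2 * (S n).T (θ, Y) ((S n).e p))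
    (hV : LowP (fun n => gaussPi (v n)) (fun n θ j => (S n).cvar θ (ρ n θ j) (τ n θ j))
      (fun n => α n ^ 2)) :
    LowP (fun n => gaussPi (v n)) X α :=
  lowP_of_measurePreserving (fun n => (S n).measurePreserving) hX
    (fun _ _ _ => (S _).cvar_nonneg _ _ _)
    (fun n θ j => by simp_rw [hrep]; exact (S n).map_rankOne _ _ _) hα hV

theorem lintegral_sq {n : ℕ} {X : (I n → ℝ) → ℝ} {ρ : R n → ℝ} {τ : C n → ℝ} {θ : I n → ℝ}
    (hrep : ∀ Y, X ((S n).T (θ, Y)) =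
      ∑ p : R n × C n, ρ p.1 * τ p.2 * (S n).T (θ, Y) ((S n).e p)) :
    ∫⁻ Y, ENNReal.ofReal (X ((S n).T (θ, Y)) ^ 2) ∂(S n).γ =
      ENNReal.ofReal ((S n).mean θ ρ τ ^ 2 + (S n).cvar θ ρ τ) := by
  have hm : Measurable fun Y => (S n).T (θ, Y) :=
    (S n).measurePreserving.measurable.comp measurable_prodMk_left
  rw [← lintegral_sq_gaussianReal _ ((S n).cvar_nonneg θ ρ τ), ← (S n).map_rankOne,
    lintegral_map (by fun_prop) (by fun_prop)]
  simp_rw [hrep]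

include hα in
theorem bdd {X : ∀ n, (I n → ℝ) → ι n → ℝ} {ρ : ∀ n, (I n → ℝ) → ι n → R n → ℝ}
    {τ : ∀ n, (I n → ℝ) → ι n → C n → ℝ}
    (hX : ∀ n j, Measurable fun θ => X n θ j)
    (hrep : ∀ n θ Y j, X n ((S n).T (θ, Y)) j =
      ∑ p : R n × C n, ρ n θ j p.1 * τ n θ j p.2 * (S n).T (θ, Y) ((S n).e p))
    (hb : BddP (fun n => gaussPi (v n)) (fun n θ j => (S n).mean θ (ρ n θ j) (τ n θ j)) α)
    (hV : BddP (fun n => gaussPi (v n)) (fun n θ j => (S n).cvar θ (ρ n θ j) (τ n θ j))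
      (fun n => α n ^ 2)) :
    BddP (fun n => gaussPi (v n)) X α := by
  refine BddP.of_sq ?_ (hα.mono fun _ h => h.le)
  refine bddP_of_measurePreserving (fun n => (S n).measurePreserving)
    (B := fun n θ j => (S n).mean θ (ρ n θ j) (τ n θ j) ^ 2 + (S n).cvar θ (ρ n θ j) (τ n θ j))
    (fun n j => (hX n j).pow_const 2) (fun _ _ _ => sq_nonneg _)
    (fun n θ j => (lintegral_sq S (X := fun θ => X n θ j) fun Y => hrep n θ Y j).le)
    (hα.mono fun _ h => by positivity) ?_
  exact hb.sq.add hV (hα.mono fun _ h => by positivity)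

include hα in
-- The squared root mean square is an average of squares, so its conditional expectation is the
-- average of squared means plus variances. No independence between entries is used.
theorem bdd_rms [∀ n, Fintype (ι n)] {X : ∀ n, (I n → ℝ) → κ n → ι n → ℝ}
    {ρ : ∀ n, (I n → ℝ) → κ n → ι n → R n → ℝ} {τ : ∀ n, (I n → ℝ) → κ n → ι n → C n → ℝ}
    (hX : ∀ n i j, Measurable fun θ => X n θ i j)
    (hrep : ∀ n θ Y i j, X n ((S n).T (θ, Y)) i j =
      ∑ p : R n × C n, ρ n θ i j p.1 * τ n θ i j p.2 * (S n).T (θ, Y) ((S n).e p))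
    (hb : BddP (fun n => gaussPi (v n))
      (fun n θ i => rms fun j => (S n).mean θ (ρ n θ i j) (τ n θ i j)) α)
    (hV : BddP (fun n => gaussPi (v n))
      (fun n θ i => (∑ j, (S n).cvar θ (ρ n θ i j) (τ n θ i j)) / Fintype.card (ι n))
      (fun n => α n ^ 2)) :
    BddP (fun n => gaussPi (v n)) (fun n θ i => rms (X n θ i)) α := by
  refine BddP.of_sq ?_ (hα.mono fun _ h => h.le)
  refine bddP_of_measurePreserving (fun n => (S n).measurePreserving)
    (B := fun n θ i => rms (fun j => (S n).mean θ (ρ n θ i j) (τ n θ i j)) ^ 2 +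
      (∑ j, (S n).cvar θ (ρ n θ i j) (τ n θ i j)) / Fintype.card (ι n))
    (fun n i => (measurable_rms.comp (measurable_pi_lambda _ fun j => hX n i j)).pow_const 2)
    (fun _ _ _ => sq_nonneg _) (fun n θ i => le_of_eq ?_) (hα.mono fun _ h => by positivity)
    (hb.sq.add hV (hα.mono fun _ h => by positivity))
  have hm : Measurable fun Y => (S n).T (θ, Y) :=
    (S n).measurePreserving.measurable.comp measurable_prodMk_left
  have hXm := hX n i
  simp_rw [rms_sq, ← add_div, ← Finset.sum_add_distrib]
  have h0 : (0 : ℝ) ≤ (Fintype.card (ι n) : ℝ)⁻¹ := by positivity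
  simp_rw [div_eq_inv_mul, ENNReal.ofReal_mul h0]
  rw [lintegral_const_mul _ (by fun_prop)]
  congr 1
  rw [ENNReal.ofReal_sum_of_nonneg fun j _ => add_nonneg (sq_nonneg _) ((S n).cvar_nonneg _ _ _)]
  simp_rw [ENNReal.ofReal_sum_of_nonneg fun j _ => sq_nonneg _]
  rw [lintegral_finsetSum _ fun j _ => by fun_prop]
  exact Finset.sum_congr rfl fun j _ =>
    lintegral_sq S (X := fun θ => X n θ i j) fun Y => hrep n θ Y i j

end Seq

end GaussBlock

end MoE

end

noncomputable section

namespace MoE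

/-! ### Partial derivatives and the chain rule -/

section Pgrad

variable {ι : Type*} [Fintype ι] [DecidableEq ι]

theorem pgrad_eq_fderiv {F : (ι → ℝ) → ℝ} {y : ι → ℝ} (hF : DifferentiableAt ℝ F y) (j : ι) :
    pgrad F y j = fderiv ℝ F y (Pi.single j 1) := by
  have h1 : HasFDerivAt F (fderiv ℝ F y) (Function.update y j (y j)) := by
    simpa using hF.hasFDerivAt
  exact (h1.comp_hasDerivAt (y j) (hasDerivAt_update y j (y j))).deriv

theorem hasDerivAt_comp_pgrad {F : (ι → ℝ) → ℝ} {G : ℝ → ι → ℝ} {G' : ι → ℝ} {r : ℝ}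
    (hF : DifferentiableAt ℝ F (G r)) (hG : HasDerivAt G G' r) :
    HasDerivAt (fun t => F (G t)) (pgrad F (G r) ⬝ᵥ G') r := by
  have h := hF.hasFDerivAt.comp_hasDerivAt r hG
  have h2 : fderiv ℝ F (G r) G' = pgrad F (G r) ⬝ᵥ G' := by
    conv_lhs => rw [pi_eq_sum_univ' G']
    simp only [map_sum, map_smul, smul_eq_mul, dotProduct]
    exact Finset.sum_congr rfl fun i _ => by rw [pgrad_eq_fderiv hF, mul_comm]
  rwa [h2] at h

/-- Chain rule for partial derivatives. -/
theorem pgrad_comp {κ : Type*} [DecidableEq κ] {F : (ι → ℝ) → ℝ} {G : (κ → ℝ) → ι → ℝ}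
    {y : κ → ℝ} {j : κ} {G' : ι → ℝ} (hF : DifferentiableAt ℝ F (G y))
    (hG : HasDerivAt (fun r => G (Function.update y j r)) G' (y j)) :
    pgrad (fun y => F (G y)) y j = pgrad F (G y) ⬝ᵥ G' := by
  have h := hasDerivAt_comp_pgrad (F := F) (G := fun r => G (Function.update y j r)) (r := y j)
    (by simpa using hF) hG
  simp only [Function.update_eq_self] at h
  exact h.deriv

end Pgrad

variable {s : Shape} {K : ℕ}

/-! ### Recursions and dependence on the parameters -/

section Recursion

variable {θ θ' : Params s K} {x : Fin s.D → ℝ}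

theorem agg_zero : agg θ x 0 = matW1 θ *ᵥ x := rfl

theorem agg_succ (k : Fin K) : agg θ x k.succ = block θ k (agg θ x k.castSucc) := by
  rw [agg, Fin.induction_succ]

theorem tail_last (h : Fin s.N → ℝ) : tail θ (Fin.last K) h = vecW4 θ ⬝ᵥ h := by
  rw [tail, Fin.reverseInduction_last]

theorem tail_castSucc (k : Fin K) (h : Fin s.N → ℝ) :
    tail θ k.castSucc h = tail θ k.succ (block θ k h) := by
  rw [tail, Fin.reverseInduction_castSucc]

theorem agg_succ_eq_aggregate (k : Fin K) :
    agg θ x k.succ = aggregate (phi θ x k) (h3 θ x k) := agg_succ k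

theorem output_eq_tail (k : Fin (K + 1)) : output θ x = tail θ k (agg θ x k) := by
  induction k using Fin.reverseInduction with
  | last => rw [tail_last]; rfl
  | cast k ih => rw [ih, agg_succ, tail_castSucc]

theorem router_congr {k : Fin K} (hQ : ∀ i a, θ (.Q k i a) = θ' (.Q k i a)) :
    router θ k = router θ' k := by
  have : matQ θ k = matQ θ' k := by ext; simp [matQ, hQ]
  ext; rw [router, router, this]

theorem expertIn_congr {k : Fin K} (h : ∀ i e a, θ (.W2 k i e a) = θ' (.W2 k i e a)) :
    expertIn θ k = expertIn θ' k := by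
  have : matW2 θ k = matW2 θ' k := by ext; simp [matW2, h]
  ext; simp only [expertIn, this]

theorem expertOut_congr {k : Fin K} (h : ∀ i a e, θ (.W3 k i a e) = θ' (.W3 k i a e)) :
    expertOut θ k = expertOut θ' k := by
  have : matW3 θ k = matW3 θ' k := by ext; simp [matW3, h]
  ext; simp only [expertOut, this]

theorem block_congr {k : Fin K} (hQ : ∀ i a, θ (.Q k i a) = θ' (.Q k i a))
    (h2 : ∀ i e a, θ (.W2 k i e a) = θ' (.W2 k i e a))
    (h3 : ∀ i a e, θ (.W3 k i a e) = θ' (.W3 k i a e)) : block θ k = block θ' k := by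
  ext h : 1
  rw [block, block, router_congr hQ, expertIn_congr h2, expertOut_congr h3]

theorem agg_congr {k : Fin (K + 1)} (h1 : ∀ a d, θ (.W1 a d) = θ' (.W1 a d))
    (hb : ∀ j : Fin K, j.castSucc < k → block θ j = block θ' j) : agg θ x k = agg θ' x k := by
  induction k using Fin.induction with
  | zero =>
    have : matW1 θ = matW1 θ' := by ext; simp [matW1, h1]
    rw [agg_zero, agg_zero, this]
  | succ k ih =>
    rw [agg_succ, agg_succ, hb k (Fin.castSucc_lt_succ), ih fun j hj =>
      hb j (hj.trans Fin.castSucc_lt_succ)]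

theorem tail_congr {k : Fin (K + 1)} (h4 : ∀ a, θ (.W4 a) = θ' (.W4 a))
    (hb : ∀ j : Fin K, k ≤ j.castSucc → block θ j = block θ' j) : tail θ k = tail θ' k := by
  induction k using Fin.reverseInduction with
  | last =>
    ext h
    have : vecW4 θ = vecW4 θ' := by ext; simp [vecW4, h4]
    rw [tail_last, tail_last, this]
  | cast k ih =>
    ext h
    rw [tail_castSucc, tail_castSucc, hb k le_rfl, ih fun j hj =>
      hb j (Fin.castSucc_lt_succ.le.trans hj)]

/-- If the parameters differ in block `k` only and the output of this block is the same, then all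
the aggregates are the same. -/
theorem agg_congr_of_block {k : Fin K} (h1 : ∀ a d, θ (.W1 a d) = θ' (.W1 a d))
    (hb : ∀ j : Fin K, j ≠ k → block θ j = block θ' j)
    (hk : block θ k (agg θ' x k.castSucc) = block θ' k (agg θ' x k.castSucc)) (j : Fin (K + 1)) :
    agg θ x j = agg θ' x j := by
  induction j using Fin.induction with
  | zero =>
    have : matW1 θ = matW1 θ' := by ext; simp [matW1, h1]
    rw [agg_zero, agg_zero, this]
  | succ j ih =>
    rw [agg_succ, agg_succ, ih]
    by_cases hj : j = k
    · rw [hj, hk]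
    · rw [hb j hj]

end Recursion

/-! ### Derivatives of the layers -/

section Deriv

variable {θ : Params s K} {r : ℝ}

theorem hasDerivAt_mulVec {m n : Type*} [Fintype m] [Fintype n] (A : Matrix m n ℝ)
    {h : ℝ → n → ℝ} {h' : n → ℝ}
    (hh : HasDerivAt h h' r) : HasDerivAt (fun t => A *ᵥ h t) (A *ᵥ h') r := by
  rw [hasDerivAt_pi] at hh ⊢
  intro i
  simp only [Matrix.mulVec, dotProduct]
  exact HasDerivAt.fun_sum fun j _ => (hh j).const_mul _

theorem hasDerivAt_gate {ψ : ℝ → Fin s.M → ℝ} {ψ' : Fin s.M → ℝ} (hψ : HasDerivAt ψ ψ' r) :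
    HasDerivAt (fun t => gate (ψ t)) (fun i => gate (ψ r) i * (1 - gate (ψ r) i) * ψ' i) r := by
  rw [hasDerivAt_pi] at hψ ⊢
  exact fun i => (Real.hasDerivAt_sigmoid _).comp r (hψ i)

theorem hasDerivAt_aggregate {φ : ℝ → Fin s.M → ℝ} {φ' : Fin s.M → ℝ}
    {u : ℝ → Fin s.M → Fin s.N → ℝ} {u' : Fin s.M → Fin s.N → ℝ} (hφ : HasDerivAt φ φ' r)
    (hu : HasDerivAt u u' r) :
    HasDerivAt (fun t => aggregate (φ t) (u t)) (aggregate φ' (u r) + aggregate (φ r) u') r := by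
  rw [hasDerivAt_pi] at hφ hu ⊢
  intro a
  have hu' : ∀ i, HasDerivAt (fun t => u t i a) (u' i a) r := fun i => hasDerivAt_pi.1 (hu i) a
  simp only [aggregate, Pi.smul_apply, Finset.sum_apply, smul_eq_mul, Pi.add_apply, ← mul_add,
    ← Finset.sum_add_distrib]
  exact (HasDerivAt.fun_sum fun i _ => (hφ i).mul (hu' i)).const_mul _

theorem hasDerivAt_router (k : Fin K) {h : ℝ → Fin s.N → ℝ} {h' : Fin s.N → ℝ}
    (hh : HasDerivAt h h' r) : HasDerivAt (fun t => router θ k (h t)) (router θ k h') r :=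
  hasDerivAt_mulVec _ hh

theorem hasDerivAt_expertIn (k : Fin K) {h : ℝ → Fin s.N → ℝ} {h' : Fin s.N → ℝ}
    (hh : HasDerivAt h h' r) : HasDerivAt (fun t => expertIn θ k (h t)) (expertIn θ k h') r :=
  hasDerivAt_pi.2 fun _ => hasDerivAt_mulVec _ hh

theorem hasDerivAt_expertOut (k : Fin K) {z : ℝ → Fin s.M → Fin s.Ne → ℝ}
    {z' : Fin s.M → Fin s.Ne → ℝ} (hz : HasDerivAt z z' r) :
    HasDerivAt (fun t => expertOut θ k (z t)) (expertOut θ k z') r :=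
  hasDerivAt_pi.2 fun i => hasDerivAt_mulVec _ (hasDerivAt_pi.1 hz i)

theorem differentiable_block (k : Fin K) : Differentiable ℝ (block θ k) := by
  have : Differentiable ℝ Real.sigmoid := differentiable_sigmoid
  rw [differentiable_pi]
  intro a
  simp only [block, aggregate, gate, router, expertOut, expertIn, Matrix.mulVec, dotProduct,
    Pi.smul_apply, Finset.sum_apply, smul_eq_mul]
  fun_prop

theorem differentiable_tail (k : Fin (K + 1)) : Differentiable ℝ (tail θ k) := by
  induction k using Fin.reverseInduction with
  | last =>
    have : tail θ (Fin.last K) = fun h => ∑ a, vecW4 θ a * h a := by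
      ext h; rw [tail_last]; rfl
    rw [this]
    fun_prop
  | cast k ih =>
    have : tail θ k.castSucc = fun h => tail θ k.succ (block θ k h) := by
      ext h; rw [tail_castSucc]
    rw [this]
    exact ih.comp (differentiable_block k)

theorem dotProduct_aggregate (g : Fin s.N → ℝ) (φ : Fin s.M → ℝ) (u : Fin s.M → Fin s.N → ℝ) :
    g ⬝ᵥ aggregate φ u = 1 / (s.M : ℝ) * ∑ i, φ i * (g ⬝ᵥ u i) := by
  simp only [aggregate, dotProduct_smul, dotProduct_sum, smul_eq_mul]

end Deriv

/-! ### The backward pass in closed form -/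

section Backward

variable (θ : Params s K) (x : Fin s.D → ℝ)

/-- The gradient of the output contracted with the second expert matrix. -/
def backP (k : Fin K) (i : Fin s.M) : Fin s.Ne → ℝ := gradAgg θ x k.succ ᵥ* matW3 θ k i

/-- `backP` contracted with the hidden state of the expert. -/
def backQ (k : Fin K) (i : Fin s.M) : ℝ := backP θ x k i ⬝ᵥ h2 θ x k i

/-- The derivative of the gate. -/
def dphi (k : Fin K) (i : Fin s.M) : ℝ := phi θ x k i * (1 - phi θ x k i)

variable {θ x}

/-- Contracting the expert matrix with the gradient before the hidden state keeps the intermediate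
at order one and bypasses the large expert output. The gradient formulas below use this order. -/
theorem gradAgg_dot_expertOut (k : Fin K) (i : Fin s.M) (z : Fin s.M → Fin s.Ne → ℝ) :
    gradAgg θ x k.succ ⬝ᵥ expertOut θ k z i = backP θ x k i ⬝ᵥ z i :=
  Matrix.dotProduct_mulVec _ _ _

theorem gradAgg_last : gradAgg θ x (Fin.last K) = vecW4 θ := by
  ext a
  have h1 : HasDerivAt (fun r => (1 : Matrix (Fin s.N) (Fin s.N) ℝ) *ᵥ
      Function.update (agg θ x (Fin.last K)) a r)
      ((1 : Matrix (Fin s.N) (Fin s.N) ℝ) *ᵥ Pi.single a 1) (agg θ x (Fin.last K) a) :=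
    hasDerivAt_mulVec _ (hasDerivAt_update _ _ _)
  simp only [Matrix.one_mulVec] at h1
  have h2 : HasDerivAt (fun r => ∑ b, vecW4 θ b * Function.update (agg θ x (Fin.last K)) a r b)
      (∑ b, vecW4 θ b * (Pi.single a 1 : Fin s.N → ℝ) b) (agg θ x (Fin.last K) a) :=
    HasDerivAt.fun_sum fun b _ => (hasDerivAt_pi.1 h1 b).const_mul _
  have h3 : gradAgg θ x (Fin.last K) a = deriv (fun r => ∑ b, vecW4 θ b *
      Function.update (agg θ x (Fin.last K)) a r b) (agg θ x (Fin.last K) a) := by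
    rw [gradAgg, pgrad]; congr 1; ext r; rw [tail_last]; rfl
  rw [h3, h2.deriv]
  simp [Pi.single_apply]

theorem gradPhi_eq (k : Fin K) (i : Fin s.M) :
    gradPhi θ x k i = 1 / (s.M : ℝ) * backQ θ x k i := by
  rw [gradPhi, pgrad_comp (F := tail θ k.succ) (G := fun φ => aggregate φ (h3 θ x k))
    (differentiable_tail _ _) (hasDerivAt_aggregate (hasDerivAt_update _ _ _)
      (hasDerivAt_const _ (h3 θ x k))), ← agg_succ_eq_aggregate]
  -- The base point of the tail is now the actual aggregate, so its gradient is `gradAgg` by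
  -- definition. The other closed forms follow the same pattern.
  change gradAgg θ x k.succ ⬝ᵥ _ = _
  rw [dotProduct_add, dotProduct_aggregate, dotProduct_aggregate]
  simp only [Pi.zero_apply, dotProduct_zero, mul_zero, Finset.sum_const_zero, add_zero]
  simp only [h3, gradAgg_dot_expertOut]
  simp [Pi.single_apply, backQ]

theorem gradPsi_eq (k : Fin K) (i : Fin s.M) :
    gradPsi θ x k i = 1 / (s.M : ℝ) * (dphi θ x k i * backQ θ x k i) := by
  rw [gradPsi, pgrad_comp (F := tail θ k.succ) (G := fun ψ => aggregate (gate ψ) (h3 θ x k))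
    (differentiable_tail _ _) (hasDerivAt_aggregate (hasDerivAt_gate (hasDerivAt_update _ _ _))
      (hasDerivAt_const _ (h3 θ x k)))]
  change pgrad _ (aggregate (phi θ x k) _) ⬝ᵥ _ = _
  rw [← agg_succ_eq_aggregate]
  change gradAgg θ x k.succ ⬝ᵥ _ = _
  rw [dotProduct_add, dotProduct_aggregate, dotProduct_aggregate]
  simp only [Pi.zero_apply, dotProduct_zero, mul_zero, Finset.sum_const_zero, add_zero]
  simp only [h3, gradAgg_dot_expertOut, Function.update_eq_self]
  simp [Pi.single_apply, backQ, dphi, phi]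

theorem gradH3_eq (k : Fin K) (i : Fin s.M) (a : Fin s.N) :
    gradH3 θ x k i a = 1 / (s.M : ℝ) * (phi θ x k i * gradAgg θ x k.succ a) := by
  have hu : HasDerivAt (fun r => Function.update (h3 θ x k) i
      (Function.update (h3 θ x k i) a r)) (Pi.single i (Pi.single a 1)) (h3 θ x k i a) := by
    rw [hasDerivAt_pi]
    intro j
    by_cases hj : j = i
    · subst hj
      simpa using hasDerivAt_update (h3 θ x k j) a (h3 θ x k j a)
    · simpa [Function.update_of_ne hj, hj] using hasDerivAt_const _ _
  rw [gradH3, pgrad_comp (F := tail θ k.succ)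
    (G := fun u => aggregate (phi θ x k) (Function.update (h3 θ x k) i u))
    (differentiable_tail _ _) (hasDerivAt_aggregate (hasDerivAt_const _ (phi θ x k)) hu),
    Function.update_eq_self, ← agg_succ_eq_aggregate]
  change gradAgg θ x k.succ ⬝ᵥ _ = _
  rw [dotProduct_add, dotProduct_aggregate, dotProduct_aggregate]
  simp [Pi.single_apply, apply_ite (fun v => gradAgg θ x k.succ ⬝ᵥ v)]

theorem gradH2_eq (k : Fin K) (i : Fin s.M) (e : Fin s.Ne) :
    gradH2 θ x k i e = 1 / (s.M : ℝ) * (phi θ x k i * backP θ x k i e) := by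
  have hu : HasDerivAt (fun r => Function.update (h2 θ x k) i
      (Function.update (h2 θ x k i) e r)) (Pi.single i (Pi.single e 1)) (h2 θ x k i e) := by
    rw [hasDerivAt_pi]
    intro j
    by_cases hj : j = i
    · subst hj
      simpa using hasDerivAt_update (h2 θ x k j) e (h2 θ x k j e)
    · simpa [Function.update_of_ne hj, hj] using hasDerivAt_const _ _
  rw [gradH2, pgrad_comp (F := tail θ k.succ)
    (G := fun z => aggregate (phi θ x k) (expertOut θ k (Function.update (h2 θ x k) i z)))
    (differentiable_tail _ _) (hasDerivAt_aggregate (hasDerivAt_const _ (phi θ x k))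
      (hasDerivAt_expertOut k hu)), Function.update_eq_self]
  change pgrad _ (aggregate (phi θ x k) (h3 θ x k)) ⬝ᵥ _ = _
  rw [← agg_succ_eq_aggregate]
  change gradAgg θ x k.succ ⬝ᵥ _ = _
  rw [dotProduct_add, dotProduct_aggregate, dotProduct_aggregate]
  simp only [gradAgg_dot_expertOut, Pi.zero_apply, zero_mul, Finset.sum_const_zero, mul_zero,
    zero_add]
  rw [Finset.sum_eq_single i (fun j _ hj => by simp [hj]) (by simp)]
  simp

theorem gradExpert_eq (k : Fin K) (a : Fin s.N) :
    gradExpert θ x k a =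
      1 / (s.M : ℝ) * ∑ i, phi θ x k i * ∑ e, backP θ x k i e * θ (.W2 k i e a) := by
  rw [gradExpert, pgrad_comp (F := tail θ k.succ)
    (G := fun h => aggregate (phi θ x k) (expertOut θ k (expertIn θ k h)))
    (differentiable_tail _ _) (hasDerivAt_aggregate (hasDerivAt_const _ (phi θ x k))
      (hasDerivAt_expertOut k (hasDerivAt_expertIn k (hasDerivAt_update _ _ _))))]
  change pgrad _ (aggregate (phi θ x k) (h3 θ x k)) ⬝ᵥ _ = _
  rw [← agg_succ_eq_aggregate]
  change gradAgg θ x k.succ ⬝ᵥ _ = _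
  rw [dotProduct_add, dotProduct_aggregate, dotProduct_aggregate]
  simp only [gradAgg_dot_expertOut, Pi.zero_apply, zero_mul, Finset.sum_const_zero, mul_zero,
    zero_add]
  simp [expertIn, dotProduct, matW2]

theorem gradRouter_eq (k : Fin K) (a : Fin s.N) :
    gradRouter θ x k a =
      1 / (s.M : ℝ) * ∑ i, dphi θ x k i * backQ θ x k i * θ (.Q k i a) := by
  rw [gradRouter, pgrad_comp (F := tail θ k.succ)
    (G := fun h => aggregate (gate (router θ k h)) (h3 θ x k))
    (differentiable_tail _ _) (hasDerivAt_aggregate (hasDerivAt_gate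
      (hasDerivAt_router k (hasDerivAt_update _ _ _))) (hasDerivAt_const _ (h3 θ x k)))]
  change pgrad _ (aggregate (phi θ x k) (h3 θ x k)) ⬝ᵥ _ = _
  rw [← agg_succ_eq_aggregate]
  change gradAgg θ x k.succ ⬝ᵥ _ = _
  rw [dotProduct_add, dotProduct_aggregate, dotProduct_aggregate]
  simp only [Pi.zero_apply, dotProduct_zero, mul_zero, Finset.sum_const_zero, add_zero]
  simp only [h3, gradAgg_dot_expertOut, Function.update_eq_self]
  congr 1
  refine Finset.sum_congr rfl fun i _ => ?_
  change dphi θ x k i * _ * backQ θ x k i = _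
  simp [router, matQ]
  ring

/-- The gradient at the input of a block is the sum of the expert part and the router part. -/
theorem gradAgg_castSucc (k : Fin K) (a : Fin s.N) :
    gradAgg θ x k.castSucc a = gradExpert θ x k a + gradRouter θ x k a := by
  have hup : HasDerivAt (fun r => Function.update (agg θ x k.castSucc) a r) (Pi.single a 1)
      (agg θ x k.castSucc a) := hasDerivAt_update _ _ _
  have h1 : tail θ k.castSucc = fun h => tail θ k.succ
      (aggregate (gate (router θ k h)) (expertOut θ k (expertIn θ k h))) := by
    ext h; rw [tail_castSucc]; rfl
  have ht := differentiable_tail (θ := θ) k.succ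
  rw [gradAgg, h1, pgrad_comp (ht _) (hasDerivAt_aggregate (hasDerivAt_gate
      (hasDerivAt_router k hup)) (hasDerivAt_expertOut k (hasDerivAt_expertIn k hup))),
    gradExpert, pgrad_comp (F := tail θ k.succ) (ht _)
      (hasDerivAt_aggregate (hasDerivAt_const _ (phi θ x k))
      (hasDerivAt_expertOut k (hasDerivAt_expertIn k hup))),
    gradRouter, pgrad_comp (F := tail θ k.succ) (ht _) (hasDerivAt_aggregate (hasDerivAt_gate
      (hasDerivAt_router k hup)) (hasDerivAt_const _ (h3 θ x k)))]
  have z1 : ∀ u : Fin s.M → Fin s.N → ℝ, aggregate 0 u = 0 := fun u => by ext; simp [aggregate]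
  have z2 : ∀ φ : Fin s.M → ℝ, aggregate φ (0 : Fin s.M → Fin s.N → ℝ) = 0 := fun u => by
    ext; simp [aggregate]
  simp only [Function.update_eq_self, z1, z2, zero_add, add_zero]
  rw [add_comm, dotProduct_add]
  rfl

instance : Finite (ParamIdx s K) := by
  let f : ParamIdx s K → (Fin s.N × Fin s.D) ⊕ (Fin K × Fin s.M × Fin s.N) ⊕
      (Fin K × Fin s.M × Fin s.Ne × Fin s.N) ⊕ (Fin K × Fin s.M × Fin s.N × Fin s.Ne) ⊕ Fin s.N
    | .W1 a d => .inl (a, d)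
    | .Q k i a => .inr (.inl (k, i, a))
    | .W2 k i e a => .inr (.inr (.inl (k, i, e, a)))
    | .W3 k i a e => .inr (.inr (.inr (.inl (k, i, a, e))))
    | .W4 a => .inr (.inr (.inr (.inr a)))
  refine Finite.of_injective f ?_
  intro p q h
  cases p <;> cases q <;> simp_all [f]

instance : Fintype (ParamIdx s K) := Fintype.ofFinite _

theorem hasDerivAt_update_apply {ι : Type*} [Fintype ι] [DecidableEq ι] (θ : ι → ℝ) (p q : ι)
    (r : ℝ) : HasDerivAt (fun t => Function.update θ p t q) (if q = p then 1 else 0) r := by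
  have := hasDerivAt_pi.1 (hasDerivAt_update θ p r) q
  simpa [Pi.single_apply] using this

/-- The derivative of the output in a parameter of block `k`. -/
theorem gradParam_of_block {k : Fin K} {p : ParamIdx s K} (h1 : ∀ a d, p ≠ .W1 a d)
    (h4 : ∀ a, p ≠ .W4 a) (hQ : ∀ j i a, j ≠ k → p ≠ .Q j i a)
    (h2 : ∀ j i e a, j ≠ k → p ≠ .W2 j i e a) (h3 : ∀ j i a e, j ≠ k → p ≠ .W3 j i a e)
    {G' : Fin s.N → ℝ} (hG : HasDerivAt
      (fun r => block (Function.update θ p r) k (agg θ x k.castSucc)) G' (θ p)) :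
    gradParam θ x p = gradAgg θ x k.succ ⬝ᵥ G' := by
  have hout : (fun r => output (Function.update θ p r) x) =
      fun r => tail θ k.succ (block (Function.update θ p r) k (agg θ x k.castSucc)) := by
    ext r
    have hb : ∀ j : Fin K, j ≠ k → block (Function.update θ p r) j = block θ j := fun j hj =>
      block_congr (fun i a => Function.update_of_ne (hQ j i a hj).symm _ _)
        (fun i e a => Function.update_of_ne (h2 j i e a hj).symm _ _)
        (fun i a e => Function.update_of_ne (h3 j i a e hj).symm _ _)
    rw [output_eq_tail k.succ, agg_succ]
    -- The blocks before `k` give the same input and those after `k` the same tail, so the parameter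
    -- acts inside block `k` only.
    have e1 : agg (Function.update θ p r) x k.castSucc = agg θ x k.castSucc :=
      agg_congr (fun a d => Function.update_of_ne (h1 a d).symm _ _)
        fun j hj => hb j (ne_of_lt (by simpa using hj))
    have e2 : tail (Function.update θ p r) k.succ = tail θ k.succ :=
      tail_congr (fun a => Function.update_of_ne (h4 a).symm _ _)
        fun j hj => hb j (ne_of_gt (by simpa [Fin.succ_le_castSucc_iff] using hj))
    rw [e1, e2]
  rw [gradParam, pgrad, hout]
  have h := hasDerivAt_comp_pgrad (F := tail θ k.succ) (differentiable_tail _ _) hG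
  simp only [Function.update_eq_self] at h
  rw [h.deriv, ← agg_succ]
  rfl

/-- The weight enters only through logit `i`, linearly, with the input coordinate `a` as its
coefficient. The same mechanism makes the gradients of the expert matrices outer products. -/
theorem gradParam_Q (k : Fin K) (i : Fin s.M) (a : Fin s.N) :
    gradParam θ x (.Q k i a) = gradPsi θ x k i * agg θ x k.castSucc a := by
  have hψ : HasDerivAt (fun r => router (Function.update θ (.Q k i a) r) k (agg θ x k.castSucc))
      (Pi.single i (agg θ x k.castSucc a)) (θ (.Q k i a)) := by
    rw [hasDerivAt_pi]
    intro j
    have h : HasDerivAt (fun r => ∑ b, Function.update θ (.Q k i a) r (.Q k j b) *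
        agg θ x k.castSucc b) (∑ b, (if (.Q k j b : ParamIdx s K) = .Q k i a then 1 else 0) *
        agg θ x k.castSucc b) (θ (.Q k i a)) :=
      HasDerivAt.fun_sum fun b _ => (hasDerivAt_update_apply _ _ _ _).mul_const _
    have heq : (Pi.single i (agg θ x k.castSucc a) : Fin s.M → ℝ) j =
        ∑ b, (if (.Q k j b : ParamIdx s K) = .Q k i a then 1 else 0) * agg θ x k.castSucc b := by
      by_cases hj : j = i
      · subst hj; simp
      · simp [hj]
    rw [heq]
    exact h
  have hblk : (fun r => block (Function.update θ (.Q k i a) r) k (agg θ x k.castSucc)) = fun r =>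
      aggregate (gate (router (Function.update θ (.Q k i a) r) k (agg θ x k.castSucc)))
        (h3 θ x k) := by
    ext r : 1
    rw [block, expertIn_congr (θ' := θ) (by simp), expertOut_congr (θ' := θ) (by simp)]
    rfl
  have hG := hasDerivAt_aggregate (hasDerivAt_gate hψ) (hasDerivAt_const _ (h3 θ x k))
  rw [← hblk] at hG
  rw [gradParam_of_block (k := k) (G' := _) (by simp) (by simp)
    (by rintro j i a hj ⟨⟩; exact hj rfl) (by simp) (by simp) hG]
  rw [dotProduct_add, dotProduct_aggregate, dotProduct_aggregate, gradPsi_eq]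
  simp only [Pi.zero_apply, dotProduct_zero, mul_zero, Finset.sum_const_zero, add_zero,
    Function.update_eq_self]
  simp only [h3, gradAgg_dot_expertOut]
  rw [Finset.sum_eq_single i (fun j _ hj => by simp [hj]) (by simp)]
  simp [backQ, dphi, phi, psi]
  ring

theorem gradParam_W2 (k : Fin K) (i : Fin s.M) (e : Fin s.Ne) (a : Fin s.N) :
    gradParam θ x (.W2 k i e a) = gradH2 θ x k i e * agg θ x k.castSucc a := by
  have hz : HasDerivAt (fun r => expertIn (Function.update θ (.W2 k i e a) r) k
      (agg θ x k.castSucc)) (Pi.single i (Pi.single e (agg θ x k.castSucc a)))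
      (θ (.W2 k i e a)) := by
    rw [hasDerivAt_pi]
    intro j
    rw [hasDerivAt_pi]
    intro f
    have h : HasDerivAt (fun r => ∑ b, Function.update θ (.W2 k i e a) r (.W2 k j f b) *
        agg θ x k.castSucc b) (∑ b, (if (.W2 k j f b : ParamIdx s K) = .W2 k i e a then 1 else 0) *
        agg θ x k.castSucc b) (θ (.W2 k i e a)) :=
      HasDerivAt.fun_sum fun b _ => (hasDerivAt_update_apply _ _ _ _).mul_const _
    have heq : (Pi.single i (Pi.single e (agg θ x k.castSucc a)) : Fin s.M → Fin s.Ne → ℝ) j f =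
        ∑ b, (if (.W2 k j f b : ParamIdx s K) = .W2 k i e a then 1 else 0) *
          agg θ x k.castSucc b := by
      by_cases hj : j = i
      · subst hj
        by_cases hf : f = e
        · subst hf; simp
        · simp [hf]
      · simp [hj]
    rw [heq]
    exact h
  have hblk : (fun r => block (Function.update θ (.W2 k i e a) r) k (agg θ x k.castSucc)) =
      fun r => aggregate (phi θ x k) (expertOut θ k (expertIn (Function.update θ (.W2 k i e a) r) k
        (agg θ x k.castSucc))) := by
    ext r : 1
    rw [block, router_congr (θ' := θ) (by simp), expertOut_congr (θ' := θ) (by simp)]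
    rfl
  have hG := hasDerivAt_aggregate (hasDerivAt_const _ (phi θ x k))
    (hasDerivAt_expertOut (θ := θ) k hz)
  rw [← hblk] at hG
  rw [gradParam_of_block (k := k) (G' := _) (by simp) (by simp) (by simp)
    (by rintro j i e a hj ⟨⟩; exact hj rfl) (by simp) hG]
  rw [dotProduct_add, dotProduct_aggregate, dotProduct_aggregate, gradH2_eq]
  simp only [gradAgg_dot_expertOut, Pi.zero_apply, zero_mul, Finset.sum_const_zero, mul_zero,
    zero_add]
  rw [Finset.sum_eq_single i (fun j _ hj => by simp [hj]) (by simp)]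
  simp
  ring

theorem gradParam_W3 (k : Fin K) (i : Fin s.M) (a : Fin s.N) (e : Fin s.Ne) :
    gradParam θ x (.W3 k i a e) = gradH3 θ x k i a * h2 θ x k i e := by
  have hz : HasDerivAt (fun r => expertOut (Function.update θ (.W3 k i a e) r) k
      (h2 θ x k)) (Pi.single i (Pi.single a (h2 θ x k i e)))
      (θ (.W3 k i a e)) := by
    rw [hasDerivAt_pi]
    intro j
    rw [hasDerivAt_pi]
    intro b
    have h : HasDerivAt (fun r => ∑ f, Function.update θ (.W3 k i a e) r (.W3 k j b f) *
        h2 θ x k j f) (∑ f, (if (.W3 k j b f : ParamIdx s K) = .W3 k i a e then 1 else 0) *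
        h2 θ x k j f) (θ (.W3 k i a e)) :=
      HasDerivAt.fun_sum fun b _ => (hasDerivAt_update_apply _ _ _ _).mul_const _
    have heq : (Pi.single i (Pi.single a (h2 θ x k i e)) : Fin s.M → Fin s.N → ℝ) j b =
        ∑ f, (if (.W3 k j b f : ParamIdx s K) = .W3 k i a e then 1 else 0) * h2 θ x k j f := by
      by_cases hj : j = i
      · subst hj
        by_cases hb : b = a
        · subst hb; simp
        · simp [hb]
      · simp [hj]
    rw [heq]
    exact h
  have hblk : (fun r => block (Function.update θ (.W3 k i a e) r) k (agg θ x k.castSucc)) =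
      fun r => aggregate (phi θ x k) (expertOut (Function.update θ (.W3 k i a e) r) k
        (h2 θ x k)) := by
    ext r : 1
    rw [block, router_congr (θ' := θ) (by simp), expertIn_congr (θ' := θ) (by simp)]
    rfl
  have hG := hasDerivAt_aggregate (hasDerivAt_const _ (phi θ x k)) hz
  rw [← hblk] at hG
  rw [gradParam_of_block (k := k) (G' := _) (by simp) (by simp) (by simp) (by simp)
    (by rintro j i e a hj ⟨⟩; exact hj rfl) hG]
  rw [dotProduct_add, dotProduct_aggregate, dotProduct_aggregate, gradH3_eq]
  simp only [Pi.zero_apply, zero_mul, Finset.sum_const_zero, mul_zero, zero_add]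
  rw [Finset.sum_eq_single i (fun j _ hj => by simp [hj]) (by simp)]
  simp
  ring

theorem hasDerivAt_output_W4 (a : Fin s.N) :
    HasDerivAt (fun r => output (Function.update θ (.W4 a) r) x) (agg θ x (Fin.last K) a)
      (θ (.W4 a)) := by
  have hagg : ∀ r, agg (Function.update θ (.W4 a) r) x (Fin.last K) = agg θ x (Fin.last K) :=
    fun r => agg_congr (by simp) fun j _ => block_congr (by simp) (by simp) (by simp)
  have h : HasDerivAt (fun r => ∑ b, Function.update θ (.W4 a) r (.W4 b) * agg θ x (Fin.last K) b)
      (∑ b, (if (.W4 b : ParamIdx s K) = .W4 a then 1 else 0) * agg θ x (Fin.last K) b)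
      (θ (.W4 a)) :=
    HasDerivAt.fun_sum fun b _ => (hasDerivAt_update_apply _ _ _ _).mul_const _
  convert h using 1
  · ext r
    rw [output, hagg]
    rfl
  · simp

theorem gradParam_W4 (a : Fin s.N) :
    gradParam θ x (.W4 a) = agg θ x (Fin.last K) a := (hasDerivAt_output_W4 a).deriv

end Backward

end MoE

end

noncomputable section

namespace MoE

variable {s : Shape} {K : ℕ}

/-! ### The network after the first step -/

/-- The parameters with a readout proportional to the last aggregate. -/
def withReadout (c : ℝ) (x : Fin s.D → ℝ) (θ : Params s K) : Params s K
  | .W4 a => c * agg θ x (Fin.last K) a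
  | .W1 a d => θ (.W1 a d)
  | .Q k i a => θ (.Q k i a)
  | .W2 k i e a => θ (.W2 k i e a)
  | .W3 k i a e => θ (.W3 k i a e)

section WithReadout

variable (c : ℝ) (x : Fin s.D → ℝ) (θ : Params s K)

theorem block_withReadout (k : Fin K) : block (withReadout c x θ) k = block θ k :=
  block_congr (fun _ _ => rfl) (fun _ _ _ => rfl) (fun _ _ _ => rfl)

theorem agg_withReadout (k : Fin (K + 1)) : agg (withReadout c x θ) x k = agg θ x k :=
  agg_congr (fun _ _ => rfl) fun j _ => block_withReadout c x θ j

theorem psi_withReadout (k : Fin K) : psi (withReadout c x θ) x k = psi θ x k := by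
  rw [psi, psi, agg_withReadout]; rfl

theorem phi_withReadout (k : Fin K) : phi (withReadout c x θ) x k = phi θ x k := by
  rw [phi, phi, psi_withReadout]

theorem h2_withReadout (k : Fin K) : h2 (withReadout c x θ) x k = h2 θ x k := by
  rw [h2, h2, agg_withReadout]; rfl

theorem vecW4_withReadout :
    vecW4 (withReadout c x θ) = c • agg θ x (Fin.last K) := rfl

/-- The gradient at the aggregates after the first step. -/
def bwdG (k : Fin (K + 1)) : Fin s.N → ℝ := gradAgg (withReadout c x θ) x k

/-- `backP` after the first step. -/
def bwdP (k : Fin K) (i : Fin s.M) : Fin s.Ne → ℝ := backP (withReadout c x θ) x k i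

/-- `backQ` after the first step. -/
def bwdQ (k : Fin K) (i : Fin s.M) : ℝ := backQ (withReadout c x θ) x k i

theorem bwdG_last (a : Fin s.N) :
    bwdG c x θ (Fin.last K) a = c * agg θ x (Fin.last K) a := by
  rw [bwdG, gradAgg_last]; rfl

theorem bwdP_apply (k : Fin K) (i : Fin s.M) (e : Fin s.Ne) :
    bwdP c x θ k i e = ∑ a, bwdG c x θ k.succ a * θ (.W3 k i a e) := rfl

theorem bwdQ_apply (k : Fin K) (i : Fin s.M) :
    bwdQ c x θ k i = ∑ e, bwdP c x θ k i e * h2 θ x k i e := by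
  rw [bwdQ, backQ, h2_withReadout]; rfl

theorem gradExpert_withReadout (k : Fin K) (a : Fin s.N) :
    gradExpert (withReadout c x θ) x k a =
      1 / (s.M : ℝ) * ∑ i, phi θ x k i * ∑ e, bwdP c x θ k i e * θ (.W2 k i e a) := by
  rw [gradExpert_eq, phi_withReadout]; rfl

theorem dphi_withReadout (k : Fin K) (i : Fin s.M) :
    dphi (withReadout c x θ) x k i = dphi θ x k i := by
  rw [dphi, dphi, phi_withReadout]

theorem gradRouter_withReadout (k : Fin K) (a : Fin s.N) :
    gradRouter (withReadout c x θ) x k a =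
      1 / (s.M : ℝ) * ∑ i, dphi θ x k i * bwdQ c x θ k i * θ (.Q k i a) := by
  rw [gradRouter_eq]; simp_rw [dphi_withReadout]; rfl

theorem bwdG_castSucc (k : Fin K) (a : Fin s.N) :
    bwdG c x θ k.castSucc a = gradExpert (withReadout c x θ) x k a +
      gradRouter (withReadout c x θ) x k a := gradAgg_castSucc k a

end WithReadout

/-! ### Measurability -/

section Measurability

variable (x : Fin s.D → ℝ) (c : ℝ)

theorem psi_apply (θ : Params s K) (k : Fin K) (i : Fin s.M) :
    psi θ x k i = ∑ a, θ (.Q k i a) * agg θ x k.castSucc a := rfl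

theorem h2_apply (θ : Params s K) (k : Fin K) (i : Fin s.M) (e : Fin s.Ne) :
    h2 θ x k i e = ∑ a, θ (.W2 k i e a) * agg θ x k.castSucc a := rfl

theorem h3_apply (θ : Params s K) (k : Fin K) (i : Fin s.M) (a : Fin s.N) :
    h3 θ x k i a = ∑ e, θ (.W3 k i a e) * h2 θ x k i e := rfl

/-- The hidden states of the experts weighted by the gates. -/
def gatedIn (θ : Params s K) (k : Fin K) : Fin s.M × Fin s.Ne → ℝ :=
  fun p => phi θ x k p.1 * h2 θ x k p.1 p.2

/-- The block output depends on the output matrices only through their product with the gated hidden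
states. This singles out `gatedIn` as the direction to be kept when they are resampled. -/
theorem agg_succ_apply (θ : Params s K) (k : Fin K) (a : Fin s.N) :
    agg θ x k.succ a =
      1 / (s.M : ℝ) * ∑ p : Fin s.M × Fin s.Ne, θ (.W3 k p.1 a p.2) * gatedIn x θ k p := by
  rw [agg_succ_eq_aggregate, aggregate, Fintype.sum_prod_type]
  simp only [Pi.smul_apply, Finset.sum_apply, smul_eq_mul, h3_apply, gatedIn, Finset.mul_sum]
  refine Finset.sum_congr rfl fun i _ => Finset.sum_congr rfl fun e _ => ?_
  ring

theorem measurable_agg (k : Fin (K + 1)) (a : Fin s.N) :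
    Measurable fun θ : Params s K => agg θ x k a := by
  induction k using Fin.induction generalizing a with
  | zero =>
    have : ∀ θ : Params s K, agg θ x 0 a = ∑ d, θ (.W1 a d) * x d := fun θ => rfl
    simp_rw [this]
    fun_prop
  | succ k ih =>
    have hs : Measurable Real.sigmoid := continuous_sigmoid.measurable
    simp_rw [agg_succ_apply, gatedIn, phi, gate, psi_apply, h2_apply]
    fun_prop

theorem measurable_psi (k : Fin K) (i : Fin s.M) :
    Measurable fun θ : Params s K => psi θ x k i := by
  have := measurable_agg (s := s) (K := K) x
  simp_rw [psi_apply]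
  fun_prop

theorem measurable_phi (k : Fin K) (i : Fin s.M) :
    Measurable fun θ : Params s K => phi θ x k i :=
  continuous_sigmoid.measurable.comp (measurable_psi x k i)

theorem measurable_h2 (k : Fin K) (i : Fin s.M) (e : Fin s.Ne) :
    Measurable fun θ : Params s K => h2 θ x k i e := by
  have := measurable_agg (s := s) (K := K) x
  simp_rw [h2_apply]
  fun_prop

theorem measurable_h3 (k : Fin K) (i : Fin s.M) (a : Fin s.N) :
    Measurable fun θ : Params s K => h3 θ x k i a := by
  have := measurable_h2 (s := s) (K := K) x
  simp_rw [h3_apply]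
  fun_prop

/-- Measurability of the next gradient is a hypothesis so that the lemma can be used inside the
downward induction of `measurable_bwdG`. -/
theorem measurable_gradExpert_of (k : Fin K)
    (hG : ∀ a, Measurable fun θ : Params s K => bwdG c x θ k.succ a) (a : Fin s.N) :
    Measurable fun θ : Params s K => gradExpert (withReadout c x θ) x k a := by
  have := measurable_phi (s := s) (K := K) x
  simp_rw [gradExpert_withReadout, bwdP_apply]
  fun_prop

theorem measurable_gradRouter_of (k : Fin K)
    (hG : ∀ a, Measurable fun θ : Params s K => bwdG c x θ k.succ a) (a : Fin s.N) :
    Measurable fun θ : Params s K => gradRouter (withReadout c x θ) x k a := by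
  have := measurable_phi (s := s) (K := K) x
  have := measurable_h2 (s := s) (K := K) x
  simp_rw [gradRouter_withReadout, bwdQ_apply, bwdP_apply, dphi]
  fun_prop

theorem measurable_bwdG (k : Fin (K + 1)) (a : Fin s.N) :
    Measurable fun θ : Params s K => bwdG c x θ k a := by
  induction k using Fin.reverseInduction generalizing a with
  | last =>
    have := measurable_agg (s := s) (K := K) x
    simp_rw [bwdG_last]
    fun_prop
  | cast k ih =>
    simp_rw [bwdG_castSucc]
    exact (measurable_gradExpert_of x c k ih a).add (measurable_gradRouter_of x c k ih a)

theorem measurable_bwdP (k : Fin K) (i : Fin s.M) (e : Fin s.Ne) :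
    Measurable fun θ : Params s K => bwdP c x θ k i e := by
  have := measurable_bwdG (s := s) (K := K) x c
  simp_rw [bwdP_apply]
  fun_prop

theorem measurable_bwdQ (k : Fin K) (i : Fin s.M) :
    Measurable fun θ : Params s K => bwdQ c x θ k i := by
  have := measurable_bwdP (s := s) (K := K) x c
  have := measurable_h2 (s := s) (K := K) x
  simp_rw [bwdQ_apply]
  fun_prop

end Measurability

/-! ### Parameters that differ in one block -/

/-- The two parameter vectors agree outside of block `k`. -/
structure AgreeOff (k : Fin K) (θ θ' : Params s K) : Prop where
  w1 : ∀ a d, θ (.W1 a d) = θ' (.W1 a d)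
  q : ∀ j i a, j ≠ k → θ (.Q j i a) = θ' (.Q j i a)
  w2 : ∀ j i e a, j ≠ k → θ (.W2 j i e a) = θ' (.W2 j i e a)
  w3 : ∀ j i a e, j ≠ k → θ (.W3 j i a e) = θ' (.W3 j i a e)

namespace AgreeOff

variable {k : Fin K} {θ θ' : Params s K} (h : AgreeOff k θ θ') (x : Fin s.D → ℝ)
include h

theorem block_eq {j : Fin K} (hj : j ≠ k) : block θ j = block θ' j :=
  block_congr (fun i a => h.q j i a hj) (fun i e a => h.w2 j i e a hj) fun i a e => h.w3 j i a e hj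

theorem agg_castSucc : agg θ x k.castSucc = agg θ' x k.castSucc :=
  agg_congr h.w1 fun j hj => h.block_eq (ne_of_lt (by simpa using hj))

theorem agg_eq (hk : block θ k (agg θ' x k.castSucc) = block θ' k (agg θ' x k.castSucc))
    (j : Fin (K + 1)) : agg θ x j = agg θ' x j :=
  agg_congr_of_block h.w1 (fun _ hj => h.block_eq hj) hk j

/-- The gradient involves the later blocks, which agree, and the readout and base point, which are
aggregates. All aggregates agree once the output of block `k` at its actual input does. The old
readout weights play no role, as `withReadout` overwrites them. -/
theorem bwdG_eq (hk : block θ k (agg θ' x k.castSucc) = block θ' k (agg θ' x k.castSucc))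
    (c : ℝ) : bwdG c x θ k.succ = bwdG c x θ' k.succ := by
  have h1 : tail (withReadout c x θ) k.succ = tail (withReadout c x θ') k.succ := by
    refine tail_congr (fun a => ?_) fun j hj => ?_
    · simp only [withReadout, h.agg_eq x hk]
    · rw [block_withReadout, block_withReadout]
      exact h.block_eq (ne_of_gt (by simpa [Fin.succ_le_castSucc_iff] using hj))
  rw [bwdG, bwdG, gradAgg, gradAgg, h1, agg_withReadout, agg_withReadout, h.agg_eq x hk]

end AgreeOff

/-! ### The Gaussian blocks of the network -/

def idxW1 : Fin s.N × Fin s.D → ParamIdx s K := fun p => .W1 p.1 p.2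

/-- The router and the first expert matrices act on the same input and have the same variance, so
they are stacked into a single matrix. This allows the two parts of the input gradient to be treated
jointly. -/
def idxIn (k : Fin K) : (Fin s.M ⊕ Fin s.M × Fin s.Ne) × Fin s.N → ParamIdx s K
  | (.inl i, a) => .Q k i a
  | (.inr p, a) => .W2 k p.1 p.2 a

/-- The output matrices of all experts side by side form one matrix acting on the vector of gated
hidden states. -/
def idxW3 (k : Fin K) : Fin s.N × (Fin s.M × Fin s.Ne) → ParamIdx s K :=
  fun p => .W3 k p.2.1 p.1 p.2.2

theorem idxW1_injective : Function.Injective (idxW1 : _ → ParamIdx s K) := by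
  rintro ⟨a, d⟩ ⟨a', d'⟩ h
  simpa [idxW1] using h

theorem idxIn_injective (k : Fin K) : Function.Injective (idxIn (s := s) k) := by
  rintro ⟨i | i, a⟩ ⟨j | j, b⟩ h <;> simp_all [idxIn, Prod.ext_iff]

theorem idxW3_injective (k : Fin K) : Function.Injective (idxW3 (s := s) k) := by
  rintro ⟨a, i, e⟩ ⟨a', i', e'⟩ h
  simp_all [idxW3]

theorem agreeOff_of_eqOn_idxIn {k : Fin K} {θ θ' : Params s K}
    (h : ∀ p, (∀ q, idxIn k q ≠ p) → θ p = θ' p) : AgreeOff k θ θ' where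
  w1 a d := h _ (by rintro ⟨i | i, b⟩ <;> simp [idxIn])
  q j i a hj := h _ (by rintro ⟨i | i, b⟩ <;> simp [idxIn, Ne.symm hj])
  w2 j i e a hj := h _ (by rintro ⟨i | i, b⟩ <;> simp [idxIn, Ne.symm hj])
  w3 j i a e hj := h _ (by rintro ⟨i | i, b⟩ <;> simp [idxIn])

theorem agreeOff_of_eqOn_idxW3 {k : Fin K} {θ θ' : Params s K}
    (h : ∀ p, (∀ q, idxW3 k q ≠ p) → θ p = θ' p) : AgreeOff k θ θ' where
  w1 a d := h _ (by rintro ⟨i, b⟩; simp [idxW3])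
  q j i a hj := h _ (by rintro ⟨i, b⟩; simp [idxW3])
  w2 j i e a hj := h _ (by rintro ⟨i, b⟩; simp [idxW3])
  w3 j i a e hj := h _ (by rintro ⟨i, b⟩; simp [idxW3, Ne.symm hj])

theorem extend_eq_of_notMem {α β : Type*} {e : α → β} (y : α → ℝ) (θ : β → ℝ) (p : β)
    (hp : ∀ q, e q ≠ p) : Function.extend e y θ p = θ p :=
  Function.extend_apply' _ _ _ (by simpa using hp)

theorem psi_eq_of_eqOn_idxW3 {k : Fin K} {θ θ' : Params s K} (x : Fin s.D → ℝ)
    (h : ∀ p, (∀ q, idxW3 k q ≠ p) → θ p = θ' p) : psi θ x k = psi θ' x k := by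
  ext i
  rw [psi_apply, psi_apply, (agreeOff_of_eqOn_idxW3 h).agg_castSucc]
  refine Finset.sum_congr rfl fun a _ => ?_
  rw [h _ (by rintro ⟨i, b⟩; simp [idxW3])]

theorem h2_eq_of_eqOn_idxW3 {k : Fin K} {θ θ' : Params s K} (x : Fin s.D → ℝ)
    (h : ∀ p, (∀ q, idxW3 k q ≠ p) → θ p = θ' p) : h2 θ x k = h2 θ' x k := by
  ext i e
  rw [h2_apply, h2_apply, (agreeOff_of_eqOn_idxW3 h).agg_castSucc]
  refine Finset.sum_congr rfl fun a _ => ?_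
  rw [h _ (by rintro ⟨i, b⟩; simp [idxW3])]

theorem gatedIn_eq_of_eqOn_idxW3 {k : Fin K} {θ θ' : Params s K} (x : Fin s.D → ℝ)
    (h : ∀ p, (∀ q, idxW3 k q ≠ p) → θ p = θ' p) : gatedIn x θ k = gatedIn x θ' k := by
  ext p
  rw [gatedIn, gatedIn, phi, phi, psi_eq_of_eqOn_idxW3 x h, h2_eq_of_eqOn_idxW3 x h]

/-- The input matrix, fully resampled. -/
def blockW1 : GaussBlock (initVar : ParamIdx s K → ℝ≥0) (Fin s.N) (Fin s.D) where
  e := idxW1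
  u _ := 0
  σ := 1 / (s.D : ℝ≥0)
  inj := idxW1_injective
  var _ := rfl
  meas := measurable_const
  inv _ _ := rfl

/-- The matrices applied to the input of block `k`, fully resampled. -/
def blockIn (k : Fin K) : GaussBlock (initVar : ParamIdx s K → ℝ≥0)
    (Fin s.M ⊕ Fin s.M × Fin s.Ne) (Fin s.N) where
  e := idxIn k
  u _ := 0
  σ := 1 / (s.N : ℝ≥0)
  inj := idxIn_injective k
  var := by rintro ⟨i | i, a⟩ <;> rfl
  meas := measurable_const
  inv _ _ := rfl

/-- The matrices applied to the input of block `k`, resampled orthogonally to this input. -/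
def blockInPerp (x : Fin s.D → ℝ) (k : Fin K) : GaussBlock (initVar : ParamIdx s K → ℝ≥0)
    (Fin s.M ⊕ Fin s.M × Fin s.Ne) (Fin s.N) where
  e := idxIn k
  u θ := agg θ x k.castSucc
  σ := 1 / (s.N : ℝ≥0)
  inj := idxIn_injective k
  var := by rintro ⟨i | i, a⟩ <;> rfl
  meas := measurable_pi_lambda _ fun a => measurable_agg x _ a
  inv θ y := (agreeOff_of_eqOn_idxIn (extend_eq_of_notMem y θ)).agg_castSucc x

/-- The output matrices of the experts of block `k`, fully resampled. -/
def blockW3 (k : Fin K) : GaussBlock (initVar : ParamIdx s K → ℝ≥0)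
    (Fin s.N) (Fin s.M × Fin s.Ne) where
  e := idxW3 k
  u _ := 0
  σ := (s.M : ℝ≥0) / (s.Ne : ℝ≥0)
  inj := idxW3_injective k
  var _ := rfl
  meas := measurable_const
  inv _ _ := rfl

/-- The output matrices of the experts of block `k`, resampled orthogonally to the gated
hidden states. -/
def blockW3Perp (x : Fin s.D → ℝ) (k : Fin K) : GaussBlock (initVar : ParamIdx s K → ℝ≥0)
    (Fin s.N) (Fin s.M × Fin s.Ne) where
  e := idxW3 k
  u θ := gatedIn x θ k
  σ := (s.M : ℝ≥0) / (s.Ne : ℝ≥0)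
  inj := idxW3_injective k
  var _ := rfl
  meas := measurable_pi_lambda _ fun p => (measurable_phi x k p.1).mul (measurable_h2 x k p.1 p.2)
  inv θ y := gatedIn_eq_of_eqOn_idxW3 x (extend_eq_of_notMem y θ)

/-! ### Quantities preserved by the resamplings -/

section Invariance

variable (x : Fin s.D → ℝ) (k : Fin K) (c : ℝ)

theorem blockIn_agg (z) : agg ((blockIn (s := s) k).T z) x k.castSucc = agg z.1 x k.castSucc :=
  (agreeOff_of_eqOn_idxIn fun _ hp => (blockIn k).T_apply_of_notMem z hp).agg_castSucc x

theorem blockW3_h2 (z) : h2 ((blockW3 (s := s) k).T z) x k = h2 z.1 x k :=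
  h2_eq_of_eqOn_idxW3 x fun _ hp => (blockW3 k).T_apply_of_notMem z hp

theorem blockW3_gatedIn (z) : gatedIn x ((blockW3 (s := s) k).T z) k = gatedIn x z.1 k :=
  gatedIn_eq_of_eqOn_idxW3 x fun _ hp => (blockW3 k).T_apply_of_notMem z hp

theorem blockW3Perp_agreeOff (z) : AgreeOff k ((blockW3Perp x k).T z) z.1 :=
  agreeOff_of_eqOn_idxW3 fun _ hp => (blockW3Perp x k).T_apply_of_notMem z hp

theorem blockW3Perp_h2 (z) : h2 ((blockW3Perp x k).T z) x k = h2 z.1 x k :=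
  h2_eq_of_eqOn_idxW3 x fun _ hp => (blockW3Perp x k).T_apply_of_notMem z hp

theorem blockW3Perp_gatedIn (z) : gatedIn x ((blockW3Perp x k).T z) k = gatedIn x z.1 k :=
  gatedIn_eq_of_eqOn_idxW3 x fun _ hp => (blockW3Perp x k).T_apply_of_notMem z hp

/-- The product with the gated hidden states is kept by `T_mul_u`, and the output at the actual
input is a multiple of it. At any other input the block may change. -/
theorem blockW3Perp_block (z) : block ((blockW3Perp x k).T z) k (agg z.1 x k.castSucc) =
    block z.1 k (agg z.1 x k.castSucc) := by
  have h1 := (blockW3Perp_agreeOff x k z).agg_castSucc x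
  rw [← agg_succ]
  conv_lhs => rw [← h1, ← agg_succ]
  ext a
  rw [agg_succ_apply, agg_succ_apply, blockW3Perp_gatedIn]
  congr 1
  exact (blockW3Perp x k).T_mul_u z a

/-- The decoupling at the heart of the backward pass: the gradient depends on these output matrices
through the later aggregates and the readout, yet not on the part that is redrawn. -/
theorem blockW3Perp_bwdG (z) : bwdG c x ((blockW3Perp x k).T z) k.succ = bwdG c x z.1 k.succ :=
  (blockW3Perp_agreeOff x k z).bwdG_eq x (blockW3Perp_block x k z) c

theorem blockInPerp_agreeOff (z) : AgreeOff k ((blockInPerp x k).T z) z.1 :=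
  agreeOff_of_eqOn_idxIn fun _ hp => (blockInPerp x k).T_apply_of_notMem z hp

theorem blockInPerp_psi (z) : psi ((blockInPerp x k).T z) x k = psi z.1 x k := by
  ext i
  rw [psi_apply, psi_apply, (blockInPerp_agreeOff x k z).agg_castSucc]
  exact (blockInPerp x k).T_mul_u z (.inl i)

theorem blockInPerp_h2 (z) : h2 ((blockInPerp x k).T z) x k = h2 z.1 x k := by
  ext i e
  rw [h2_apply, h2_apply, (blockInPerp_agreeOff x k z).agg_castSucc]
  exact (blockInPerp x k).T_mul_u z (.inr (i, e))

theorem blockInPerp_phi (z) : phi ((blockInPerp x k).T z) x k = phi z.1 x k := by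
  rw [phi, phi, blockInPerp_psi]

theorem blockInPerp_W3 (z) (i : Fin s.M) (a : Fin s.N) (e : Fin s.Ne) :
    (blockInPerp x k).T z (.W3 k i a e) = z.1 (.W3 k i a e) :=
  (blockInPerp x k).T_apply_of_notMem z
    (by rintro ⟨i | i, b⟩ <;> simp [blockInPerp, idxIn])

/-- Logits and hidden states are products with the kept direction, and the output matrices do not
belong to the resampled block. -/
theorem blockInPerp_block (z) : block ((blockInPerp x k).T z) k (agg z.1 x k.castSucc) =
    block z.1 k (agg z.1 x k.castSucc) := by
  have h1 := (blockInPerp_agreeOff x k z).agg_castSucc x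
  rw [← agg_succ]
  conv_lhs => rw [← h1, ← agg_succ]
  ext a
  simp only [agg_succ_apply, gatedIn, blockInPerp_phi, blockInPerp_h2, blockInPerp_W3]

theorem blockInPerp_bwdG (z) : bwdG c x ((blockInPerp x k).T z) k.succ = bwdG c x z.1 k.succ :=
  (blockInPerp_agreeOff x k z).bwdG_eq x (blockInPerp_block x k z) c

theorem blockInPerp_bwdP (z) : bwdP c x ((blockInPerp x k).T z) k = bwdP c x z.1 k := by
  ext i e
  simp only [bwdP_apply, blockInPerp_bwdG, blockInPerp_W3]

theorem blockInPerp_bwdQ (z) : bwdQ c x ((blockInPerp x k).T z) k = bwdQ c x z.1 k := by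
  ext i
  simp only [bwdQ_apply, blockInPerp_bwdP, blockInPerp_h2]

end Invariance

end MoE

end

noncomputable section

namespace MoE

/-! ### Coordinate scales of conditionally Gaussian tensors -/

section Scales

variable {Ω : ℕ → Type*} [∀ n, MeasurableSpace (Ω n)] {μ : ∀ n, Measure (Ω n)}
  {ι κ : ℕ → Type} {α β : ℕ → ℝ}

/-- A tensor of bounded size has a bounded root mean square if its entries are bounded. -/
theorem BddP.rms_of_card_le [∀ n, Fintype (ι n)] {X : ∀ n, Ω n → κ n → ι n → ℝ} {L : ℕ}
    (h : BddP μ (fun n ω (p : κ n × ι n) => X n ω p.1 p.2) α)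
    (hL : ∀ᶠ n in atTop, Fintype.card (ι n) ≤ L) (hα : ∀ᶠ n in atTop, 0 ≤ α n) :
    BddP μ (fun n ω i => rms (X n ω i)) α := by
  intro ε hε
  -- Union bound over at most `L` entries; the added one keeps the level positive when `L = 0`.
  obtain ⟨C, hC, h⟩ := h (ε / (L + 1)) (by positivity)
  refine ⟨C, hC, ?_⟩
  filter_upwards [h, hL, hα] with n hn hLn hαn i
  have hsub : {ω | C * α n < |rms (X n ω i)|} ⊆ ⋃ j, {ω | C * α n < |X n ω i j|} := by
    intro ω hω
    by_contra hcon
    simp only [Set.mem_iUnion, Set.mem_ofPred_eq, not_exists, not_lt] at hcon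
    have hω : C * α n < |rms (X n ω i)| := hω
    rw [abs_of_nonneg (rms_nonneg _)] at hω
    refine absurd hω (not_lt.2 ?_)
    rw [rms, Real.sqrt_le_left (by positivity)]
    refine div_le_of_le_mul₀ (by positivity) (by positivity) ?_
    calc ∑ j, X n ω i j ^ 2 ≤ ∑ _j : ι n, (C * α n) ^ 2 := Finset.sum_le_sum fun j _ => by
          rw [← sq_abs]
          gcongr
          exact hcon j
      _ = _ := by simp [mul_comm]
  calc μ n _ ≤ ∑ j, μ n {ω | C * α n < |X n ω i j|} :=
        (measure_mono hsub).trans (measure_iUnion_fintype_le _ _)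
    _ ≤ ∑ _j : ι n, ENNReal.ofReal (ε / (L + 1)) := Finset.sum_le_sum fun j _ => hn (i, j)
    _ = ENNReal.ofReal (Fintype.card (ι n) * (ε / (L + 1))) := by
        rw [ENNReal.ofReal_mul (by positivity)]; simp
    _ ≤ ENNReal.ofReal ε := by
        refine ENNReal.ofReal_le_ofReal ?_
        have : (Fintype.card (ι n) : ℝ) ≤ L + 1 := by
          have : (Fintype.card (ι n) : ℝ) ≤ L := by exact_mod_cast hLn
          linarith
        calc (Fintype.card (ι n) : ℝ) * (ε / (L + 1)) ≤ (L + 1) * (ε / (L + 1)) := by gcongr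
          _ = ε := by field_simp

theorem uniformCoordScale_of_low [∀ n, Fintype (ι n)] {X : ∀ n, Ω n → κ n → ι n → ℝ}
    (hι : ∀ᶠ n in atTop, Nonempty (ι n)) (hα : ∀ᶠ n in atTop, 0 ≤ α n)
    (hlow : LowP μ (fun n ω (p : κ n × ι n) => X n ω p.1 p.2) α)
    (hbdd : BddP μ (fun n ω (p : κ n × ι n) => X n ω p.1 p.2) α)
    (hbdd' : BddP μ (fun n ω i => rms (X n ω i)) α) : UniformCoordScale μ X α :=
  uniformCoordScale_of hlow hbdd (hlow.rms hι hα) hbdd'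

theorem coordScale_of_low [∀ n, Fintype (ι n)] {X : ∀ n, Ω n → ι n → ℝ}
    (hι : ∀ᶠ n in atTop, Nonempty (ι n)) (hα : ∀ᶠ n in atTop, 0 ≤ α n)
    (hlow : LowP μ X α) (hbdd : BddP μ X α)
    (hbdd' : BddP μ (fun n ω (_ : Unit) => rms (X n ω)) α) : CoordScale μ X α :=
  uniformCoordScale_of_low hι hα (hlow.comp fun n (p : Unit × ι n) => p.2)
    (hbdd.comp fun n (p : Unit × ι n) => p.2) hbdd'

theorem CoordScale.low [∀ n, Fintype (ι n)] {X : ∀ n, Ω n → ι n → ℝ} (h : CoordScale μ X α) :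
    LowP μ X α := (UniformCoordScale.low h).comp fun _ j => ((), j)

theorem CoordScale.bdd [∀ n, Fintype (ι n)] {X : ∀ n, Ω n → ι n → ℝ} (h : CoordScale μ X α) :
    BddP μ X α := (UniformCoordScale.bdd h).comp fun _ j => ((), j)

theorem CoordScale.low_rms [∀ n, Fintype (ι n)] {X : ∀ n, Ω n → ι n → ℝ} (h : CoordScale μ X α) :
    LowP μ (fun n ω (_ : κ n) => rms (X n ω)) α :=
  (UniformCoordScale.low_rms h).comp fun _ _ => ()

theorem CoordScale.bdd_rms [∀ n, Fintype (ι n)] {X : ∀ n, Ω n → ι n → ℝ} (h : CoordScale μ X α) :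
    BddP μ (fun n ω (_ : κ n) => rms (X n ω)) α :=
  (UniformCoordScale.bdd_rms h).comp fun _ _ => ()

end Scales

/-! ### Coordinate scales from conditional means and variances -/

namespace GaussBlock

variable {I R C κ ι : ℕ → Type} [∀ n, Fintype (I n)] [∀ n, Fintype (R n)] [∀ n, Fintype (C n)]
  {v : ∀ n, I n → ℝ≥0} (S : ∀ n, GaussBlock (v n) (R n) (C n))
  {α : ℕ → ℝ} (hα : ∀ᶠ n in atTop, 0 < α n)

include hα in
/-- The coordinate scale of a tensor that is a rank one functional of a fully resampled block, with
a conditional variance that does not depend on the entry. -/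
theorem uniformCoordScale [∀ n, Fintype (ι n)] (hu : ∀ n θ, (S n).u θ = 0)
    {X : ∀ n, (I n → ℝ) → κ n → ι n → ℝ}
    {ρ : ∀ n, (I n → ℝ) → κ n → ι n → R n → ℝ} {τ : ∀ n, (I n → ℝ) → κ n → ι n → C n → ℝ}
    (hX : ∀ n i j, Measurable fun θ => X n θ i j)
    (hrep : ∀ n θ Y i j, X n ((S n).T (θ, Y)) i j =
      ∑ p : R n × C n, ρ n θ i j p.1 * τ n θ i j p.2 * (S n).T (θ, Y) ((S n).e p))
    (hι : ∀ᶠ n in atTop, Nonempty (ι n)) {V : ∀ n, (I n → ℝ) → κ n → ℝ}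
    (hcv : ∀ n θ i j, (S n).σ * (∑ r, ρ n θ i j r ^ 2) * ∑ c, τ n θ i j c ^ 2 = V n θ i)
    (hlow : LowP (fun n => gaussPi (v n)) V (fun n => α n ^ 2))
    (hbdd : BddP (fun n => gaussPi (v n)) V (fun n => α n ^ 2)) :
    UniformCoordScale (fun n => gaussPi (v n)) X α := by
  have hcv' : ∀ n θ i j, (S n).cvar θ (ρ n θ i j) (τ n θ i j) = V n θ i := fun n θ i j => by
    rw [← hcv n θ i j, cvar, hu, perpSq_zero]
  have hm : ∀ n θ i j, (S n).mean θ (ρ n θ i j) (τ n θ i j) = 0 := fun n θ i j => by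
    simp [mean, hu]
  have h0 : ∀ᶠ n in atTop, |(0 : ℝ)| ≤ 1 * α n := hα.mono fun n hn => by simpa using hn.le
  refine uniformCoordScale_of_low hι (hα.mono fun _ h => h.le) ?_ ?_ ?_
  · refine low S hα (ρ := fun n θ p => ρ n θ p.1 p.2) (τ := fun n θ p => τ n θ p.1 p.2)
      (fun n p => hX n p.1 p.2) (fun n θ Y p => hrep n θ Y p.1 p.2) ?_
    simp_rw [hcv']
    exact hlow.comp fun n (p : κ n × ι n) => p.1
  · refine bdd S hα (ρ := fun n θ p => ρ n θ p.1 p.2) (τ := fun n θ p => τ n θ p.1 p.2)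
      (fun n p => hX n p.1 p.2) (fun n θ Y p => hrep n θ Y p.1 p.2) ?_ ?_
    · simp_rw [hm]
      exact bddP_const one_pos h0
    · simp_rw [hcv']
      exact hbdd.comp fun n (p : κ n × ι n) => p.1
  · refine bdd_rms S hα hX hrep ?_ ?_
    · simp_rw [hm]
      refine bddP_const one_pos ?_
      simpa [rms] using h0
    · simp_rw [hcv']
      refine hbdd.congr (hι.mono fun n hn θ i => ?_)
      simp only [Finset.sum_const, Finset.card_univ, nsmul_eq_mul]
      field_simp

include hα in
/-- The coordinate scale of a tensor that is a rank one functional of a resampled block. -/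
theorem coordScale [∀ n, Fintype (ι n)] {X : ∀ n, (I n → ℝ) → ι n → ℝ}
    (ρ : ∀ n, (I n → ℝ) → ι n → R n → ℝ) (τ : ∀ n, (I n → ℝ) → ι n → C n → ℝ)
    (hX : ∀ n j, Measurable fun θ => X n θ j)
    (hrep : ∀ n θ Y j, X n ((S n).T (θ, Y)) j =
      ∑ p : R n × C n, ρ n θ j p.1 * τ n θ j p.2 * (S n).T (θ, Y) ((S n).e p))
    (hι : ∀ᶠ n in atTop, Nonempty (ι n))
    (hlow : LowP (fun n => gaussPi (v n)) (fun n θ j => (S n).cvar θ (ρ n θ j) (τ n θ j))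
      (fun n => α n ^ 2))
    (hb : BddP (fun n => gaussPi (v n)) (fun n θ j => (S n).mean θ (ρ n θ j) (τ n θ j)) α)
    (hV : BddP (fun n => gaussPi (v n)) (fun n θ j => (S n).cvar θ (ρ n θ j) (τ n θ j))
      (fun n => α n ^ 2))
    (hb' : BddP (fun n => gaussPi (v n))
      (fun n θ (_ : Unit) => rms fun j => (S n).mean θ (ρ n θ j) (τ n θ j)) α)
    (hV' : BddP (fun n => gaussPi (v n))
      (fun n θ (_ : Unit) => (∑ j, (S n).cvar θ (ρ n θ j) (τ n θ j)) / Fintype.card (ι n))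
      (fun n => α n ^ 2)) :
    CoordScale (fun n => gaussPi (v n)) X α :=
  coordScale_of_low hι (hα.mono fun _ h => h.le) (low S hα hX hrep hlow) (bdd S hα hX hrep hb hV)
    (bdd_rms S hα (X := fun n θ (_ : Unit) j => X n θ j) (ρ := fun n θ _ j => ρ n θ j)
      (τ := fun n θ _ j => τ n θ j) (fun n _ j => hX n j) (fun n θ Y _ j => hrep n θ Y j) hb' hV')

end GaussBlock

theorem sum_row_single {R C : Type*} [Fintype R] [Fintype C] [DecidableEq R] (r : R) (τ : C → ℝ)
    (f : R × C → ℝ) :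
    ∑ p : R × C, (if p.1 = r then 1 else 0) * τ p.2 * f p = ∑ c, τ c * f (r, c) := by
  rw [Fintype.sum_prod_type, Finset.sum_eq_single r (fun b _ hb => by simp [hb]) (by simp)]
  simp

theorem sum_col_single {R C : Type*} [Fintype R] [Fintype C] [DecidableEq C] (c : C) (ρ : R → ℝ)
    (f : R × C → ℝ) :
    ∑ p : R × C, ρ p.1 * (if p.2 = c then 1 else 0) * f p = ∑ r, ρ r * f (r, c) := by
  rw [Fintype.sum_prod_type]
  refine Finset.sum_congr rfl fun r _ => ?_
  rw [Finset.sum_eq_single c (fun b _ hb => by simp [hb]) (by simp)]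
  simp

/-- The trajectory of widths and inputs. -/
structure Regime (s : ℕ → Shape) (x : ∀ n, Fin (s n).D → ℝ) : Prop where
  tendsto_N : Tendsto (fun n => (s n).N) atTop atTop
  M_ge : ∃ c : ℝ, 0 < c ∧ ∀ᶠ n in atTop, c * (s n).N ≤ (s n).M
  M_le : ∃ C : ℝ, 0 < C ∧ ∀ᶠ n in atTop, ((s n).M : ℝ) ≤ C * (s n).N
  Ne_pos : ∀ᶠ n in atTop, 0 < (s n).Ne
  Ne_le : ∃ L : ℕ, ∀ᶠ n in atTop, (s n).Ne ≤ L
  x_ge : ∃ c : ℝ, 0 < c ∧ ∀ᶠ n in atTop, c ≤ (∑ d, x n d ^ 2) / (s n).D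
  x_le : ∃ C : ℝ, 0 < C ∧ ∀ᶠ n in atTop, (∑ d, x n d ^ 2) / (s n).D ≤ C

/-- The law of the parameters at initialization. -/
abbrev initLaw (s : Shape) (K : ℕ) : Measure (Params s K) :=
  gaussPi (initVar : ParamIdx s K → ℝ≥0)

/-! ### The embedding, the logits and the hidden states -/

section Forward

variable {s : ℕ → Shape} {x : ∀ n, Fin (s n).D → ℝ} {K : ℕ}

namespace Regime

variable (hR : Regime s x)
include hR

theorem N_pos : ∀ᶠ n in atTop, 0 < (s n).N := hR.tendsto_N.eventually_gt_atTop 0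

theorem N_pos' : ∀ᶠ n in atTop, (0 : ℝ) < (s n).N := hR.N_pos.mono fun _ h => by exact_mod_cast h

theorem M_pos' : ∀ᶠ n in atTop, (0 : ℝ) < (s n).M := by
  obtain ⟨c, hc, h⟩ := hR.M_ge
  filter_upwards [h, hR.N_pos'] with n hn hN
  exact lt_of_lt_of_le (by positivity) hn

theorem M_pos : ∀ᶠ n in atTop, 0 < (s n).M := hR.M_pos'.mono fun _ h => by exact_mod_cast h

theorem nonempty_N : ∀ᶠ n in atTop, Nonempty (Fin (s n).N) :=
  hR.N_pos.mono fun _ h => ⟨⟨0, h⟩⟩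

theorem nonempty_M : ∀ᶠ n in atTop, Nonempty (Fin (s n).M) :=
  hR.M_pos.mono fun _ h => ⟨⟨0, h⟩⟩

theorem nonempty_Ne : ∀ᶠ n in atTop, Nonempty (Fin (s n).Ne) :=
  hR.Ne_pos.mono fun _ h => ⟨⟨0, h⟩⟩

theorem nonempty_MNe : ∀ᶠ n in atTop, Nonempty (Fin (s n).M × Fin (s n).Ne) := by
  filter_upwards [hR.nonempty_M, hR.nonempty_Ne] with n h1 h2
  infer_instance

end Regime

theorem eventually_one_pos : ∀ᶠ _ : ℕ in atTop, (0 : ℝ) < 1 := Eventually.of_forall fun _ => one_pos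

theorem eventually_one_nonneg : ∀ᶠ _ : ℕ in atTop, (0 : ℝ) ≤ 1 :=
  Eventually.of_forall fun _ => zero_le_one

theorem agg_zero_scale (hR : Regime s x) :
    CoordScale (fun n => initLaw (s n) K) (fun n θ => agg θ (x n) 0) (fun _ => 1) := by
  refine GaussBlock.uniformCoordScale (fun n => blockW1 (s := s n) (K := K)) eventually_one_pos
    (fun _ _ => rfl) (ρ := fun n θ _ a r => if r = a then 1 else 0) (τ := fun n θ _ a => x n)
    (V := fun n _ _ => (∑ d, x n d ^ 2) / (s n).D)
    (fun n _ a => measurable_agg (x n) 0 a) (fun n θ Y _ a => ?_) hR.nonempty_N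
    (fun n θ _ a => ?_) ?_ ?_
  · rw [sum_row_single]
    change ∑ d, (blockW1 (s := s n) (K := K)).T (θ, Y) (.W1 a d) * x n d = _
    exact Finset.sum_congr rfl fun d _ => mul_comm _ _
  · simp [blockW1]
    ring
  · obtain ⟨c, hc, h⟩ := hR.x_ge
    exact lowP_const hc (h.mono fun n hn => by simpa using hn.trans (le_abs_self _))
  · obtain ⟨C, hC, h⟩ := hR.x_le
    refine bddP_const hC (h.mono fun n hn => ?_)
    rw [abs_of_nonneg (by positivity)]
    simpa using hn

section Step

variable (hR : Regime s x) {k : Fin K}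
  (hagg : CoordScale (fun n => initLaw (s n) K) (fun n θ => agg θ (x n) k.castSucc) (fun _ => 1))
include hR hagg

/-- The input of the block does not involve the matrices of the block. Given this input, each logit
is centered Gaussian with variance the mean square of the input. -/
theorem psi_scale :
    CoordScale (fun n => initLaw (s n) K) (fun n θ => psi θ (x n) k) (fun _ => 1) := by
  refine GaussBlock.uniformCoordScale (fun n => blockIn (s := s n) k) eventually_one_pos
    (fun _ _ => rfl) (ρ := fun n θ _ i r => if r = .inl i then 1 else 0)
    (τ := fun n θ _ i => agg θ (x n) k.castSucc)
    (V := fun n θ _ => rms (agg θ (x n) k.castSucc) ^ 2)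
    (fun n _ i => measurable_psi (x n) k i) (fun n θ Y _ i => ?_) hR.nonempty_M
    (fun n θ _ i => ?_) (hagg.low_rms.sq eventually_one_nonneg) hagg.bdd_rms.sq
  · rw [sum_row_single]
    beta_reduce
    rw [psi_apply, blockIn_agg]
    exact Finset.sum_congr rfl fun d _ => mul_comm _ _
  · simp [blockIn, rms_sq]
    ring

theorem h2_full_scale :
    CoordScale (fun n => initLaw (s n) K)
      (fun n θ (p : Fin (s n).M × Fin (s n).Ne) => h2 θ (x n) k p.1 p.2) (fun _ => 1) := by
  refine GaussBlock.uniformCoordScale (fun n => blockIn (s := s n) k) eventually_one_pos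
    (fun _ _ => rfl) (ρ := fun n θ _ i r => if r = .inr i then 1 else 0)
    (τ := fun n θ _ i => agg θ (x n) k.castSucc)
    (V := fun n θ _ => rms (agg θ (x n) k.castSucc) ^ 2)
    (fun n _ i => measurable_h2 (x n) k i.1 i.2) (fun n θ Y _ i => ?_) hR.nonempty_MNe
    (fun n θ _ i => ?_) (hagg.low_rms.sq eventually_one_nonneg) hagg.bdd_rms.sq
  · rw [sum_row_single]
    beta_reduce
    rw [h2_apply, blockIn_agg]
    exact Finset.sum_congr rfl fun d _ => mul_comm _ _
  · simp [blockIn, rms_sq]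
    ring

/-- `h2_full_scale` averages over the experts and says nothing about the root mean square of a
single one. That vector has a bounded number of entries, so a union bound over them suffices. -/
theorem h2_scale :
    UniformCoordScale (fun n => initLaw (s n) K) (fun n θ => h2 θ (x n) k) (fun _ => 1) := by
  obtain ⟨L, hL⟩ := hR.Ne_le
  have h := h2_full_scale hR hagg
  exact uniformCoordScale_of_low hR.nonempty_Ne eventually_one_nonneg h.low h.bdd
    (h.bdd.rms_of_card_le (X := fun n θ => h2 θ (x n) k) (by simpa using hL) eventually_one_nonneg)

theorem phi_low : LowP (fun n => initLaw (s n) K) (fun n θ => phi θ (x n) k) (fun _ => 1) := by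
  refine (psi_scale hR hagg).bdd.lowP_of (fun _ i => i) fun C hC =>
    ⟨Real.sigmoid (-C), Real.sigmoid_pos _, Eventually.of_forall fun n θ i h => ?_⟩
  rw [mul_one] at h ⊢
  exact (Real.sigmoid_le (neg_le_of_abs_le h)).trans (le_abs_self _)

/-- The derivative of the sigmoid at `u` is the product of its values at `u` and `-u`; both are at
least the value at `-C` when `|u| ≤ C`. -/
theorem dphi_low : LowP (fun n => initLaw (s n) K) (fun n θ => dphi θ (x n) k) (fun _ => 1) := by
  refine (psi_scale hR hagg).bdd.lowP_of (fun _ i => i) fun C hC =>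
    ⟨Real.sigmoid (-C) * Real.sigmoid (-C), by
      have := Real.sigmoid_pos (-C); positivity, Eventually.of_forall fun n θ i h => ?_⟩
  rw [mul_one] at h ⊢
  refine le_trans ?_ (le_abs_self _)
  have h1 := Real.sigmoid_le (neg_le_of_abs_le h)
  have h2 : Real.sigmoid (-C) ≤ 1 - Real.sigmoid (psi θ (x n) k i) := by
    rw [← Real.sigmoid_neg]
    exact Real.sigmoid_le (neg_le_neg (le_of_abs_le h))
  exact mul_le_mul h1 h2 (Real.sigmoid_nonneg _) (Real.sigmoid_nonneg _)

end Step

end Forward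

end MoE

end

noncomputable section

namespace MoE

/-! ### The gates, the aggregates and the expert outputs -/

section ForwardPass

variable {s : ℕ → Shape} {x : ∀ n, Fin (s n).D → ℝ} {K : ℕ}

theorem phi_nonneg {s : Shape} (θ : Params s K) (x : Fin s.D → ℝ) (k : Fin K) (i : Fin s.M) :
    0 ≤ phi θ x k i := Real.sigmoid_nonneg _

theorem phi_le_one {s : Shape} (θ : Params s K) (x : Fin s.D → ℝ) (k : Fin K) (i : Fin s.M) :
    phi θ x k i ≤ 1 := Real.sigmoid_le_one _

theorem abs_phi_le_one {s : Shape} (θ : Params s K) (x : Fin s.D → ℝ) (k : Fin K) (i : Fin s.M) :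
    |phi θ x k i| ≤ 1 := abs_le.2 ⟨by linarith [phi_nonneg θ x k i], phi_le_one θ x k i⟩

theorem dphi_nonneg {s : Shape} (θ : Params s K) (x : Fin s.D → ℝ) (k : Fin K) (i : Fin s.M) :
    0 ≤ dphi θ x k i := mul_nonneg (phi_nonneg _ _ _ _) (sub_nonneg.2 (phi_le_one _ _ _ _))

theorem abs_dphi_le_one {s : Shape} (θ : Params s K) (x : Fin s.D → ℝ) (k : Fin K) (i : Fin s.M) :
    |dphi θ x k i| ≤ 1 := by
  rw [abs_of_nonneg (dphi_nonneg _ _ _ _), dphi]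
  nlinarith [phi_nonneg θ x k i, phi_le_one θ x k i]

/-- The gate saturates fast enough to compensate the size of the logit. -/
theorem abs_dphi_mul_psi_le_one {s : Shape} (θ : Params s K) (x : Fin s.D → ℝ) (k : Fin K)
    (i : Fin s.M) : |dphi θ x k i * psi θ x k i| ≤ 1 := by
  -- The left side is `u / (1 + e ^ u)`. Of the two sigmoid factors of the derivative, only the one
  -- that decays on the side of the logit is needed.
  have key : ∀ u : ℝ, 0 ≤ u → Real.sigmoid (-u) * u ≤ 1 := fun u hu => by
    rw [Real.sigmoid_def, neg_neg, inv_mul_le_iff₀ (by positivity), mul_one]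
    linarith [Real.add_one_le_exp u]
  have h1 : dphi θ x k i = Real.sigmoid (psi θ x k i) * Real.sigmoid (-psi θ x k i) := by
    rw [Real.sigmoid_neg]; rfl
  rw [abs_mul, abs_of_nonneg (dphi_nonneg _ _ _ _), h1]
  rcases le_total 0 (psi θ x k i) with h | h
  · rw [abs_of_nonneg h, mul_assoc]
    exact mul_le_one₀ (Real.sigmoid_le_one _) (mul_nonneg (Real.sigmoid_nonneg _) h) (key _ h)
  · rw [abs_of_nonpos h, mul_comm (Real.sigmoid _), mul_assoc]
    have := key (-psi θ x k i) (by linarith)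
    rw [neg_neg] at this
    exact mul_le_one₀ (Real.sigmoid_le_one _)
      (mul_nonneg (Real.sigmoid_nonneg _) (by linarith)) this

theorem rms_le_of_abs_le {ι : Type*} [Fintype ι] {v : ι → ℝ} {C : ℝ} (hC : 0 ≤ C)
    (h : ∀ j, |v j| ≤ C) : rms v ≤ C := by
  rw [rms, Real.sqrt_le_left hC]
  refine div_le_of_le_mul₀ (by positivity) (by positivity) ?_
  calc ∑ j, v j ^ 2 ≤ ∑ _j : ι, C ^ 2 := Finset.sum_le_sum fun j _ => by
        rw [← sq_abs]; exact pow_le_pow_left₀ (abs_nonneg _) (h j) 2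
    _ = _ := by simp [mul_comm]

theorem rms_mono_of {ι : Type*} [Fintype ι] {v w : ι → ℝ} (h : ∀ j, |v j| ≤ |w j|) :
    |rms v| ≤ |rms w| := by
  rw [abs_of_nonneg (rms_nonneg _), abs_of_nonneg (rms_nonneg _)]
  exact rms_mono h

section Step

variable (hR : Regime s x) {k : Fin K}
  (hagg : CoordScale (fun n => initLaw (s n) K) (fun n θ => agg θ (x n) k.castSucc) (fun _ => 1))
include hR hagg

theorem phi_scale :
    CoordScale (fun n => initLaw (s n) K) (fun n θ => phi θ (x n) k) (fun _ => 1) := by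
  have h1 : BddP (ι := fun _ => Unit) (fun n => initLaw (s n) K) (fun _ _ _ => (1 : ℝ))
      (fun _ => 1) := bddP_const one_pos (by simp)
  refine coordScale_of_low hR.nonempty_M eventually_one_nonneg (phi_low hR hagg) ?_ ?_
  · exact (h1.comp fun _ _ => ()).mono (Eventually.of_forall fun n θ i => by
      simpa using abs_phi_le_one θ (x n) k i)
  · refine h1.mono (Eventually.of_forall fun n θ _ => ?_)
    rw [abs_of_nonneg (rms_nonneg _), abs_one]
    exact rms_le_of_abs_le zero_le_one fun i => abs_phi_le_one θ (x n) k i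

theorem gatedIn_scale :
    CoordScale (fun n => initLaw (s n) K) (fun n θ => gatedIn (x n) θ k) (fun _ => 1) := by
  have hz := h2_full_scale hR hagg
  have hle : ∀ n (θ : Params (s n) K) p, |gatedIn (x n) θ k p| ≤ |h2 θ (x n) k p.1 p.2| := by
    intro n θ p
    rw [gatedIn, abs_mul]
    exact mul_le_of_le_one_left (abs_nonneg _) (abs_phi_le_one _ _ _ _)
  refine coordScale_of_low hR.nonempty_MNe eventually_one_nonneg ?_ ?_ ?_
  · have := ((phi_low hR hagg).comp fun n (p : Fin (s n).M × Fin (s n).Ne) => p.1).mul hz.low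
      eventually_one_nonneg
    simp only [mul_one] at this
    exact this
  · exact hz.bdd.mono (Eventually.of_forall fun n θ p => hle n θ p)
  · exact hz.bdd_rms.mono (Eventually.of_forall fun n θ _ => rms_mono_of (hle n θ))

/-- The gated hidden states are independent of the output matrices. Averaging with weight `1 / M`
against weights of variance `M / Ne` gives the conditional variance `(M / Ne) * M⁻² * ∑ gatedIn²`,
which is exactly the mean square of `gatedIn`. -/
theorem agg_succ_scale :
    CoordScale (fun n => initLaw (s n) K) (fun n θ => agg θ (x n) k.succ) (fun _ => 1) := by
  have hu := gatedIn_scale hR hagg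
  refine GaussBlock.uniformCoordScale (fun n => blockW3 (s := s n) k) eventually_one_pos
    (fun _ _ => rfl) (ρ := fun n θ _ a r => if r = a then 1 else 0)
    (τ := fun n θ _ a p => 1 / ((s n).M : ℝ) * gatedIn (x n) θ k p)
    (V := fun n θ _ => rms (gatedIn (x n) θ k) ^ 2)
    (fun n _ a => measurable_agg (x n) _ a) (fun n θ Y _ a => ?_) hR.nonempty_N
    (fun n θ _ a => ?_) (hu.low_rms.sq eventually_one_nonneg) hu.bdd_rms.sq
  · rw [sum_row_single (τ := fun p => 1 / ((s n).M : ℝ) * gatedIn (x n) θ k p)]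
    beta_reduce
    rw [agg_succ_apply, blockW3_gatedIn, Finset.mul_sum]
    refine Finset.sum_congr rfl fun p _ => ?_
    rw [mul_comm (_ : ℝ) (gatedIn _ _ _ _), mul_assoc]
    rfl
  · simp only [blockW3, mul_pow, ← Finset.mul_sum, rms_sq, Fintype.card_prod, Fintype.card_fin]
    simp
    rcases eq_or_ne ((s n).M : ℝ) 0 with h | h
    · simp [h]
    · field_simp

/-- A single expert sums only `Ne` terms with weights of variance `M / Ne`, so nothing averages the
factor `M`: the conditional variance is `M` times the mean square of its hidden state, of order `N`.
-/
theorem h3_scale :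
    UniformCoordScale (fun n => initLaw (s n) K) (fun n θ => h3 θ (x n) k)
      (fun n => √((s n).N : ℝ)) := by
  have hz := h2_scale hR hagg
  obtain ⟨c, hc, hMc⟩ := hR.M_ge
  obtain ⟨C, hC, hMC⟩ := hR.M_le
  have hsq : ∀ n, √((s n).N : ℝ) ^ 2 = (s n).N * 1 ^ 2 := fun n => by
    rw [Real.sq_sqrt (by positivity)]; ring
  refine GaussBlock.uniformCoordScale (fun n => blockW3 (s := s n) k)
    (hR.N_pos'.mono fun n h => Real.sqrt_pos.2 h)
    (fun _ _ => rfl) (ρ := fun n θ i a r => if r = a then 1 else 0)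
    (τ := fun n θ i a p => if p.1 = i then h2 θ (x n) k p.1 p.2 else 0)
    (V := fun n θ i => (s n).M * rms (h2 θ (x n) k i) ^ 2)
    (fun n i a => measurable_h3 (x n) _ i a) (fun n θ Y i a => ?_) hR.nonempty_N
    (fun n θ i a => ?_) ?_ ?_
  · rw [sum_row_single a (fun p : Fin (s n).M × Fin (s n).Ne =>
      if p.1 = i then h2 θ (x n) k p.1 p.2 else 0),
      h3_apply, blockW3_h2, Fintype.sum_prod_type,
      Finset.sum_eq_single i (fun b _ hb => by simp [hb]) (by simp)]
    refine Finset.sum_congr rfl fun e _ => ?_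
    simp only [if_true]
    rw [mul_comm]
    rfl
  · have : ∑ p : Fin (s n).M × Fin (s n).Ne,
        (if p.1 = i then h2 θ (x n) k p.1 p.2 else 0) ^ 2 = ∑ e, h2 θ (x n) k i e ^ 2 := by
      rw [Fintype.sum_prod_type, Finset.sum_eq_single i (fun b _ hb => by simp [hb]) (by simp)]
      simp
    rw [this, rms_sq]
    simp [blockW3]
    ring
  · simp_rw [hsq]
    refine LowP.mul (α := fun n => ((s n).N : ℝ)) (β := fun _ => 1 ^ 2)
      (lowP_const hc (hMc.mono fun n h => ?_)) (hz.low_rms.sq eventually_one_nonneg) (by simp)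
    simpa using h
  · simp_rw [hsq]
    refine BddP.mul (α := fun n => ((s n).N : ℝ)) (β := fun _ => 1 ^ 2)
      (bddP_const hC (hMC.mono fun n h => ?_)) hz.bdd_rms.sq
    simpa using h

/-- The fourth moment of the hidden states of the experts. -/
theorem h2_pow_four_bdd :
    BddP (ι := fun _ => Unit) (fun n => initLaw (s n) K)
      (fun n θ _ => (∑ p : Fin (s n).M × Fin (s n).Ne, h2 θ (x n) k p.1 p.2 ^ 4) /
        ((s n).M * (s n).Ne)) (fun _ => 1) := by
  have hm : ∀ n i e, Measurable fun θ : Params (s n) K => h2 θ (x n) k i e :=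
    fun n => measurable_h2 (x n) k
  refine bddP_of_measurePreserving
    (fun n => (blockIn (s := s n) k).measurePreserving)
    -- Given the input, every hidden state is centered Gaussian with variance the mean square of the
    -- input, and the fourth moment scales as the square of the variance.
    (B := fun n θ _ => fourthMoment * (rms (agg θ (x n) k.castSucc) ^ 2) ^ 2)
    (fun n _ => by fun_prop) (fun n θ _ => by positivity) (fun n θ _ => ?_) eventually_one_pos ?_
  · have hTm : Measurable fun Y => (blockIn (s := s n) k).T (θ, Y) :=
      (blockIn k).measurePreserving.measurable.comp measurable_prodMk_left
    have hent : ∀ p : Fin (s n).M × Fin (s n).Ne,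
        ∫⁻ Y, ENNReal.ofReal (h2 ((blockIn (s := s n) k).T (θ, Y)) (x n) k p.1 p.2 ^ 4)
          ∂(blockIn (s := s n) k).γ =
        ENNReal.ofReal (fourthMoment * (rms (agg θ (x n) k.castSucc) ^ 2) ^ 2) := by
      intro p
      have hlaw := (blockIn (s := s n) k).map_rankOne θ
        (fun r => if r = .inr p then 1 else 0) (agg θ (x n) k.castSucc)
      have hmean : (blockIn (s := s n) k).mean θ (fun r => if r = .inr p then 1 else 0)
        (agg θ (x n) k.castSucc) = 0 := by simp [GaussBlock.mean, blockIn]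
      have hcvar : (blockIn (s := s n) k).cvar θ (fun r => if r = .inr p then 1 else 0)
          (agg θ (x n) k.castSucc) = rms (agg θ (x n) k.castSucc) ^ 2 := by
        rw [GaussBlock.cvar, show (blockIn (s := s n) k).u θ = 0 from rfl, perpSq_zero, rms_sq]
        simp [blockIn]
        ring
      rw [hmean, hcvar] at hlaw
      rw [← lintegral_pow_four_gaussianReal (sq_nonneg _), ← hlaw,
        lintegral_map (by fun_prop) (by fun_prop)]
      refine lintegral_congr fun Y => ?_
      rw [sum_row_single, h2_apply, blockIn_agg]
      congr 2
      exact Finset.sum_congr rfl fun d _ => mul_comm _ _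
    have h0 : (0 : ℝ) ≤ (((s n).M : ℝ) * (s n).Ne)⁻¹ := by positivity
    simp_rw [div_eq_inv_mul, ENNReal.ofReal_mul h0]
    rw [lintegral_const_mul _ (by fun_prop)]
    have hsum : ∀ Y, ENNReal.ofReal (∑ p : Fin (s n).M × Fin (s n).Ne,
        h2 ((blockIn (s := s n) k).T (θ, Y)) (x n) k p.1 p.2 ^ 4) =
        ∑ p : Fin (s n).M × Fin (s n).Ne,
          ENNReal.ofReal (h2 ((blockIn (s := s n) k).T (θ, Y)) (x n) k p.1 p.2 ^ 4) :=
      fun Y => ENNReal.ofReal_sum_of_nonneg fun p _ => by positivity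
    simp_rw [hsum]
    rw [lintegral_finsetSum _ fun j _ => by fun_prop]
    simp_rw [hent]
    rw [Finset.sum_const, Finset.card_univ, nsmul_eq_mul, ← mul_assoc]
    refine mul_le_of_le_one_left (zero_le) ?_
    rw [Fintype.card_prod, Fintype.card_fin, Fintype.card_fin, ← Nat.cast_mul,
      ← ENNReal.ofReal_natCast, ← ENNReal.ofReal_mul (by positivity)]
    rw [← ENNReal.ofReal_one]
    exact ENNReal.ofReal_le_ofReal inv_mul_le_one
  · have h := (bddP_const (μ := fun n => initLaw (s n) K) (ι := fun _ => Unit)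
      (a := fun _ => fourthMoment) (α := fun _ => 1) (C := fourthMoment + 1)
      (by linarith [fourthMoment_nonneg])
      (Eventually.of_forall fun _ => by
        rw [abs_of_nonneg fourthMoment_nonneg]; linarith)).mul hagg.bdd_rms.sq.sq
    simpa using h

end Step

/-- All the aggregates are of order one at initialization. -/
theorem agg_scale (hR : Regime s x) (k : Fin (K + 1)) :
    CoordScale (fun n => initLaw (s n) K) (fun n θ => agg θ (x n) k) (fun _ => 1) := by
  induction k using Fin.induction with
  | zero => exact agg_zero_scale hR
  | succ k ih => exact agg_succ_scale hR ih

/-! ### The weights -/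

theorem inv_sqrt_sq (n : ℕ) : (1 / √((s n).N : ℝ)) ^ 2 = 1 / ((s n).N : ℝ) := by
  rw [div_pow, one_pow, Real.sq_sqrt (by positivity)]

theorem matQ_scale (hR : Regime s x) (k : Fin K) :
    CoordScale (fun n => initLaw (s n) K)
      (fun n θ (p : Fin (s n).M × Fin (s n).N) => matQ θ k p.1 p.2)
      (fun n => 1 / √((s n).N : ℝ)) := by
  refine GaussBlock.uniformCoordScale (fun n => blockIn (s := s n) k)
    (hR.N_pos'.mono fun n h => one_div_pos.2 (Real.sqrt_pos.2 h))
    (fun _ _ => rfl) (ρ := fun n θ _ p r => if r = .inl p.1 then 1 else 0)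
    (τ := fun n θ _ p c => if c = p.2 then 1 else 0)
    (V := fun n θ _ => 1 / ((s n).N : ℝ))
    (fun n _ p => measurable_pi_apply (ParamIdx.Q k p.1 p.2)) (fun n θ Y _ p => ?_) ?_
    (fun n θ _ a => ?_) ?_ ?_
  · refine Eq.trans ?_ (sum_row_single (Sum.inl p.1)
      (fun c : Fin (s n).N => if c = p.2 then (1 : ℝ) else 0) _).symm
    simp [blockIn, idxIn, matQ]
  · filter_upwards [hR.nonempty_M, hR.nonempty_N] with n h1 h2
    infer_instance
  · simp [blockIn]
  · simp_rw [inv_sqrt_sq]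
    exact lowP_const one_pos (Eventually.of_forall fun n => by rw [one_mul]; exact le_abs_self _)
  · simp_rw [inv_sqrt_sq]
    exact bddP_const one_pos (Eventually.of_forall fun n => by rw [one_mul, abs_of_nonneg (by
      positivity)])

theorem matW2_scale (hR : Regime s x) (k : Fin K) :
    UniformCoordScale (fun n => initLaw (s n) K)
      (fun n θ i (p : Fin (s n).Ne × Fin (s n).N) => matW2 θ k i p.1 p.2)
      (fun n => 1 / √((s n).N : ℝ)) := by
  refine GaussBlock.uniformCoordScale (fun n => blockIn (s := s n) k)
    (hR.N_pos'.mono fun n h => one_div_pos.2 (Real.sqrt_pos.2 h))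
    (fun _ _ => rfl) (ρ := fun n θ i p r => if r = .inr (i, p.1) then 1 else 0)
    (τ := fun n θ _ p c => if c = p.2 then 1 else 0)
    (V := fun n θ _ => 1 / ((s n).N : ℝ))
    (fun n i p => measurable_pi_apply (ParamIdx.W2 k i p.1 p.2)) (fun n θ Y i p => ?_) ?_
    (fun n θ _ a => ?_) ?_ ?_
  · refine Eq.trans ?_ (sum_row_single (Sum.inr (i, p.1))
      (fun c : Fin (s n).N => if c = p.2 then (1 : ℝ) else 0) _).symm
    simp [blockIn, idxIn, matW2]
  · filter_upwards [hR.nonempty_Ne, hR.nonempty_N] with n h1 h2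
    infer_instance
  · simp [blockIn]
  · simp_rw [inv_sqrt_sq]
    exact lowP_const one_pos (Eventually.of_forall fun n => by rw [one_mul]; exact le_abs_self _)
  · simp_rw [inv_sqrt_sq]
    exact bddP_const one_pos (Eventually.of_forall fun n => by rw [one_mul, abs_of_nonneg (by
      positivity)])

/-- The variance of the output matrices of the experts is of order `N`. -/
theorem Regime.div_ge (hR : Regime s x) :
    ∃ c : ℝ, 0 < c ∧ ∀ᶠ n in atTop, c * (s n).N ≤ (s n).M / (s n).Ne := by
  obtain ⟨c, hc, hM⟩ := hR.M_ge
  obtain ⟨L, hL⟩ := hR.Ne_le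
  refine ⟨c / (L + 1), by positivity, ?_⟩
  filter_upwards [hM, hL, hR.Ne_pos] with n h1 h2 h3
  have h3' : (0 : ℝ) < (s n).Ne := by exact_mod_cast h3
  have h2' : ((s n).Ne : ℝ) ≤ L + 1 := by
    have : ((s n).Ne : ℝ) ≤ L := by exact_mod_cast h2
    linarith
  rw [div_mul_eq_mul_div]
  exact div_le_div₀ (by positivity) h1 h3' h2'

theorem Regime.div_le (hR : Regime s x) :
    ∃ C : ℝ, 0 < C ∧ ∀ᶠ n in atTop, ((s n).M / (s n).Ne : ℝ) ≤ C * (s n).N := by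
  obtain ⟨C, hC, hM⟩ := hR.M_le
  refine ⟨C, hC, ?_⟩
  filter_upwards [hM, hR.Ne_pos] with n h1 h3
  have h3' : (1 : ℝ) ≤ (s n).Ne := by exact_mod_cast h3
  exact (div_le_self (by positivity) h3').trans h1

theorem matW3_scale (hR : Regime s x) (k : Fin K) :
    UniformCoordScale (fun n => initLaw (s n) K)
      (fun n θ i (p : Fin (s n).N × Fin (s n).Ne) => matW3 θ k i p.1 p.2)
      (fun n => √((s n).N : ℝ)) := by
  have hsq : ∀ n, √((s n).N : ℝ) ^ 2 = (s n).N := fun n => Real.sq_sqrt (by positivity)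
  refine GaussBlock.uniformCoordScale (fun n => blockW3 (s := s n) k)
    (hR.N_pos'.mono fun n h => Real.sqrt_pos.2 h)
    (fun _ _ => rfl) (ρ := fun n θ i p r => if r = p.1 then 1 else 0)
    (τ := fun n θ i p c => if c = (i, p.2) then 1 else 0)
    (V := fun n θ _ => ((s n).M : ℝ) / (s n).Ne)
    (fun n i p => measurable_pi_apply (ParamIdx.W3 k i p.1 p.2)) (fun n θ Y i p => ?_) ?_
    (fun n θ _ a => ?_) ?_ ?_
  · refine Eq.trans ?_ (sum_row_single p.1
      (fun c : Fin (s n).M × Fin (s n).Ne => if c = (i, p.2) then (1 : ℝ) else 0) _).symm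
    simp [blockW3, idxW3, matW3]
  · filter_upwards [hR.nonempty_Ne, hR.nonempty_N] with n h1 h2
    infer_instance
  · simp [blockW3]
  · simp_rw [hsq]
    obtain ⟨c, hc, h⟩ := hR.div_ge
    exact lowP_const hc (h.mono fun n h => h.trans (le_abs_self _))
  · simp_rw [hsq]
    obtain ⟨c, hc, h⟩ := hR.div_le
    exact bddP_const hc (h.mono fun n h => by rwa [abs_of_nonneg (by positivity)])

end ForwardPass

end MoE

end

noncomputable section

namespace MoE

/-! ### Scalar multiples and outer products -/

section Products

variable {Ω : ℕ → Type*} [∀ n, MeasurableSpace (Ω n)] {μ : ∀ n, Measure (Ω n)}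
  {ι ι' κ κ' : ℕ → Type} {α β : ℕ → ℝ} [∀ n, Fintype (ι n)] [∀ n, Fintype (ι' n)]

theorem UniformCoordScale.comp {X : ∀ n, Ω n → κ n → ι n → ℝ} (h : UniformCoordScale μ X α)
    (f : ∀ n, κ' n → κ n) : UniformCoordScale μ (fun n ω i => X n ω (f n i)) α := by
  intro ε hε
  obtain ⟨c, C, hc, hC, h⟩ := h ε hε
  exact ⟨c, C, hc, hC, h.mono fun n hn i => hn (f n i)⟩

theorem UniformCoordScale.smul {a : ∀ n, Ω n → κ n → ℝ} {X : ∀ n, Ω n → κ n → ι n → ℝ}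
    (ha : LowP μ a α) (ha' : BddP μ a α) (hX : UniformCoordScale μ X β)
    (hβ : ∀ᶠ n in atTop, 0 ≤ β n) :
    UniformCoordScale μ (fun n ω i j => a n ω i * X n ω i j) (fun n => α n * β n) := by
  have hr : ∀ n ω i, |rms (fun j => a n ω i * X n ω i j)| = |a n ω i * rms (X n ω i)| := by
    intro n ω i
    rw [rms_const_mul, abs_mul, abs_mul, abs_abs]
  exact uniformCoordScale_of
    ((ha.comp fun n (p : κ n × ι n) => p.1).mul hX.low hβ)
    ((ha'.comp fun n (p : κ n × ι n) => p.1).mul hX.bdd)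
    ((ha.mul hX.low_rms hβ).mono (Eventually.of_forall fun n ω i => (hr n ω i).ge))
    ((ha'.mul hX.bdd_rms).mono (Eventually.of_forall fun n ω i => (hr n ω i).le))

theorem UniformCoordScale.outer {X : ∀ n, Ω n → κ n → ι n → ℝ} {Y : ∀ n, Ω n → κ n → ι' n → ℝ}
    (hX : UniformCoordScale μ X α) (hY : UniformCoordScale μ Y β) (hβ : ∀ᶠ n in atTop, 0 ≤ β n) :
    UniformCoordScale μ (fun n ω i (p : ι n × ι' n) => X n ω i p.1 * Y n ω i p.2)
      (fun n => α n * β n) := by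
  refine uniformCoordScale_of
    ((hX.low.comp fun n (p : κ n × (ι n × ι' n)) => (p.1, p.2.1)).mul
      (hY.low.comp fun n (p : κ n × (ι n × ι' n)) => (p.1, p.2.2)) hβ)
    ((hX.bdd.comp fun n (p : κ n × (ι n × ι' n)) => (p.1, p.2.1)).mul
      (hY.bdd.comp fun n (p : κ n × (ι n × ι' n)) => (p.1, p.2.2))) ?_ ?_
  · simp_rw [rms_outer]
    exact hX.low_rms.mul hY.low_rms hβ
  · simp_rw [rms_outer]
    exact hX.bdd_rms.mul hY.bdd_rms

theorem UniformCoordScale.congr {X Y : ∀ n, Ω n → κ n → ι n → ℝ} (hY : UniformCoordScale μ Y α)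
    (h : ∀ n, ∀ᵐ ω ∂μ n, ∀ i j, X n ω i j = Y n ω i j) : UniformCoordScale μ X α := by
  refine uniformCoordScale_of
    (hY.low.congr_ae fun n => (h n).mono fun ω hω p => hω p.1 p.2)
    (hY.bdd.congr_ae fun n => (h n).mono fun ω hω p => hω p.1 p.2)
    (hY.low_rms.congr_ae fun n => (h n).mono fun ω hω i => congrArg rms (funext (hω i)))
    (hY.bdd_rms.congr_ae fun n => (h n).mono fun ω hω i => congrArg rms (funext (hω i)))

theorem UniformCoordScale.scale {X : ∀ n, Ω n → κ n → ι n → ℝ} (h : UniformCoordScale μ X α)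
    {c C : ℝ} (hc : 0 < c) (hC : 0 < C) (hα : ∀ᶠ n in atTop, α n ≤ C * β n)
    (hβ : ∀ᶠ n in atTop, β n ≤ c * α n) : UniformCoordScale μ X β :=
  uniformCoordScale_of (h.low.scale hc hβ) (h.bdd.scale hC hα) (h.low_rms.scale hc hβ)
    (h.bdd_rms.scale hC hα)

end Products

theorem abs_sum_mul_le {ι : Type*} [Fintype ι] (v w : ι → ℝ) :
    |∑ j, v j * w j| ≤ Fintype.card ι * (rms v * rms w) := by
  have h0 : 0 ≤ (Fintype.card ι : ℝ) * (rms v * rms w) :=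
    mul_nonneg (Nat.cast_nonneg _) (mul_nonneg (rms_nonneg _) (rms_nonneg _))
  refine abs_le_of_sq_le_sq ?_ h0
  calc (∑ j, v j * w j) ^ 2 ≤ (∑ j, v j ^ 2) * ∑ j, w j ^ 2 :=
        Finset.sum_mul_sq_le_sq_mul_sq _ _ _
    _ = _ := by rw [← card_mul_rms_sq, ← card_mul_rms_sq]; ring

theorem sum_abs_le {ι : Type*} [Fintype ι] (v : ι → ℝ) :
    ∑ j, |v j| ≤ Fintype.card ι * rms v := by
  have h := abs_sum_mul_le (fun j => |v j|) (fun _ : ι => (1 : ℝ))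
  have h1 : rms (fun _ : ι => (1 : ℝ)) ≤ 1 := rms_le_of_abs_le zero_le_one fun _ => by simp
  have h2 : rms (fun j => |v j|) = rms v := by simp [rms]
  simp only [mul_one, h2] at h
  refine (le_abs_self _).trans (h.trans ?_)
  exact mul_le_mul_of_nonneg_left (mul_le_of_le_one_right (rms_nonneg _) h1) (Nat.cast_nonneg _)

/-- A coordinate vector loses only the share of coordinate `c` in the squared length of `u`. For
directions with bounded entries and squared length of order `N` this share vanishes as the width
grows. -/
theorem perpSq_single {C : Type*} [Fintype C] [DecidableEq C] (u : C → ℝ) (c : C) :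
    perpSq u (fun c' => if c' = c then 1 else 0) = 1 - u c ^ 2 / ∑ c, u c ^ 2 := by
  simp [perpSq]

/-! ### The gradient contracted with the expert output matrices -/

section BackwardPass

variable {s : ℕ → Shape} {x : ∀ n, Fin (s n).D → ℝ} {K : ℕ} {c : ℕ → ℝ}

theorem Regime.tendsto_inv_N (hR : Regime s x) :
    Tendsto (fun n => 1 / ((s n).N : ℝ)) atTop (𝓝 0) := by
  have := (tendsto_natCast_atTop_atTop (R := ℝ)).comp hR.tendsto_N
  simpa [Function.comp_def, Pi.inv_def] using this.inv_tendsto_atTop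

theorem Regime.inv_N_pos (hR : Regime s x) : ∀ᶠ n in atTop, 0 < 1 / ((s n).N : ℝ) :=
  hR.N_pos'.mono fun _ h => one_div_pos.2 h

theorem Regime.inv_N_nonneg (hR : Regime s x) : ∀ᶠ n in atTop, 0 ≤ 1 / ((s n).N : ℝ) :=
  hR.inv_N_pos.mono fun _ h => h.le

theorem bwdG_last_scale (hR : Regime s x)
    (hlow : ∃ a : ℝ, 0 < a ∧ ∀ᶠ n in atTop, a * (1 / ((s n).N : ℝ)) ≤ |c n|)
    (hbdd : ∃ a : ℝ, 0 < a ∧ ∀ᶠ n in atTop, |c n| ≤ a * (1 / ((s n).N : ℝ))) :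
    CoordScale (fun n => initLaw (s n) K) (fun n θ => bwdG (c n) (x n) θ (Fin.last K))
      (fun n => 1 / ((s n).N : ℝ)) := by
  obtain ⟨a, ha, hlow⟩ := hlow
  obtain ⟨b, hb, hbdd⟩ := hbdd
  have h := UniformCoordScale.smul (lowP_const ha hlow) (bddP_const hb hbdd)
    (agg_scale (K := K) hR (Fin.last K)) eventually_one_nonneg
  simp only [mul_one] at h
  exact h.congr fun n => ae_of_all _ fun θ i j => bwdG_last _ _ _ _

section Step

variable (hR : Regime s x) {k : Fin K}
  (hG : CoordScale (fun n => initLaw (s n) K) (fun n θ => bwdG (c n) (x n) θ k.succ)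
    (fun n => 1 / ((s n).N : ℝ)))

theorem sum_W3_mul_gatedIn {s : Shape} (x : Fin s.D → ℝ) (θ : Params s K) (k : Fin K)
    (a : Fin s.N) :
    ∑ p : Fin s.M × Fin s.Ne, θ (.W3 k p.1 a p.2) * gatedIn x θ k p = s.M * agg θ x k.succ a := by
  rw [agg_succ_apply]
  rcases Nat.eq_zero_or_pos s.M with h | h
  · have : IsEmpty (Fin s.M) := by rw [h]; infer_instance
    simp
  · have : (s.M : ℝ) ≠ 0 := by positivity
    field_simp

/-- The coefficient of the gated hidden states in the conditional mean of `bwdP`. -/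
def coefP {s : Shape} (c : ℝ) (x : Fin s.D → ℝ) (k : Fin K) (θ : Params s K) : ℝ :=
  (s.M : ℝ) * (∑ a, bwdG c x θ k.succ a * agg θ x k.succ a) / ∑ p, gatedIn x θ k p ^ 2

/-- The kept product of the output matrices with the gated hidden states is `M` times the next
aggregate, so the conditional mean feels the matrices only through the overlap of the gradient with
that aggregate. -/
theorem mean_blockW3Perp {s : Shape} (c : ℝ) (x : Fin s.D → ℝ) (k : Fin K) (θ : Params s K)
    (τ : Fin s.M × Fin s.Ne → ℝ) :
    (blockW3Perp x k).mean θ (bwdG c x θ k.succ) τ =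
      coefP c x k θ * ∑ p, τ p * gatedIn x θ k p := by
  have h : ∀ r, ∑ p, θ ((blockW3Perp x k).e (r, p)) * (blockW3Perp x k).u θ p =
      s.M * agg θ x k.succ r := sum_W3_mul_gatedIn x θ k
  rw [GaussBlock.mean, coefP]
  simp_rw [h]
  have h2 : ∑ a, bwdG c x θ k.succ a * (s.M * agg θ x k.succ a) =
      s.M * ∑ a, bwdG c x θ k.succ a * agg θ x k.succ a := by
    rw [Finset.mul_sum]
    exact Finset.sum_congr rfl fun a _ => by ring
  rw [h2]
  change (∑ p, τ p * gatedIn x θ k p) / (∑ p, gatedIn x θ k p ^ 2) * _ = _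
  ring

/-- The factor of the conditional variance of `bwdP` that does not depend on the entry. -/
def varP {s : Shape} (c : ℝ) (x : Fin s.D → ℝ) (k : Fin K) (θ : Params s K) : ℝ :=
  (s.M : ℝ) / s.Ne * (s.N * rms (bwdG c x θ k.succ) ^ 2)

theorem cvar_blockW3Perp {s : Shape} (c : ℝ) (x : Fin s.D → ℝ) (k : Fin K) (θ : Params s K)
    (τ : Fin s.M × Fin s.Ne → ℝ) :
    (blockW3Perp x k).cvar θ (bwdG c x θ k.succ) τ =
      varP c x k θ * perpSq (gatedIn x θ k) τ := by
  have h := card_mul_rms_sq (bwdG c x θ k.succ)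
  rw [Fintype.card_fin] at h
  rw [GaussBlock.cvar, varP, h]
  simp [blockW3Perp]

include hR

theorem gatedIn_sq_low {κ : ℕ → Type} : LowP (fun n => initLaw (s n) K)
    (fun n θ (_ : κ n) => ∑ p, gatedIn (x n) θ k p ^ 2) (fun n => ((s n).N : ℝ)) := by
  have hu := gatedIn_scale hR (agg_scale hR k.castSucc)
  obtain ⟨a, ha, hM⟩ := hR.M_ge
  have h1 : LowP (fun n => initLaw (s n) K) (fun n _ (_ : κ n) => ((s n).M : ℝ) * (s n).Ne)
      (fun n => ((s n).N : ℝ)) := by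
    refine lowP_const ha ?_
    filter_upwards [hM, hR.Ne_pos] with n h1 h2
    have : (1 : ℝ) ≤ (s n).Ne := by exact_mod_cast h2
    rw [abs_of_nonneg (by positivity)]
    exact h1.trans (le_mul_of_one_le_right (by positivity) this)
  have h2 := h1.mul (hu.low_rms.sq eventually_one_nonneg) (by simp)
  simp only [one_pow, mul_one] at h2
  refine h2.congr (Eventually.of_forall fun n θ j => ?_)
  rw [← card_mul_rms_sq]
  simp

include hG

/-- By Cauchy–Schwarz the overlap of gradient and aggregate is at most of order `N * (1 / N) = 1`;
the factor `M` is compensated by the squared length of `gatedIn`. No cancellation is needed. -/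
theorem coefP_bdd {κ : ℕ → Type} : BddP (fun n => initLaw (s n) K)
    (fun n θ (_ : κ n) => coefP (c n) (x n) k θ) (fun _ => 1) := by
  obtain ⟨C, hC, hM⟩ := hR.M_le
  have hh := agg_scale (K := K) hR k.succ
  have h1 : BddP (fun n => initLaw (s n) K) (fun n _ (_ : κ n) => ((s n).M : ℝ))
      (fun n => ((s n).N : ℝ)) := bddP_const hC (by simpa using hM)
  have h2 : BddP (fun n => initLaw (s n) K)
      (fun n θ (_ : κ n) => ∑ a, bwdG (c n) (x n) θ k.succ a * agg θ (x n) k.succ a)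
      (fun n => (s n).N * (1 / ((s n).N : ℝ) * 1)) := by
    refine ((bddP_const (a := fun n => ((s n).N : ℝ)) one_pos (by simp)).mul
      (hG.bdd_rms.mul hh.bdd_rms)).mono (Eventually.of_forall fun n θ j => ?_)
    refine (abs_sum_mul_le _ _).trans ?_
    rw [Fintype.card_fin]
    exact le_abs_self _
  refine ((h1.mul h2).div (gatedIn_sq_low (k := k) hR) hR.N_pos').scale one_pos ?_
  filter_upwards [hR.N_pos'] with n hn
  field_simp
  exact le_rfl

/-- The weight variance `M / Ne` is of order `N`, and the squared length of the gradient is of order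
`N * N⁻²`. -/
theorem varP_low {κ : ℕ → Type} : LowP (fun n => initLaw (s n) K)
    (fun n θ (_ : κ n) => varP (c n) (x n) k θ) (fun _ => 1) := by
  obtain ⟨a, ha, h⟩ := hR.div_ge
  have h1 : LowP (fun n => initLaw (s n) K) (fun n _ (_ : κ n) => ((s n).M : ℝ) / (s n).Ne)
      (fun n => ((s n).N : ℝ)) := lowP_const ha (h.mono fun n h => h.trans (le_abs_self _))
  have h2 : LowP (fun n => initLaw (s n) K) (fun n _ (_ : κ n) => ((s n).N : ℝ))
      (fun n => ((s n).N : ℝ)) := lowP_const one_pos (by simp)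
  refine (h1.mul (h2.mul (hG.low_rms.sq hR.inv_N_nonneg)
    (Eventually.of_forall fun n => by positivity))
    (Eventually.of_forall fun n => by positivity)).scale one_pos ?_
  filter_upwards [hR.N_pos'] with n hn
  field_simp
  exact le_rfl

theorem varP_bdd {κ : ℕ → Type} : BddP (fun n => initLaw (s n) K)
    (fun n θ (_ : κ n) => varP (c n) (x n) k θ) (fun _ => 1) := by
  obtain ⟨a, ha, h⟩ := hR.div_le
  have h1 : BddP (fun n => initLaw (s n) K) (fun n _ (_ : κ n) => ((s n).M : ℝ) / (s n).Ne)
      (fun n => ((s n).N : ℝ)) :=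
    bddP_const ha (h.mono fun n h => by rwa [abs_of_nonneg (by positivity)])
  have h2 : BddP (fun n => initLaw (s n) K) (fun n _ (_ : κ n) => ((s n).N : ℝ))
      (fun n => ((s n).N : ℝ)) := bddP_const one_pos (by simp)
  refine (h1.mul (h2.mul hG.bdd_rms.sq)).scale one_pos ?_
  filter_upwards [hR.N_pos'] with n hn
  field_simp
  exact le_rfl

/-- After resampling the output matrices orthogonally to the gated hidden states, an entry is
Gaussian with mean `coefP` times the corresponding entry of `gatedIn` and variance `varP` times
`perpSq`. The mean is bounded, possibly of order one as well, and the variance is of order one. -/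
theorem bwdP_full_scale : CoordScale (fun n => initLaw (s n) K)
    (fun n θ (p : Fin (s n).M × Fin (s n).Ne) => bwdP (c n) (x n) θ k p.1 p.2) (fun _ => 1) := by
  have hu := gatedIn_scale hR (agg_scale hR k.castSucc)
  refine GaussBlock.coordScale (fun n => blockW3Perp (x n) k) eventually_one_pos
    (fun n θ p => bwdG (c n) (x n) θ k.succ) (fun n θ p q => if q = p then 1 else 0)
    (fun n p => measurable_bwdP (x n) (c n) k p.1 p.2) (fun n θ Y p => ?_) hR.nonempty_MNe
    ?_ ?_ ?_ ?_ ?_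
  · rw [sum_col_single]
    rw [bwdP_apply, blockW3Perp_bwdG]
    rfl
  · simp_rw [cvar_blockW3Perp, perpSq_single]
    -- The share of one entry in the squared length of `gatedIn` is of order `1 / N`, so the factor
    -- `1 - share` of the variance stays away from zero.
    have hY := (hu.bdd.sq.div (gatedIn_sq_low (k := k) hR) hR.N_pos')
    simp only [one_pow] at hY
    have := (varP_low hR hG).mul (hY.one_sub hR.tendsto_inv_N) eventually_one_nonneg
    simpa using this
  · simp_rw [mean_blockW3Perp]
    have := (coefP_bdd hR hG).mul hu.bdd
    simpa using this
  · simp_rw [cvar_blockW3Perp]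
    simp only [one_pow]
    refine (varP_bdd hR hG).mono (Eventually.of_forall fun n θ p => ?_)
    rw [abs_mul]
    refine mul_le_of_le_one_right (abs_nonneg _) ?_
    rw [abs_of_nonneg (perpSq_nonneg _ _)]
    exact (perpSq_le _ _).trans (by simp)
  · simp_rw [mean_blockW3Perp]
    have := (coefP_bdd (κ := fun _ => Unit) hR hG).mul hu.bdd_rms
    simp only [mul_one] at this
    refine this.mono (Eventually.of_forall fun n θ _ => ?_)
    simp only [ite_mul, one_mul, zero_mul, Finset.sum_ite_eq', Finset.mem_univ, if_true]
    rw [rms_const_mul, abs_mul, abs_mul, abs_abs]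
  · simp_rw [cvar_blockW3Perp]
    simp only [one_pow]
    refine (varP_bdd (κ := fun _ => Unit) hR hG).mono (Eventually.of_forall fun n θ p => ?_)
    rw [← Finset.mul_sum, mul_div_assoc, abs_mul]
    refine mul_le_of_le_one_right (abs_nonneg _) ?_
    rw [abs_of_nonneg (div_nonneg (Finset.sum_nonneg fun _ _ => perpSq_nonneg _ _)
      (Nat.cast_nonneg _))]
    refine div_le_one_of_le₀ ?_ (Nat.cast_nonneg _)
    refine (Finset.sum_le_sum fun p _ => perpSq_le (gatedIn (x n) θ k) _).trans ?_
    simp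

theorem bwdP_scale : UniformCoordScale (fun n => initLaw (s n) K)
    (fun n θ => bwdP (c n) (x n) θ k) (fun _ => 1) := by
  obtain ⟨L, hL⟩ := hR.Ne_le
  have h := bwdP_full_scale hR hG
  exact uniformCoordScale_of_low hR.nonempty_Ne eventually_one_nonneg h.low h.bdd
    (h.bdd.rms_of_card_le (X := fun n θ => bwdP (c n) (x n) θ k) (by simpa using hL)
      eventually_one_nonneg)

end Step

end BackwardPass

end MoE

end

noncomputable section

namespace MoE

section BackwardPass

variable {s : ℕ → Shape} {x : ∀ n, Fin (s n).D → ℝ} {K : ℕ} {c : ℕ → ℝ}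

/-! ### The gradient at the gates -/

/-- The squared norm of the hidden state of an expert. -/
def inSq {s : Shape} (x : Fin s.D → ℝ) (θ : Params s K) (k : Fin K) (i : Fin s.M) : ℝ :=
  ∑ e, h2 θ x k i e ^ 2

/-- The hidden state of expert `i`, as a vector over all experts. -/
def inRow {s : Shape} (x : Fin s.D → ℝ) (θ : Params s K) (k : Fin K) (i : Fin s.M) :
    Fin s.M × Fin s.Ne → ℝ := fun q => if q.1 = i then h2 θ x k q.1 q.2 else 0

section Single

variable {s : Shape} (x : Fin s.D → ℝ) (θ : Params s K) (k : Fin K) (i : Fin s.M)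

theorem inSq_nonneg : 0 ≤ inSq x θ k i := Finset.sum_nonneg fun _ _ => sq_nonneg _

theorem inSq_eq : inSq x θ k i = s.Ne * rms (h2 θ x k i) ^ 2 := by
  rw [inSq, ← card_mul_rms_sq, Fintype.card_fin]

theorem sum_inRow_mul (f : Fin s.M × Fin s.Ne → ℝ) :
    ∑ q, inRow x θ k i q * f q = ∑ e, h2 θ x k i e * f (i, e) := by
  rw [Fintype.sum_prod_type, Finset.sum_eq_single i (fun b _ hb => by simp [inRow, hb]) (by simp)]
  simp [inRow]

theorem sum_inRow_sq : ∑ q, inRow x θ k i q ^ 2 = inSq x θ k i := by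
  simp_rw [sq]
  rw [sum_inRow_mul]
  simp [inRow, inSq, sq]

theorem sum_inRow_gatedIn :
    ∑ q, inRow x θ k i q * gatedIn x θ k q = phi θ x k i * inSq x θ k i := by
  rw [sum_inRow_mul, inSq, Finset.mul_sum]
  exact Finset.sum_congr rfl fun e _ => by rw [gatedIn]; ring

theorem perpSq_inRow : perpSq (gatedIn x θ k) (inRow x θ k i) = inSq x θ k i *
    (1 - phi θ x k i ^ 2 * inSq x θ k i / ∑ p, gatedIn x θ k p ^ 2) := by
  rw [perpSq, sum_inRow_sq, sum_inRow_gatedIn]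
  ring

/-- Cauchy–Schwarz over the `Ne` entries of each expert reduces the mean square of the squared norms
to the fourth moment of the hidden states. -/
theorem rms_inSq_sq_le : rms (inSq x θ k) ^ 2 ≤
    s.Ne ^ 2 * ((∑ p : Fin s.M × Fin s.Ne, h2 θ x k p.1 p.2 ^ 4) / (s.M * s.Ne)) := by
  rw [rms_sq, Fintype.card_fin, Fintype.sum_prod_type]
  have h : ∀ i, inSq x θ k i ^ 2 ≤ s.Ne * ∑ e, h2 θ x k i e ^ 4 := fun i => by
    have := sq_sum_le_card_mul_sum_sq (s := (Finset.univ : Finset (Fin s.Ne)))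
      (f := fun e => h2 θ x k i e ^ 2)
    simpa [inSq, ← pow_mul] using this
  have h2 := Finset.sum_le_sum fun i (_ : i ∈ Finset.univ) => h i
  rw [← Finset.mul_sum] at h2
  refine (div_le_div_of_nonneg_right h2 (Nat.cast_nonneg _)).trans (le_of_eq ?_)
  rcases Nat.eq_zero_or_pos s.Ne with h0 | h0
  · simp [h0]
  · have : (s.Ne : ℝ) ≠ 0 := by positivity
    field_simp

end Single

section Step

variable (hR : Regime s x) {k : Fin K}

include hR

theorem inSq_low :
    LowP (fun n => initLaw (s n) K) (fun n θ => inSq (x n) θ k) (fun _ => 1) := by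
  have h := (h2_scale hR (agg_scale hR k.castSucc)).low_rms.sq eventually_one_nonneg
  simp only [one_pow] at h
  refine h.mono ?_
  filter_upwards [hR.Ne_pos] with n hn θ i
  have : (1 : ℝ) ≤ (s n).Ne := by exact_mod_cast hn
  rw [inSq_eq, abs_mul]
  exact le_mul_of_one_le_left (abs_nonneg _) (this.trans (le_abs_self _))

theorem Regime.Ne_bdd {Ω : ℕ → Type*} [∀ n, MeasurableSpace (Ω n)] {μ : ∀ n, Measure (Ω n)}
    {κ : ℕ → Type} : BddP μ (fun n _ (_ : κ n) => ((s n).Ne : ℝ)) (fun _ => 1) := by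
  obtain ⟨L, hL⟩ := hR.Ne_le
  refine bddP_const (C := L + 1) (by positivity) (hL.mono fun n hn => ?_)
  have : ((s n).Ne : ℝ) ≤ L := by exact_mod_cast hn
  rw [abs_of_nonneg (by positivity)]
  linarith

theorem inSq_bdd :
    BddP (fun n => initLaw (s n) K) (fun n θ => inSq (x n) θ k) (fun _ => 1) := by
  have h := hR.Ne_bdd.mul (h2_scale hR (agg_scale (K := K) hR k.castSucc)).bdd_rms.sq
  simp only [one_pow, mul_one] at h
  exact h.congr (Eventually.of_forall fun n θ i => inSq_eq _ _ _ _)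

theorem rms_inSq_bdd : BddP (fun n => initLaw (s n) K)
    (fun n θ (_ : Unit) => rms (inSq (x n) θ k)) (fun _ => 1) := by
  have h := (hR.Ne_bdd (κ := fun _ => Unit)).sq.mul
    (h2_pow_four_bdd hR (agg_scale (K := K) hR k.castSucc))
  simp only [one_pow, mul_one] at h
  refine BddP.of_sq ?_ eventually_one_nonneg
  simp only [one_pow]
  refine h.mono (Eventually.of_forall fun n θ _ => ?_)
  rw [abs_of_nonneg (sq_nonneg _)]
  exact (rms_inSq_sq_le _ _ _).trans (le_abs_self _)

variable (hG : CoordScale (fun n => initLaw (s n) K) (fun n θ => bwdG (c n) (x n) θ k.succ)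
    (fun n => 1 / ((s n).N : ℝ)))
include hG

/-- The same resampling as for `bwdP`, tested on the hidden state of one expert. The conditional
mean contains the squared norm of this hidden state, so its root mean square over the experts needs
fourth moments: bounds in probability on each entry do not bound an average over a growing number of
experts. -/
theorem bwdQ_scale : CoordScale (fun n => initLaw (s n) K)
    (fun n θ => bwdQ (c n) (x n) θ k) (fun _ => 1) := by
  have hφ := phi_scale hR (agg_scale hR k.castSucc)
  have hz := h2_full_scale hR (agg_scale hR k.castSucc)
  refine GaussBlock.coordScale (fun n => blockW3Perp (x n) k) eventually_one_pos
    (fun n θ i => bwdG (c n) (x n) θ k.succ) (fun n θ i => inRow (x n) θ k i)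
    (fun n i => measurable_bwdQ (x n) (c n) k i) (fun n θ Y i => ?_) hR.nonempty_M
    ?_ ?_ ?_ ?_ ?_
  · rw [Fintype.sum_prod_type, bwdQ_apply, blockW3Perp_h2]
    simp only [mul_assoc, ← Finset.mul_sum, sum_inRow_mul]
    simp_rw [bwdP_apply, blockW3Perp_bwdG, Finset.sum_mul, Finset.mul_sum]
    rw [Finset.sum_comm]
    refine Finset.sum_congr rfl fun a _ => Finset.sum_congr rfl fun e _ => ?_
    rw [mul_comm (h2 _ _ _ _ _), mul_assoc]
    rfl
  · simp_rw [cvar_blockW3Perp, perpSq_inRow]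
    have hY := (hφ.bdd.sq.mul (inSq_bdd (k := k) hR)).div (gatedIn_sq_low (k := k) hR) hR.N_pos'
    simp only [one_pow, mul_one] at hY
    have := (varP_low hR hG).mul ((inSq_low (k := k) hR).mul (hY.one_sub hR.tendsto_inv_N)
      eventually_one_nonneg) (by simp)
    simpa using this
  · simp_rw [mean_blockW3Perp, sum_inRow_gatedIn]
    have := (coefP_bdd hR hG).mul (hφ.bdd.mul (inSq_bdd (k := k) hR))
    simpa using this
  · simp_rw [cvar_blockW3Perp]
    have := (varP_bdd hR hG).mul (inSq_bdd (k := k) hR)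
    simp only [one_pow]
    simp only [mul_one] at this
    refine this.mono (Eventually.of_forall fun n θ i => ?_)
    rw [abs_mul, abs_mul, abs_of_nonneg (perpSq_nonneg _ _), abs_of_nonneg (inSq_nonneg _ _ _ _)]
    gcongr
    exact (perpSq_le _ _).trans (sum_inRow_sq _ _ _ _).le
  · simp_rw [mean_blockW3Perp, sum_inRow_gatedIn]
    have := (coefP_bdd (κ := fun _ => Unit) hR hG).mul (rms_inSq_bdd (k := k) hR)
    simp only [mul_one] at this
    refine this.mono (Eventually.of_forall fun n θ _ => ?_)
    rw [rms_const_mul, abs_mul, abs_mul, abs_abs]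
    refine mul_le_mul_of_nonneg_left (rms_mono_of fun i => ?_) (abs_nonneg _)
    rw [abs_mul]
    exact mul_le_of_le_one_left (abs_nonneg _) (abs_phi_le_one _ _ _ _)
  · simp_rw [cvar_blockW3Perp]
    have := (varP_bdd (κ := fun _ => Unit) hR hG).mul
      ((hR.Ne_bdd (κ := fun _ => Unit)).mul hz.bdd_rms.sq)
    simp only [one_pow, mul_one] at this ⊢
    refine this.mono (Eventually.of_forall fun n θ _ => ?_)
    rw [← Finset.mul_sum, mul_div_assoc, abs_mul, abs_mul]
    refine mul_le_mul_of_nonneg_left ?_ (abs_nonneg _)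
    rw [abs_of_nonneg (div_nonneg (Finset.sum_nonneg fun _ _ => perpSq_nonneg _ _)
      (Nat.cast_nonneg _))]
    refine le_trans ?_ (le_abs_self _)
    rw [rms_sq, Fintype.card_prod, Fintype.sum_prod_type, Fintype.card_fin, Fintype.card_fin]
    refine (div_le_div_of_nonneg_right (Finset.sum_le_sum fun i _ =>
      (perpSq_le (gatedIn (x n) θ k) _).trans (sum_inRow_sq _ _ _ _).le)
      (Nat.cast_nonneg _)).trans (le_of_eq ?_)
    simp only [inSq]
    rcases Nat.eq_zero_or_pos (s n).Ne with h0 | h0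
    · have : IsEmpty (Fin (s n).Ne) := by rw [h0]; infer_instance
      simp
    · have : ((s n).Ne : ℝ) ≠ 0 := by positivity
      push_cast
      field_simp

end Step

end BackwardPass

end MoE

end

noncomputable section

namespace MoE

section BackwardPass

variable {s : ℕ → Shape} {x : ∀ n, Fin (s n).D → ℝ} {K : ℕ} {c : ℕ → ℝ}

/-! ### The gradient at the input of a block -/

section Single

variable {s : Shape} (a b c : ℝ) (x : Fin s.D → ℝ) (θ : Params s K) (k : Fin K)

/-- A linear combination of the expert part and of the router part of the gradient. -/
def gradMix (j : Fin s.N) : ℝ :=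
  a * gradExpert (withReadout c x θ) x k j + b * gradRouter (withReadout c x θ) x k j

/-- The coefficients of the weights in `gradMix`. -/
def mixCoef : Fin s.M ⊕ Fin s.M × Fin s.Ne → ℝ
  | .inl i => b / s.M * (dphi θ x k i * bwdQ c x θ k i)
  | .inr p => a / s.M * (phi θ x k p.1 * bwdP c x θ k p.1 p.2)

theorem gradMix_eq (j : Fin s.N) :
    gradMix a b c x θ k j = ∑ r, mixCoef a b c x θ k r * θ (idxIn k (r, j)) := by
  rw [Fintype.sum_sum_type, Fintype.sum_prod_type, gradMix, gradExpert_withReadout,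
    gradRouter_withReadout, add_comm]
  simp only [mixCoef, idxIn, Finset.mul_sum]
  congr 1
  · exact Finset.sum_congr rfl fun i _ => by ring
  · exact Finset.sum_congr rfl fun i _ => Finset.sum_congr rfl fun e _ => by ring

/-- The coefficients involve the stacked input matrix only through logits, hidden states and later
aggregates, all of which are determined by its product with the kept direction. -/
theorem blockInPerp_mixCoef (z) :
    mixCoef a b c x ((blockInPerp x k).T z) k = mixCoef a b c x z.1 k := by
  ext r
  rcases r with i | p
  · simp only [mixCoef, dphi, blockInPerp_phi, blockInPerp_bwdQ]
  · simp only [mixCoef, blockInPerp_phi, blockInPerp_bwdP]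

/-- The contraction of the coefficients with the router logits and with the hidden states. -/
def mixDot : ℝ :=
  ∑ r, mixCoef a b c x θ k r * ∑ j, θ (idxIn k (r, j)) * agg θ x k.castSucc j

/-- The contraction of `bwdP` with the hidden states collapses to `bwdQ`, so both parts become
averages of `bwdQ` over the experts with weights `phi` and `dphi * psi`. These weights are bounded
by one deterministically, so no uniform bound on the logits is required. -/
theorem abs_mixDot_le : |mixDot a b c x θ k| ≤ (|a| + |b|) * rms (bwdQ c x θ k) := by
  have h : mixDot a b c x θ k =
      1 / s.M * ∑ i, (b * (dphi θ x k i * psi θ x k i) + a * phi θ x k i) * bwdQ c x θ k i := by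
    rw [mixDot, Fintype.sum_sum_type, Fintype.sum_prod_type, Finset.mul_sum,
      ← Finset.sum_add_distrib]
    refine Finset.sum_congr rfl fun i _ => ?_
    have h1 : ∑ j, θ (idxIn k (.inl i, j)) * agg θ x k.castSucc j = psi θ x k i := rfl
    have h2 : ∀ e, ∑ j, θ (idxIn k (.inr (i, e), j)) * agg θ x k.castSucc j = h2 θ x k i e :=
      fun e => rfl
    simp_rw [h1, h2, mixCoef]
    have h3 : ∑ e, a / s.M * (phi θ x k i * bwdP c x θ k i e) * MoE.h2 θ x k i e =
        a / s.M * phi θ x k i * bwdQ c x θ k i := by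
      rw [bwdQ_apply, Finset.mul_sum]
      exact Finset.sum_congr rfl fun e _ => by ring
    rw [h3]
    ring
  have hle : ∀ i, |(b * (dphi θ x k i * psi θ x k i) + a * phi θ x k i) * bwdQ c x θ k i| ≤
      (|a| + |b|) * |bwdQ c x θ k i| := fun i => by
    rw [abs_mul]
    refine mul_le_mul_of_nonneg_right ?_ (abs_nonneg _)
    refine (abs_add_le _ _).trans ?_
    rw [abs_mul b, abs_mul a, add_comm]
    exact add_le_add (mul_le_of_le_one_right (abs_nonneg _) (abs_phi_le_one _ _ _ _))
      (mul_le_of_le_one_right (abs_nonneg _) (abs_dphi_mul_psi_le_one _ _ _ _))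
  rw [h, abs_mul, abs_of_nonneg (by positivity)]
  have h1 : |∑ i, (b * (dphi θ x k i * psi θ x k i) + a * phi θ x k i) * bwdQ c x θ k i| ≤
      (|a| + |b|) * (s.M * rms (bwdQ c x θ k)) := by
    refine (Finset.abs_sum_le_sum_abs _ _).trans ((Finset.sum_le_sum fun i _ => hle i).trans ?_)
    rw [← Finset.mul_sum]
    have := sum_abs_le (bwdQ c x θ k)
    rw [Fintype.card_fin] at this
    exact mul_le_mul_of_nonneg_left this (by positivity)
  refine (mul_le_mul_of_nonneg_left h1 (by positivity)).trans ?_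
  have hr := rms_nonneg (bwdQ c x θ k)
  rcases Nat.eq_zero_or_pos s.M with h0 | h0
  · simp only [h0, Nat.cast_zero]
    simp
    positivity
  · refine le_of_eq ?_
    have : (s.M : ℝ) ≠ 0 := by positivity
    field_simp

theorem sum_mixCoef_sq : ∑ r, mixCoef a b c x θ k r ^ 2 =
    1 / s.M * (b ^ 2 * rms (fun i => dphi θ x k i * bwdQ c x θ k i) ^ 2 + a ^ 2 * (s.Ne *
      rms (fun p : Fin s.M × Fin s.Ne => phi θ x k p.1 * bwdP c x θ k p.1 p.2) ^ 2)) := by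
  rw [Fintype.sum_sum_type]
  simp only [mixCoef, mul_pow, ← Finset.mul_sum, rms_sq, Fintype.card_prod, Fintype.card_fin]
  rcases Nat.eq_zero_or_pos s.M with h0 | h0
  · simp [h0]
  rcases Nat.eq_zero_or_pos s.Ne with h1 | h1
  · have : IsEmpty (Fin s.Ne) := by rw [h1]; infer_instance
    simp
    ring
  · have : (s.M : ℝ) ≠ 0 := by positivity
    have : (s.Ne : ℝ) ≠ 0 := by positivity
    push_cast
    field_simp

theorem mean_blockInPerp (j : Fin s.N) :
    (blockInPerp x k).mean θ (mixCoef a b c x θ k) (fun l => if l = j then 1 else 0) =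
      mixDot a b c x θ k / (∑ l, agg θ x k.castSucc l ^ 2) * agg θ x k.castSucc j := by
  rw [GaussBlock.mean]
  change (∑ l, (if l = j then 1 else 0) * agg θ x k.castSucc l) /
    (∑ l, agg θ x k.castSucc l ^ 2) * mixDot a b c x θ k = _
  simp only [ite_mul, one_mul, zero_mul, Finset.sum_ite_eq', Finset.mem_univ, if_true]
  ring

theorem cvar_blockInPerp (j : Fin s.N) :
    (blockInPerp x k).cvar θ (mixCoef a b c x θ k) (fun l => if l = j then 1 else 0) =
      1 / s.N * (∑ r, mixCoef a b c x θ k r ^ 2) *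
        (1 - agg θ x k.castSucc j ^ 2 / ∑ l, agg θ x k.castSucc l ^ 2) := by
  rw [GaussBlock.cvar, perpSq_single]
  simp [blockInPerp]

end Single

section Step

variable (hR : Regime s x) {k : Fin K}
  (hG : CoordScale (fun n => initLaw (s n) K) (fun n θ => bwdG (c n) (x n) θ k.succ)
    (fun n => 1 / ((s n).N : ℝ)))
include hR

theorem Regime.inv_M_low {Ω : ℕ → Type*} [∀ n, MeasurableSpace (Ω n)] {μ : ∀ n, Measure (Ω n)}
    {κ : ℕ → Type} :
    LowP μ (fun n _ (_ : κ n) => 1 / ((s n).M : ℝ)) (fun n => 1 / ((s n).N : ℝ)) := by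
  obtain ⟨C, hC, h⟩ := hR.M_le
  refine lowP_const (c := 1 / C) (by positivity) ?_
  filter_upwards [h, hR.M_pos'] with n hn hM
  rw [abs_of_nonneg (by positivity), div_mul_div_comm, one_mul]
  exact one_div_le_one_div_of_le hM hn

theorem Regime.inv_M_bdd {Ω : ℕ → Type*} [∀ n, MeasurableSpace (Ω n)] {μ : ∀ n, Measure (Ω n)}
    {κ : ℕ → Type} :
    BddP μ (fun n _ (_ : κ n) => 1 / ((s n).M : ℝ)) (fun n => 1 / ((s n).N : ℝ)) := by
  obtain ⟨C, hC, h⟩ := hR.M_ge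
  refine bddP_const (C := 1 / C) (by positivity) ?_
  filter_upwards [h, hR.N_pos'] with n hn hN
  rw [abs_of_nonneg (by positivity), div_mul_div_comm, one_mul]
  exact one_div_le_one_div_of_le (by positivity) hn

theorem agg_sq_low (k : Fin (K + 1)) {κ : ℕ → Type} : LowP (fun n => initLaw (s n) K)
    (fun n θ (_ : κ n) => ∑ j, agg θ (x n) k j ^ 2) (fun n => ((s n).N : ℝ)) := by
  have h := (lowP_const (μ := fun n => initLaw (s n) K) (ι := κ) (a := fun n => ((s n).N : ℝ))
    (α := fun n => ((s n).N : ℝ)) one_pos (by simp)).mul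
    ((agg_scale (K := K) hR k).low_rms.sq eventually_one_nonneg) (by simp)
  simp only [one_pow, mul_one] at h
  refine h.congr (Eventually.of_forall fun n θ j => ?_)
  rw [← card_mul_rms_sq, Fintype.card_fin]

include hG

theorem dphi_mul_bwdQ_scale : CoordScale (fun n => initLaw (s n) K)
    (fun n θ i => dphi θ (x n) k i * bwdQ (c n) (x n) θ k i) (fun _ => 1) := by
  have hq := bwdQ_scale hR hG
  have hle : ∀ n (θ : Params (s n) K) i, |dphi θ (x n) k i * bwdQ (c n) (x n) θ k i| ≤
      |bwdQ (c n) (x n) θ k i| := fun n θ i => by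
    rw [abs_mul]
    exact mul_le_of_le_one_left (abs_nonneg _) (abs_dphi_le_one _ _ _ _)
  refine coordScale_of_low hR.nonempty_M eventually_one_nonneg ?_ ?_ ?_
  · have := (dphi_low hR (agg_scale hR k.castSucc)).mul hq.low eventually_one_nonneg
    simpa using this
  · exact hq.bdd.mono (Eventually.of_forall hle)
  · exact hq.bdd_rms.mono (Eventually.of_forall fun n θ _ => rms_mono_of (hle n θ))

theorem phi_mul_bwdP_scale : CoordScale (fun n => initLaw (s n) K)
    (fun n θ (p : Fin (s n).M × Fin (s n).Ne) =>
      phi θ (x n) k p.1 * bwdP (c n) (x n) θ k p.1 p.2) (fun _ => 1) := by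
  have hq := bwdP_full_scale hR hG
  have hle : ∀ n (θ : Params (s n) K) (p : Fin (s n).M × Fin (s n).Ne),
      |phi θ (x n) k p.1 * bwdP (c n) (x n) θ k p.1 p.2| ≤
      |bwdP (c n) (x n) θ k p.1 p.2| := fun n θ i => by
    rw [abs_mul]
    exact mul_le_of_le_one_left (abs_nonneg _) (abs_phi_le_one _ _ _ _)
  refine coordScale_of_low hR.nonempty_MNe eventually_one_nonneg ?_ ?_ ?_
  · have := ((phi_low hR (agg_scale hR k.castSucc)).comp
      fun n (p : Fin (s n).M × Fin (s n).Ne) => p.1).mul hq.low eventually_one_nonneg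
    simpa using this
  · exact hq.bdd.mono (Eventually.of_forall hle)
  · exact hq.bdd_rms.mono (Eventually.of_forall fun n θ _ => rms_mono_of (hle n θ))

theorem mixCoef_sq_bdd (a b : ℝ) {κ : ℕ → Type} : BddP (fun n => initLaw (s n) K)
    (fun n θ (_ : κ n) => ∑ r, mixCoef a b (c n) (x n) θ k r ^ 2)
    (fun n => 1 / ((s n).N : ℝ)) := by
  have hq := (dphi_mul_bwdQ_scale hR hG).bdd_rms (κ := κ)
  have hp := (phi_mul_bwdP_scale hR hG).bdd_rms (κ := κ)
  have hconst : ∀ a : ℝ, BddP (fun n => initLaw (s n) K) (fun n _ (_ : κ n) => a ^ 2)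
      (fun _ => 1) := fun a => bddP_const (C := a ^ 2 + 1) (by positivity)
        (Eventually.of_forall fun _ => by rw [abs_of_nonneg (by positivity)]; linarith)
  simp_rw [sum_mixCoef_sq]
  have h1 := (hconst b).mul hq.sq
  have h2 := (hconst a).mul (hR.Ne_bdd.mul hp.sq)
  simp only [one_pow, mul_one] at h1 h2
  have := hR.inv_M_bdd.mul (h1.add h2 eventually_one_nonneg)
  simpa only [mul_one] using this

/-- Squares cannot cancel, so the part with nonzero coefficient suffices for the lower bound. -/
theorem mixCoef_sq_low {a b : ℝ} (hab : a ≠ 0 ∨ b ≠ 0) {κ : ℕ → Type} :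
    LowP (fun n => initLaw (s n) K)
      (fun n θ (_ : κ n) => ∑ r, mixCoef a b (c n) (x n) θ k r ^ 2)
      (fun n => 1 / ((s n).N : ℝ)) := by
  have hq := (dphi_mul_bwdQ_scale hR hG).low_rms (κ := κ)
  have hp := (phi_mul_bwdP_scale hR hG).low_rms (κ := κ)
  have hconst : ∀ a : ℝ, a ≠ 0 → LowP (fun n => initLaw (s n) K) (fun n _ (_ : κ n) => a ^ 2)
      (fun _ => 1) := fun a ha => lowP_const (c := a ^ 2) (by positivity)
        (Eventually.of_forall fun _ => by rw [abs_of_nonneg (by positivity), mul_one])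
  have hNe : LowP (fun n => initLaw (s n) K) (fun n _ (_ : κ n) => ((s n).Ne : ℝ))
      (fun _ => 1) := lowP_const one_pos (hR.Ne_pos.mono fun n hn => by
        rw [abs_of_nonneg (by positivity), one_mul]
        exact_mod_cast hn)
  simp_rw [sum_mixCoef_sq]
  have key := hR.inv_M_low.mul (μ := fun n => initLaw (s n) K) (β := fun _ => 1)
    (Y := fun n θ (_ : κ n) => b ^ 2 *
    rms (fun i => dphi θ (x n) k i * bwdQ (c n) (x n) θ k i) ^ 2 + a ^ 2 * ((s n).Ne *
      rms (fun p : Fin (s n).M × Fin (s n).Ne =>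
        phi θ (x n) k p.1 * bwdP (c n) (x n) θ k p.1 p.2) ^ 2)) ?_ eventually_one_nonneg
  · simpa only [mul_one] using key
  rcases hab with h | h
  · have h2 := (hconst a h).mul (hNe.mul (hp.sq eventually_one_nonneg) (by simp)) (by simp)
    simp only [one_pow, mul_one] at h2
    refine h2.mono (Eventually.of_forall fun n θ _ => ?_)
    rw [abs_of_nonneg (by positivity), abs_of_nonneg (by positivity)]
    exact le_add_of_nonneg_left (by positivity)
  · have h2 := (hconst b h).mul (hq.sq eventually_one_nonneg) (by simp)
    simp only [one_pow, mul_one] at h2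
    refine h2.mono (Eventually.of_forall fun n θ _ => ?_)
    rw [abs_of_nonneg (by positivity), abs_of_nonneg (by positivity)]
    exact le_add_of_nonneg_right (by positivity)

/-- Lower bounds on the expert and router parts would not exclude cancellation in their sum.
Treating a general combination as one Gaussian functional of the stacked matrix covers both parts
and the sum at once. The mean, along the block input, is at most of order `1 / N`, while the redrawn
part has standard deviation of exactly that order. -/
theorem gradMix_scale {a b : ℝ} (hab : a ≠ 0 ∨ b ≠ 0) : CoordScale (fun n => initLaw (s n) K)
    (fun n θ => gradMix a b (c n) (x n) θ k) (fun n => 1 / ((s n).N : ℝ)) := by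
  have hh := agg_scale (K := K) hR k.castSucc
  -- The factors of the conditional variance in order: the variance of a weight, the squared length
  -- of the coefficients, and the orthogonal share of a coordinate vector.
  have hsq : ∀ n, (1 / ((s n).N : ℝ)) ^ 2 = 1 / ((s n).N : ℝ) * (1 / ((s n).N : ℝ)) * 1 :=
    fun n => by ring
  have hdot : ∀ κ : ℕ → Type, BddP (fun n => initLaw (s n) K) (fun n θ (_ : κ n) =>
      mixDot a b (c n) (x n) θ k / ∑ l, agg θ (x n) k.castSucc l ^ 2)
      (fun n => 1 / ((s n).N : ℝ)) := by
    intro κ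
    have h1 : BddP (fun n => initLaw (s n) K) (fun n θ (_ : κ n) => mixDot a b (c n) (x n) θ k)
        (fun _ => 1) := by
      have := (bddP_const (μ := fun n => initLaw (s n) K) (ι := κ) (a := fun _ => |a| + |b|)
        (α := fun _ => 1) (C := |a| + |b| + 1) (by positivity) (Eventually.of_forall fun _ => by
          rw [abs_of_nonneg (by positivity)]; linarith)).mul (bwdQ_scale hR hG).bdd_rms
      simp only [mul_one] at this
      exact this.mono (Eventually.of_forall fun n θ _ =>
        (abs_mixDot_le _ _ _ _ _ _).trans (le_abs_self _))
    exact h1.div (agg_sq_low hR k.castSucc) hR.N_pos'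
  have hN1 : ∀ κ : ℕ → Type, BddP (fun n => initLaw (s n) K)
      (fun n θ (_ : κ n) => 1 / ((s n).N : ℝ)) (fun n => 1 / ((s n).N : ℝ)) := fun κ =>
    bddP_const one_pos (Eventually.of_forall fun n => by
      rw [abs_of_nonneg (by positivity), one_mul])
  have hperp : ∀ n (θ : Params (s n) K) (j : Fin (s n).N),
      |1 - agg θ (x n) k.castSucc j ^ 2 / ∑ l, agg θ (x n) k.castSucc l ^ 2| ≤ 1 := by
    intro n θ j
    rw [← perpSq_single, abs_of_nonneg (perpSq_nonneg _ _)]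
    exact (perpSq_le _ _).trans (by simp)
  refine GaussBlock.coordScale (fun n => blockInPerp (x n) k) hR.inv_N_pos
    (fun n θ j => mixCoef a b (c n) (x n) θ k) (fun n θ j l => if l = j then 1 else 0)
    (fun n j => ?_) (fun n θ Y j => ?_) hR.nonempty_N ?_ ?_ ?_ ?_ ?_
  · exact ((measurable_gradExpert_of _ _ _ (measurable_bwdG _ _ _) _).const_mul _).add
      ((measurable_gradRouter_of _ _ _ (measurable_bwdG _ _ _) _).const_mul _)
  · rw [sum_col_single, gradMix_eq, blockInPerp_mixCoef]
    rfl
  · simp_rw [cvar_blockInPerp, hsq]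
    have hN2 : LowP (fun n => initLaw (s n) K)
      (fun n θ (_ : Fin (s n).N) => 1 / ((s n).N : ℝ)) (fun n => 1 / ((s n).N : ℝ)) :=
      lowP_const one_pos (Eventually.of_forall fun n => by
        rw [abs_of_nonneg (by positivity), one_mul])
    have hY := hh.bdd.sq.div (agg_sq_low hR k.castSucc) hR.N_pos'
    simp only [one_pow] at hY
    exact (hN2.mul (mixCoef_sq_low hR hG hab) hR.inv_N_nonneg).mul (hY.one_sub hR.tendsto_inv_N)
      eventually_one_nonneg
  · simp_rw [mean_blockInPerp]
    have := (hdot _).mul hh.bdd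
    simpa only [mul_one] using this
  · simp_rw [cvar_blockInPerp, sq (1 / ((s _).N : ℝ))]
    refine ((hN1 _).mul (mixCoef_sq_bdd hR hG a b)).mono (Eventually.of_forall fun n θ j => ?_)
    rw [abs_mul]
    exact mul_le_of_le_one_right (abs_nonneg _) (hperp n θ j)
  · simp_rw [mean_blockInPerp, rms_const_mul]
    have := (hdot (fun _ => Unit)).mul hh.bdd_rms
    simp only [mul_one] at this
    exact this.mono (Eventually.of_forall fun n θ _ => by rw [abs_mul, abs_mul, abs_abs])
  · simp_rw [cvar_blockInPerp, sq (1 / ((s _).N : ℝ))]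
    refine ((hN1 _).mul (mixCoef_sq_bdd hR hG a b)).mono (Eventually.of_forall fun n θ _ => ?_)
    rw [← Finset.mul_sum, mul_div_assoc, abs_mul]
    refine mul_le_of_le_one_right (abs_nonneg _) ?_
    rw [abs_div, Nat.abs_cast]
    refine div_le_one_of_le₀ ?_ (Nat.cast_nonneg _)
    refine (Finset.abs_sum_le_sum_abs _ _).trans
      ((Finset.sum_le_sum fun j _ => hperp n θ j).trans ?_)
    simp

theorem gradExpert_scale : CoordScale (fun n => initLaw (s n) K)
    (fun n θ => gradExpert (withReadout (c n) (x n) θ) (x n) k)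
    (fun n => 1 / ((s n).N : ℝ)) :=
  (gradMix_scale hR hG (a := 1) (b := 0) (by simp)).congr
    fun n => ae_of_all _ fun θ _ j => by simp [gradMix]

theorem gradRouter_scale : CoordScale (fun n => initLaw (s n) K)
    (fun n θ => gradRouter (withReadout (c n) (x n) θ) (x n) k)
    (fun n => 1 / ((s n).N : ℝ)) :=
  (gradMix_scale hR hG (a := 0) (b := 1) (by simp)).congr
    fun n => ae_of_all _ fun θ _ j => by simp [gradMix]

theorem bwdG_castSucc_scale : CoordScale (fun n => initLaw (s n) K)
    (fun n θ => bwdG (c n) (x n) θ k.castSucc) (fun n => 1 / ((s n).N : ℝ)) :=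
  (gradMix_scale hR hG (a := 1) (b := 1) (by simp)).congr
    fun n => ae_of_all _ fun θ _ j => by simp [gradMix, bwdG_castSucc]

end Step

/-- Downward induction from the readout. The constants may deteriorate with each block, but the
depth is fixed and the order `1 / N` reproduces itself. -/
theorem bwdG_scale (hR : Regime s x)
    (hlow : ∃ a : ℝ, 0 < a ∧ ∀ᶠ n in atTop, a * (1 / ((s n).N : ℝ)) ≤ |c n|)
    (hbdd : ∃ a : ℝ, 0 < a ∧ ∀ᶠ n in atTop, |c n| ≤ a * (1 / ((s n).N : ℝ))) (k : Fin (K + 1)) :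
    CoordScale (fun n => initLaw (s n) K) (fun n θ => bwdG (c n) (x n) θ k)
      (fun n => 1 / ((s n).N : ℝ)) := by
  induction k using Fin.reverseInduction with
  | last => exact bwdG_last_scale hR hlow hbdd
  | cast k ih => exact bwdG_castSucc_scale hR ih

end BackwardPass

end MoE

end

noncomputable section

namespace MoE

section BackwardPass

variable {s : ℕ → Shape} {x : ∀ n, Fin (s n).D → ℝ} {K : ℕ} {c : ℕ → ℝ}

/-! ### The remaining gradients after the first step -/

theorem output_withReadout {s : Shape} (c : ℝ) (x : Fin s.D → ℝ) (θ : Params s K) :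
    output (withReadout c x θ) x = c * ∑ a, agg θ x (Fin.last K) a ^ 2 := by
  rw [output, vecW4_withReadout, agg_withReadout, smul_dotProduct, dotProduct, smul_eq_mul]
  simp_rw [sq]

theorem agg_sq_bdd (hR : Regime s x) (k : Fin (K + 1)) {κ : ℕ → Type} :
    BddP (fun n => initLaw (s n) K)
    (fun n θ (_ : κ n) => ∑ j, agg θ (x n) k j ^ 2) (fun n => ((s n).N : ℝ)) := by
  have h := (bddP_const (μ := fun n => initLaw (s n) K) (ι := κ) (a := fun n => ((s n).N : ℝ))
    (α := fun n => ((s n).N : ℝ)) one_pos (by simp)).mul (agg_scale (K := K) hR k).bdd_rms.sq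
  simp only [one_pow, mul_one] at h
  refine h.congr (Eventually.of_forall fun n θ j => ?_)
  rw [← card_mul_rms_sq, Fintype.card_fin]

theorem output_scale (hR : Regime s x)
    (hlow : ∃ a : ℝ, 0 < a ∧ ∀ᶠ n in atTop, a * (1 / ((s n).N : ℝ)) ≤ |c n|)
    (hbdd : ∃ a : ℝ, 0 < a ∧ ∀ᶠ n in atTop, |c n| ≤ a * (1 / ((s n).N : ℝ))) :
    CoordScale (fun n => initLaw (s n) K)
      (fun n θ (_ : Unit) => output (withReadout (c n) (x n) θ) (x n)) (fun _ => 1) := by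
  obtain ⟨a, ha, hlow⟩ := hlow
  obtain ⟨b, hb, hbdd⟩ := hbdd
  have hN : ∀ᶠ n in atTop, 1 / ((s n).N : ℝ) * (s n).N = 1 := hR.N_pos'.mono fun n hn => by
    field_simp
  have h2 : BddP (ι := fun _ => Unit) (fun n => initLaw (s n) K)
      (fun n θ _ => output (withReadout (c n) (x n) θ) (x n)) (fun _ => 1) := by
    simp_rw [output_withReadout]
    exact ((bddP_const hb hbdd).mul (agg_sq_bdd hR (Fin.last K))).scale one_pos
      (hN.mono fun n h => by rw [h, one_mul])
  refine coordScale_of_low (Eventually.of_forall fun _ => inferInstance) eventually_one_nonneg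
    ?_ h2 ((h2.comp fun _ (_ : Unit × Unit) => ()).rms_of_card_le
      (X := fun n θ (_ _ : Unit) => output (withReadout (c n) (x n) θ) (x n)) (L := 1) (by simp)
      eventually_one_nonneg)
  simp_rw [output_withReadout]
  exact ((lowP_const ha hlow).mul (agg_sq_low hR (Fin.last K)) (by simp)).scale one_pos
    (hN.mono fun n h => by rw [h, one_mul])

section Step

variable (hR : Regime s x) {k : Fin K}
  (hG : CoordScale (fun n => initLaw (s n) K) (fun n θ => bwdG (c n) (x n) θ k.succ)
    (fun n => 1 / ((s n).N : ℝ)))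
include hR

theorem gate_div_low : LowP (fun n => initLaw (s n) K)
    (fun n θ i => 1 / ((s n).M : ℝ) * phi θ (x n) k i) (fun n => 1 / ((s n).N : ℝ)) := by
  have := hR.inv_M_low.mul (phi_low hR (agg_scale hR k.castSucc)) eventually_one_nonneg
  simpa only [mul_one] using this

theorem gate_div_bdd : BddP (fun n => initLaw (s n) K)
    (fun n θ i => 1 / ((s n).M : ℝ) * phi θ (x n) k i) (fun n => 1 / ((s n).N : ℝ)) := by
  have := hR.inv_M_bdd.mul (phi_scale hR (agg_scale hR k.castSucc)).bdd
  simpa only [mul_one] using this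

include hG

theorem gradH3_scale : UniformCoordScale (fun n => initLaw (s n) K)
    (fun n θ => gradH3 (withReadout (c n) (x n) θ) (x n) k)
    (fun n => 1 / ((s n).N : ℝ) ^ 2) := by
  have h := UniformCoordScale.smul (gate_div_low (k := k) hR) (gate_div_bdd (k := k) hR)
    (UniformCoordScale.comp hG fun n (_ : Fin (s n).M) => ()) hR.inv_N_nonneg
  simp only [← sq, one_div_pow] at h
  refine h.congr fun n => ae_of_all _ fun θ i j => ?_
  rw [gradH3_eq, phi_withReadout, mul_assoc]
  rfl

theorem gradH2_scale : UniformCoordScale (fun n => initLaw (s n) K)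
    (fun n θ => gradH2 (withReadout (c n) (x n) θ) (x n) k)
    (fun n => 1 / ((s n).N : ℝ)) := by
  have h := UniformCoordScale.smul (gate_div_low (k := k) hR) (gate_div_bdd (k := k) hR) (bwdP_scale hR hG)
    eventually_one_nonneg
  simp only [mul_one] at h
  refine h.congr fun n => ae_of_all _ fun θ i j => ?_
  rw [gradH2_eq, phi_withReadout, mul_assoc]
  rfl

theorem gradPhi_scale : CoordScale (fun n => initLaw (s n) K)
    (fun n θ => gradPhi (withReadout (c n) (x n) θ) (x n) k)
    (fun n => 1 / ((s n).N : ℝ)) := by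
  have h := UniformCoordScale.smul hR.inv_M_low hR.inv_M_bdd (bwdQ_scale hR hG)
    eventually_one_nonneg
  simp only [mul_one] at h
  exact h.congr fun n => ae_of_all _ fun θ _ i => gradPhi_eq _ _

theorem gradPsi_scale : CoordScale (fun n => initLaw (s n) K)
    (fun n θ => gradPsi (withReadout (c n) (x n) θ) (x n) k)
    (fun n => 1 / ((s n).N : ℝ)) := by
  have h := UniformCoordScale.smul hR.inv_M_low hR.inv_M_bdd (dphi_mul_bwdQ_scale hR hG)
    eventually_one_nonneg
  simp only [mul_one] at h
  refine h.congr fun n => ae_of_all _ fun θ _ i => ?_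
  beta_reduce
  rw [gradPsi_eq, dphi_withReadout]
  rfl

theorem gradParam_Q_scale : CoordScale (fun n => initLaw (s n) K)
    (fun n θ (p : Fin (s n).M × Fin (s n).N) =>
      gradParam (withReadout (c n) (x n) θ) (x n) (.Q k p.1 p.2))
    (fun n => 1 / ((s n).N : ℝ)) := by
  have h := UniformCoordScale.outer (gradPsi_scale hR hG) (agg_scale hR k.castSucc)
    eventually_one_nonneg
  simp only [mul_one] at h
  refine h.congr fun n => ae_of_all _ fun θ _ p => ?_
  beta_reduce
  rw [gradParam_Q, agg_withReadout]

theorem gradParam_W2_scale : UniformCoordScale (fun n => initLaw (s n) K)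
    (fun n θ i (p : Fin (s n).Ne × Fin (s n).N) =>
      gradParam (withReadout (c n) (x n) θ) (x n) (.W2 k i p.1 p.2))
    (fun n => 1 / ((s n).N : ℝ)) := by
  have h := UniformCoordScale.outer (gradH2_scale hR hG)
    (UniformCoordScale.comp (agg_scale hR k.castSucc) fun n (_ : Fin (s n).M) => ())
    eventually_one_nonneg
  simp only [mul_one] at h
  refine h.congr fun n => ae_of_all _ fun θ _ p => ?_
  rw [gradParam_W2, agg_withReadout]

theorem gradParam_W3_scale : UniformCoordScale (fun n => initLaw (s n) K)
    (fun n θ i (p : Fin (s n).N × Fin (s n).Ne) =>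
      gradParam (withReadout (c n) (x n) θ) (x n) (.W3 k i p.1 p.2))
    (fun n => 1 / ((s n).N : ℝ) ^ 2) := by
  have h := UniformCoordScale.outer (gradH3_scale hR hG)
    (h2_scale hR (agg_scale hR k.castSucc)) eventually_one_nonneg
  simp only [mul_one] at h
  refine h.congr fun n => ae_of_all _ fun θ _ p => ?_
  rw [gradParam_W3, h2_withReadout]

end Step

theorem gradParam_W4_scale (hR : Regime s x) : CoordScale (fun n => initLaw (s n) K)
    (fun n θ (a : Fin (s n).N) => gradParam (withReadout (c n) (x n) θ) (x n) (.W4 a))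
    (fun _ => 1) := by
  refine UniformCoordScale.congr (agg_scale (K := K) hR (Fin.last K))
    fun n => ae_of_all _ fun θ _ a => ?_
  beta_reduce
  rw [gradParam_W4, agg_withReadout]

end BackwardPass

end MoE

end

noncomputable section

namespace MoE

/-! ### The law of the initialization -/

theorem UniformCoordScale.of_map {Ω Ω' : ℕ → Type*} [∀ n, MeasurableSpace (Ω n)]
    [∀ n, MeasurableSpace (Ω' n)] {μ : ∀ n, Measure (Ω n)} {ν : ∀ n, Measure (Ω' n)}
    {f : ∀ n, Ω n → Ω' n} (hf : ∀ n, HasLaw (f n) (ν n) (μ n)) {κ ι : ℕ → Type}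
    [∀ n, Fintype (ι n)] {X : ∀ n, Ω' n → κ n → ι n → ℝ} {α : ℕ → ℝ}
    (h : UniformCoordScale ν X α) : UniformCoordScale μ (fun n ω => X n (f n ω)) α := by
  intro ε hε
  obtain ⟨c, C, hc, hC, h⟩ := h ε hε
  -- This inequality holds for arbitrary sets, so no measurability of the tensors is needed.
  have key : ∀ n (A : Set (Ω' n)), μ n (f n ⁻¹' A) ≤ ν n A := fun n A => by
    rw [← (hf n).map_eq]
    exact Measure.le_map_apply (hf n).aemeasurable A
  exact ⟨c, C, hc, hC, h.mono fun n hn i =>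
    ⟨fun j => (key n _).trans ((hn i).1 j), (key n _).trans (hn i).2⟩⟩

theorem hasLaw_gaussPi {Ω ι : Type*} [MeasurableSpace Ω] [Fintype ι] {μ : Measure Ω}
    [IsProbabilityMeasure μ] {X : ι → Ω → ℝ} {v : ι → ℝ≥0}
    (hlaw : ∀ i, HasLaw (X i) (gaussianReal 0 (v i)) μ) (hind : iIndepFun X μ) :
    HasLaw (fun ω i => X i ω) (gaussPi v) μ := by
  have hX : ∀ i, AEMeasurable (X i) μ := fun i => (hlaw i).aemeasurable
  refine ⟨aemeasurable_pi_lambda _ hX, ?_⟩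
  rw [(iIndepFun_iff_map_fun_eq_pi_map hX).1 hind, gaussPi]
  congr 1
  ext1 i
  exact (hlaw i).map_eq

/-- Transfers a scale from the canonical space of parameters to the given probability spaces. Here
`g` describes an iterate as a function of the initialization and need only be correct almost surely,
since the zero readout holds only almost surely. -/
theorem UniformCoordScale.of_ae_eq {Ω Ω' Ω'' : ℕ → Type*} [∀ n, MeasurableSpace (Ω n)]
    [∀ n, MeasurableSpace (Ω' n)] {μ : ∀ n, Measure (Ω n)} {ν : ∀ n, Measure (Ω' n)}
    {f : ∀ n, Ω n → Ω' n} (hf : ∀ n, HasLaw (f n) (ν n) (μ n)) {g : ∀ n, Ω' n → Ω'' n}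
    {f' : ∀ n, Ω n → Ω'' n} (hg : ∀ n, ∀ᵐ ω ∂μ n, f' n ω = g n (f n ω)) {κ ι : ℕ → Type}
    [∀ n, Fintype (ι n)] {X : ∀ n, Ω'' n → κ n → ι n → ℝ} {α : ℕ → ℝ}
    (h : UniformCoordScale ν (fun n ω => X n (g n ω)) α) :
    UniformCoordScale μ (fun n ω => X n (f' n ω)) α :=
  (h.of_map hf).congr fun n => (hg n).mono fun ω hω i j => by rw [hω]

/-! ### The first two steps of the training -/

section Training

variable {s : Shape} {K : ℕ} (x : Fin s.D → ℝ)

theorem differentiable_agg (k : Fin (K + 1)) (a : Fin s.N) :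
    Differentiable ℝ fun θ : Params s K => agg θ x k a := by
  induction k using Fin.induction generalizing a with
  | zero =>
    have : ∀ θ : Params s K, agg θ x 0 a = ∑ d, θ (.W1 a d) * x d := fun θ => rfl
    simp_rw [this]
    fun_prop
  | succ k ih =>
    have hs : Differentiable ℝ Real.sigmoid := differentiable_sigmoid
    simp_rw [agg_succ_apply, gatedIn, phi, gate, psi_apply, h2_apply]
    fun_prop

theorem differentiable_output : Differentiable ℝ fun θ : Params s K => output θ x := by
  have := differentiable_agg (s := s) (K := K) x (Fin.last K)
  simp only [output, dotProduct, vecW4]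
  fun_prop

theorem pgrad_comp_left {ι : Type*} [Fintype ι] [DecidableEq ι] {ℓ : ℝ → ℝ} {F : (ι → ℝ) → ℝ}
    {y : ι → ℝ} (hℓ : DifferentiableAt ℝ ℓ (F y)) (hF : DifferentiableAt ℝ F y) (j : ι) :
    pgrad (fun y => ℓ (F y)) y j = deriv ℓ (F y) * pgrad F y j := by
  have h1 : DifferentiableAt ℝ (fun r => F (Function.update y j r)) (y j) := by
    refine DifferentiableAt.comp (y j) (by simpa using hF)
      (hasDerivAt_update y j (y j)).differentiableAt
  have h2 := deriv_comp (h₂ := ℓ) (h := fun r => F (Function.update y j r)) (y j)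
    (by simpa using hℓ) h1
  simp only [Function.update_eq_self] at h2
  exact h2

variable {x} {η : ℝ} {ℓ : ℝ → ℝ}

theorem sgd_succ_apply (hℓ : Differentiable ℝ ℓ) (θ₀ : Params s K) (t : ℕ) (p : ParamIdx s K) :
    sgd η ℓ x θ₀ (t + 1) p = sgd η ℓ x θ₀ t p -
      lr η p * (lossDeriv ℓ (sgd η ℓ x θ₀ t) x * gradParam (sgd η ℓ x θ₀ t) x p) := by
  rw [sgd]
  beta_reduce
  rw [pgrad_comp_left (hℓ _) (differentiable_output x _)]
  rfl

theorem output_eq_zero {θ : Params s K} (h : vecW4 θ = 0) : output θ x = 0 := by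
  simp [output, h]

/-- With a zero readout the output remains zero however the other parameters move. -/
theorem gradParam_eq_zero {θ : Params s K} (h : vecW4 θ = 0) {p : ParamIdx s K}
    (hp : ∀ a, p ≠ .W4 a) : gradParam θ x p = 0 := by
  have : (fun r => output (Function.update θ p r) x) = fun _ => 0 := by
    ext r
    refine output_eq_zero ?_
    ext a
    rw [vecW4, Function.update_of_ne (hp a).symm]
    exact congrFun h a
  rw [gradParam, pgrad, this, deriv_const]

/-- The first step only moves the readout. -/
theorem sgd_one (hℓ : Differentiable ℝ ℓ) {θ₀ : Params s K} (h : vecW4 θ₀ = 0) :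
    sgd η ℓ x θ₀ 1 = withReadout (-(η / s.N * deriv ℓ 0)) x θ₀ := by
  ext p
  rw [sgd_succ_apply hℓ]
  simp only [sgd, lossDeriv, output_eq_zero h]
  cases p with
  | W4 a =>
    have : θ₀ (.W4 a) = 0 := congrFun h a
    rw [gradParam_W4, this, withReadout, lr]
    ring
  | _ => rw [gradParam_eq_zero h (by simp)]; simp [withReadout]

end Training

theorem Regime.of_isTheta {s : ℕ → Shape} {x : ∀ n, Fin (s n).D → ℝ}
    (hN : Tendsto (fun n => (s n).N) atTop atTop)
    (hM : (fun n => ((s n).M : ℝ)) =Θ[atTop] fun n => ((s n).N : ℝ))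
    (hNe : (fun n => ((s n).Ne : ℝ)) =Θ[atTop] fun _ => (1 : ℝ))
    (hD : ∀ n, 0 < (s n).D)
    (hx : (fun n => ∑ d, x n d ^ 2) =Θ[atTop] fun n => ((s n).D : ℝ)) : Regime s x where
  tendsto_N := hN
  M_ge := by
    obtain ⟨C, hC, h⟩ := hM.2.exists_pos
    refine ⟨1 / C, by positivity, h.bound.mono fun n hn => ?_⟩
    simp only [RCLike.norm_natCast] at hn
    rw [div_mul_eq_mul_div, one_mul, div_le_iff₀ hC, mul_comm]
    exact hn
  M_le := by
    obtain ⟨C, hC, h⟩ := hM.1.exists_pos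
    exact ⟨C, hC, h.bound.mono fun n hn => by simpa only [RCLike.norm_natCast] using hn⟩
  Ne_pos := by
    obtain ⟨C, hC, h⟩ := hNe.2.exists_pos
    refine h.bound.mono fun n hn => ?_
    by_contra h0
    have h0 : (s n).Ne = 0 := by omega
    norm_num [h0] at hn
  Ne_le := by
    obtain ⟨C, hC, h⟩ := hNe.1.exists_pos
    refine ⟨⌈C⌉₊, h.bound.mono fun n hn => ?_⟩
    simp only [RCLike.norm_natCast, norm_one, mul_one] at hn
    exact_mod_cast hn.trans (Nat.le_ceil C)
  x_ge := by
    obtain ⟨C, hC, h⟩ := hx.2.exists_pos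
    refine ⟨1 / C, by positivity, h.bound.mono fun n hn => ?_⟩
    have : (0 : ℝ) < (s n).D := by exact_mod_cast hD n
    rw [RCLike.norm_natCast, Real.norm_of_nonneg (by positivity)] at hn
    rw [div_le_div_iff₀ hC this, one_mul, mul_comm]
    exact hn
  x_le := by
    obtain ⟨C, hC, h⟩ := hx.1.exists_pos
    refine ⟨C, hC, h.bound.mono fun n hn => ?_⟩
    have : (0 : ℝ) < (s n).D := by exact_mod_cast hD n
    rw [RCLike.norm_natCast, Real.norm_of_nonneg (by positivity)] at hn
    rwa [div_le_iff₀ this]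

/-! ### Contractions with independent vectors -/

section Independent

variable {s : ℕ → Shape} {x : ∀ n, Fin (s n).D → ℝ} {K : ℕ}

/-- The variance of an entry of `v ᵥ* A` for a Gaussian matrix `A`. -/
def contractVar (s : Shape) (v : Fin s.N → ℝ) : ℝ := s.M / s.Ne * (s.N * rms v ^ 2)

theorem contractVar_nonneg (s : Shape) (v : Fin s.N → ℝ) : 0 ≤ contractVar s v := by
  unfold contractVar; positivity

theorem measurable_contractVar (s : Shape) : Measurable (contractVar s) := by
  have := measurable_rms (ι := Fin s.N)
  unfold contractVar
  fun_prop

theorem gaussPi_map_vecMul {s : Shape} (v : Fin s.N → ℝ) (e : Fin s.Ne) :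
    (gaussPi fun _ : Fin s.N × Fin s.Ne => (s.M : ℝ≥0) / (s.Ne : ℝ≥0)).map
      (fun A => ∑ a, v a * A (a, e)) = gaussianReal 0 (contractVar s v).toNNReal := by
  have h := gaussPi_map_linear (fun _ : Fin s.N × Fin s.Ne => (s.M : ℝ≥0) / (s.Ne : ℝ≥0))
    fun p => v p.1 * if p.2 = e then 1 else 0
  simp_rw [sum_col_single] at h
  rw [h]
  have h2 : ∑ p : Fin s.N × Fin s.Ne, (v p.1 * if p.2 = e then 1 else 0) ^ 2 *
      (((s.M : ℝ≥0) / (s.Ne : ℝ≥0) : ℝ≥0) : ℝ) = contractVar s v := by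
    have h3 := card_mul_rms_sq v
    rw [Fintype.card_fin] at h3
    rw [← Finset.sum_mul, Fintype.sum_prod_type, contractVar, h3]
    simp [mul_comm]
  rw [h2]

/-- Under independence the joint law is a product. Given `v` the contraction is centered Gaussian
with variance `contractVar`, so no resampling is involved; the small ball bound and Markov's
inequality apply to the joint law of each pair `v`, `A`. -/
theorem vecMul_scale {Ω : ℕ → Type*} [∀ n, MeasurableSpace (Ω n)] {μ : ∀ n, Measure (Ω n)}
    [∀ n, IsProbabilityMeasure (μ n)] (hR : Regime s x)
    {v : ∀ n, Ω n → Fin (s n).M → Fin (s n).N → ℝ}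
    {A : ∀ n, Ω n → Fin (s n).M → Fin (s n).N × Fin (s n).Ne → ℝ}
    (hA : ∀ n i, HasLaw (fun ω => A n ω i)
      (gaussPi fun _ => ((s n).M : ℝ≥0) / ((s n).Ne : ℝ≥0)) (μ n))
    (hvm : ∀ n i, AEMeasurable (fun ω => v n ω i) (μ n))
    (hind : ∀ n i, IndepFun (fun ω => v n ω i) (fun ω => A n ω i) (μ n))
    (hv : UniformCoordScale μ v fun n => 1 / ((s n).N : ℝ)) :
    UniformCoordScale μ (fun n ω i e => ∑ a, v n ω i a * A n ω i (a, e)) (fun _ => 1) := by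
  have hjoint : ∀ n i, HasLaw (fun ω => (v n ω i, A n ω i))
      (((μ n).map fun ω => v n ω i).prod
        (gaussPi fun _ => ((s n).M : ℝ≥0) / ((s n).Ne : ℝ≥0))) (μ n) := fun n i =>
    ⟨(hvm n i).prodMk (hA n i).aemeasurable, by
      rw [(indepFun_iff_map_prod_eq_prod_map_map (hvm n i) (hA n i).aemeasurable).1 (hind n i),
        (hA n i).map_eq]⟩
  -- Order count: `M / Ne` gives `N`, and the squared length of `v` gives `N * N⁻²`.
  have hVlow : LowP μ (fun n ω i => contractVar (s n) (v n ω i)) (fun _ => 1) := by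
    obtain ⟨a, ha, h⟩ := hR.div_ge
    refine ((lowP_const (α := fun n => ((s n).N : ℝ)) ha
      (h.mono fun n h => h.trans (le_abs_self _))).mul ((lowP_const (α := fun n => ((s n).N : ℝ))
      (a := fun n => ((s n).N : ℝ)) one_pos (by simp)).mul (hv.low_rms.sq hR.inv_N_nonneg)
      (Eventually.of_forall fun n => by positivity))
      (Eventually.of_forall fun n => by positivity)).scale one_pos ?_
    filter_upwards [hR.N_pos'] with n hn
    field_simp
    exact le_rfl
  have hVbdd : BddP μ (fun n ω i => contractVar (s n) (v n ω i)) (fun _ => 1) := by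
    obtain ⟨a, ha, h⟩ := hR.div_le
    refine ((bddP_const (α := fun n => ((s n).N : ℝ)) ha
      (h.mono fun n h => by rwa [abs_of_nonneg (by positivity)])).mul
      ((bddP_const (α := fun n => ((s n).N : ℝ))
      (a := fun n => ((s n).N : ℝ)) one_pos (by simp)).mul hv.bdd_rms.sq)).scale one_pos ?_
    filter_upwards [hR.N_pos'] with n hn
    field_simp
    exact le_rfl
  have hm : ∀ n (e : Fin (s n).Ne), Measurable
      fun z : (Fin (s n).N → ℝ) × (Fin (s n).N × Fin (s n).Ne → ℝ) => ∑ a, z.1 a * z.2 (a, e) :=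
    fun n e => by fun_prop
  obtain ⟨L, hL⟩ := hR.Ne_le
  have hlow : LowP μ (fun n ω (p : Fin (s n).M × Fin (s n).Ne) =>
      ∑ a, v n ω p.1 a * A n ω p.1 (a, p.2)) (fun _ => 1) := by
    intro ε hε
    obtain ⟨c, hc, h⟩ := hVlow (ε / 2) (by positivity)
    refine ⟨√c * (ε / 2), by positivity, h.mono fun n hn p => ?_⟩
    have : IsProbabilityMeasure ((μ n).map fun ω => v n ω p.1) :=
      Measure.isProbabilityMeasure_map (hvm n p.1)
    have h1 := prod_measure_abs_lt_le (μ := (μ n).map fun ω => v n ω p.1)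
      (γ := gaussPi fun _ => ((s n).M : ℝ≥0) / ((s n).Ne : ℝ≥0)) (hm n p.2)
      (b := fun _ => 0) (V := contractVar (s n)) (contractVar_nonneg _)
      (fun w => gaussPi_map_vecMul w p.2) (δ := √c * (ε / 2)) (by positivity) hc
    have h2 := (hjoint n p.1).measure_eq
      (p := fun z => |∑ a, z.1 a * z.2 (a, p.2)| < √c * (ε / 2))
      (measurableSet_lt (by fun_prop) measurable_const)
    have h3 : (μ n).map (fun ω => v n ω p.1) {w | |contractVar (s n) w| < c} ≤
        ENNReal.ofReal (ε / 2) := by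
      have hcm := measurable_contractVar (s n)
      rw [Measure.map_apply_of_aemeasurable (hvm n p.1)
        (measurableSet_lt (by fun_prop) measurable_const)]
      simpa using hn p.1
    simp only [mul_one]
    rw [h2]
    refine h1.trans ((add_le_add h3 le_rfl).trans (le_of_eq ?_))
    rw [← ENNReal.ofReal_add (by positivity) (by positivity)]
    have := Real.sqrt_pos.2 hc
    congr 1
    field_simp
    ring
  have hbdd : BddP μ (fun n ω (p : Fin (s n).M × Fin (s n).Ne) =>
      ∑ a, v n ω p.1 a * A n ω p.1 (a, p.2)) (fun _ => 1) := by
    refine BddP.of_sq ?_ eventually_one_nonneg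
    intro ε hε
    obtain ⟨C, hC, h⟩ := hVbdd (ε / 2) (by positivity)
    refine ⟨C * (2 / ε), by positivity, h.mono fun n hn p => ?_⟩
    have : IsProbabilityMeasure ((μ n).map fun ω => v n ω p.1) :=
      Measure.isProbabilityMeasure_map (hvm n p.1)
    have h1 := prod_measure_lt_le (μ := (μ n).map fun ω => v n ω p.1)
      (γ := gaussPi fun _ => ((s n).M : ℝ≥0) / ((s n).Ne : ℝ≥0)) ((hm n p.2).pow_const 2)
      (B := contractVar (s n)) (fun w => by
        have := lintegral_sq_gaussianReal 0 (contractVar_nonneg (s n) w)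
        rw [← gaussPi_map_vecMul w p.2, lintegral_map (by fun_prop) (by fun_prop)] at this
        simp only [ne_eq, OfNat.ofNat_ne_zero, not_false_eq_true, zero_pow, zero_add] at this
        exact this.le) (β := C) (l := C * (2 / ε)) (by positivity)
    have h2 := (hjoint n p.1).measure_eq
      (p := fun z => C * (2 / ε) < (∑ a, z.1 a * z.2 (a, p.2)) ^ 2)
      (measurableSet_lt measurable_const (by fun_prop))
    have h3 : (μ n).map (fun ω => v n ω p.1) {w | C < contractVar (s n) w} ≤
        ENNReal.ofReal (ε / 2) := by
      have hcm := measurable_contractVar (s n)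
      rw [Measure.map_apply_of_aemeasurable (hvm n p.1)
        (measurableSet_lt measurable_const (by fun_prop))]
      simpa [abs_of_nonneg (contractVar_nonneg _ _)] using hn p.1
    simp only [one_pow, mul_one, abs_sq]
    rw [h2]
    refine h1.trans ((add_le_add h3 le_rfl).trans (le_of_eq ?_))
    rw [← ENNReal.ofReal_add (by positivity) (by positivity)]
    congr 1
    field_simp
    ring
  exact uniformCoordScale_of_low hR.nonempty_Ne eventually_one_nonneg hlow hbdd
    (hbdd.rms_of_card_le (X := fun n ω i e => ∑ a, v n ω i a * A n ω i (a, e)) (by simpa using hL)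
      eventually_one_nonneg)

end Independent

end MoE

end

noncomputable section

namespace MoE

/-! ### The scales of the updates -/

theorem ae_vecW4_eq_zero {s : Shape} {K : ℕ} {Ω : Type*} [MeasurableSpace Ω] {μ : Measure Ω}
    {θ : Ω → Params s K}
    (hlaw : ∀ p, HasLaw (fun ω => θ ω p) (gaussianReal 0 (initVar p)) μ) :
    ∀ᵐ ω ∂μ, vecW4 (θ ω) = 0 := by
  have h : ∀ a, ∀ᵐ ω ∂μ, θ ω (.W4 a) = 0 := fun a => by
    have hl := hlaw (.W4 a)
    rw [initVar, gaussianReal_zero_var] at hl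
    refine ae_of_ae_map (p := fun r => r = 0) hl.aemeasurable ?_
    rw [hl.map_eq, ae_dirac_eq]
    rfl
  filter_upwards [ae_all_iff.2 h] with ω hω
  exact funext hω

section Updates

variable {Ω : ℕ → Type*} [∀ n, MeasurableSpace (Ω n)] {μ : ∀ n, Measure (Ω n)}

/-- If the constant were zero, the event of being too small would have probability one, against the
bound with level one half. -/
theorem CoordScale.ne_zero_of_ae_eq [∀ n, IsProbabilityMeasure (μ n)] {χ : ∀ n, Ω n → ℝ} {d : ℝ}
    (h : CoordScale μ (fun n ω (_ : Unit) => χ n ω) (fun _ => 1))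
    (hd : ∀ n, ∀ᵐ ω ∂μ n, χ n ω = d) : d ≠ 0 := by
  rintro rfl
  obtain ⟨c, hc, h⟩ := h.low (1 / 2) (by norm_num)
  obtain ⟨n, hn⟩ := h.exists
  have h1 : {ω | |χ n ω| < c * 1} =ᵐ[μ n] Set.univ :=
    eventuallyEq_univ.2 ((hd n).mono fun ω hω => by simp [hω, hc])
  have h2 : μ n {ω | |χ n ω| < c * 1} ≤ ENNReal.ofReal (1 / 2) := hn ()
  rw [measure_congr h1, measure_univ] at h2
  norm_num [← ENNReal.ofReal_one] at h2

/-- The loss derivative and the gradient may be dependent: two-sided bounds in probability multiply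
by a union bound alone. -/
theorem UniformCoordScale.sgdStep {χ : ∀ n, Ω n → ℝ} {κ ι : ℕ → Type} [∀ n, Fintype (ι n)]
    {X : ∀ n, Ω n → κ n → ι n → ℝ} {r α β ρ : ℕ → ℝ} (hX : UniformCoordScale μ X β)
    (hχ : CoordScale μ (fun n ω (_ : Unit) => χ n ω) (fun _ => 1))
    (hβ : ∀ᶠ n in atTop, 0 ≤ β n)
    (hr : ∃ a : ℝ, 0 < a ∧ ∀ᶠ n in atTop, a * ρ n ≤ |r n|)
    (hr' : ∃ a : ℝ, 0 < a ∧ ∀ᶠ n in atTop, |r n| ≤ a * ρ n)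
    (hα : ∀ᶠ n in atTop, ρ n * β n ≤ 1 * α n) (hα' : ∀ᶠ n in atTop, α n ≤ 1 * (ρ n * β n)) :
    UniformCoordScale μ (fun n ω i j => -(r n * χ n ω) * X n ω i j) α := by
  obtain ⟨a, ha, hr⟩ := hr
  obtain ⟨b, hb, hr'⟩ := hr'
  have h1 := (lowP_const ha hr).mul (hχ.low.comp fun n (_ : κ n) => ()) eventually_one_nonneg
  have h2 := (bddP_const hb hr').mul (hχ.bdd.comp fun n (_ : κ n) => ())
  simp only [mul_one] at h1 h2
  exact (hX.smul (h1.mono (Eventually.of_forall fun n ω i => (abs_neg _).ge))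
    (h2.mono (Eventually.of_forall fun n ω i => (abs_neg _).le)) hβ).scale one_pos one_pos hα hα'

end Updates

theorem readout_coeff {s : ℕ → Shape} {η d : ℝ} (hη : 0 < η) (hd : d ≠ 0) :
    (∃ a : ℝ, 0 < a ∧ ∀ᶠ n in atTop, a * (1 / ((s n).N : ℝ)) ≤ |-(η / (s n).N * d)|) ∧
    ∃ a : ℝ, 0 < a ∧ ∀ᶠ n in atTop, |-(η / (s n).N * d)| ≤ a * (1 / ((s n).N : ℝ)) := by
  have h : ∀ n, |-(η / (s n).N * d)| = η * |d| * (1 / ((s n).N : ℝ)) := fun n => by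
    rw [abs_neg, abs_mul, abs_of_nonneg (by positivity)]
    ring
  have hpos : 0 < η * |d| := by positivity
  exact ⟨⟨_, hpos, Eventually.of_forall fun n => (h n).ge⟩,
    ⟨_, hpos, Eventually.of_forall fun n => (h n).le⟩⟩

namespace Regime

variable {s : ℕ → Shape} {x : ∀ n, Fin (s n).D → ℝ} (hR : Regime s x) {η : ℝ} (hη : 0 < η)
include hR hη

theorem lr_in_ge :
    ∃ a : ℝ, 0 < a ∧ ∀ᶠ n in atTop, a * (fun _ => 1 : ℕ → ℝ) n ≤ |η * (s n).M / (s n).N| := by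
  obtain ⟨c, hc, h⟩ := hR.M_ge
  refine ⟨η * c, by positivity, ?_⟩
  filter_upwards [h, hR.N_pos'] with n hn hN
  rw [abs_of_nonneg (by positivity), le_div_iff₀ hN, mul_one, mul_assoc]
  gcongr

theorem lr_in_le :
    ∃ a : ℝ, 0 < a ∧ ∀ᶠ n in atTop, |η * (s n).M / (s n).N| ≤ a * (fun _ => 1 : ℕ → ℝ) n := by
  obtain ⟨c, hc, h⟩ := hR.M_le
  refine ⟨η * c, by positivity, ?_⟩
  filter_upwards [h, hR.N_pos'] with n hn hN
  rw [abs_of_nonneg (by positivity), div_le_iff₀ hN, mul_one, mul_assoc]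
  gcongr

theorem lr_out_ge :
    ∃ a : ℝ, 0 < a ∧ ∀ᶠ n in atTop, a * ((s n).N : ℝ) ^ 2 ≤ |η * (s n).M * (s n).N| := by
  obtain ⟨c, hc, h⟩ := hR.M_ge
  refine ⟨η * c, by positivity, ?_⟩
  filter_upwards [h] with n hn
  rw [abs_of_nonneg (by positivity), sq, ← mul_assoc, mul_assoc η c]
  gcongr

theorem lr_out_le :
    ∃ a : ℝ, 0 < a ∧ ∀ᶠ n in atTop, |η * (s n).M * (s n).N| ≤ a * ((s n).N : ℝ) ^ 2 := by
  obtain ⟨c, hc, h⟩ := hR.M_le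
  refine ⟨η * c, by positivity, ?_⟩
  filter_upwards [h] with n hn
  rw [abs_of_nonneg (by positivity), sq, ← mul_assoc, mul_assoc η c]
  gcongr

end Regime

end MoE

end

/-! ### Assembly of the scales -/

theorem mainTheorem4
    -- depth, and the trajectory of widths: `N → ∞`, `M ≍ N`, `N_e = Θ(1)`
    (K : ℕ) (hK : 1 ≤ K) (s : ℕ → MoE.Shape)
    (hN : Tendsto (fun n => (s n).N) atTop atTop)
    (hM : (fun n => ((s n).M : ℝ)) =Θ[atTop] fun n => ((s n).N : ℝ))
    (hNe : (fun n => ((s n).Ne : ℝ)) =Θ[atTop] fun _ => (1 : ℝ))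
    (hD : ∀ n, 0 < (s n).D)
    -- the training input, `‖x‖² = Θ(D)`
    (x : ∀ n, Fin (s n).D → ℝ)
    (hx : (fun n => ∑ d, x n d ^ 2) =Θ[atTop] fun n => ((s n).D : ℝ))
    (η : ℝ) (hη : 0 < η) (ℓ : ℝ → ℝ) (hℓ : Differentiable ℝ ℓ)
    -- independent centered Gaussian initialization
    {Ω : ℕ → Type*} [∀ n, MeasurableSpace (Ω n)] (μ : ∀ n, Measure (Ω n))
    [∀ n, IsProbabilityMeasure (μ n)]
    (θ₀ : ∀ n, Ω n → MoE.Params (s n) K)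
    (hlaw : ∀ n (p : MoE.ParamIdx (s n) K),
      HasLaw (fun ω => θ₀ n ω p) (gaussianReal 0 (MoE.initVar p)) (μ n))
    (hind : ∀ n, iIndepFun (fun (p : MoE.ParamIdx (s n) K) ω => θ₀ n ω p) (μ n))
    -- the SGD iterates
    (θ : ∀ (_t : ℕ) n, Ω n → MoE.Params (s n) K)
    (hθ : ∀ t n ω, θ t n ω = MoE.sgd η ℓ (x n) (θ₀ n ω) t)
    -- the loss derivative is of order one at the first two steps
    (hχ : ∀ t ≤ 1, MoE.CoordScale μ
      (fun n ω (_ : Unit) => MoE.lossDeriv ℓ (θ t n ω) (x n)) (fun _ => 1)) :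
    -- (i) every primitive variable at initialization
    ((∀ k, MoE.CoordScale μ (fun n ω => MoE.agg (θ 0 n ω) (x n) k) (fun _ => 1)) ∧
      (∀ k, MoE.CoordScale μ (fun n ω => MoE.psi (θ 0 n ω) (x n) k) (fun _ => 1)) ∧
      (∀ k, MoE.CoordScale μ (fun n ω => MoE.phi (θ 0 n ω) (x n) k) (fun _ => 1)) ∧
      (∀ k, MoE.UniformCoordScale μ (fun n ω => MoE.h2 (θ 0 n ω) (x n) k) (fun _ => 1)) ∧
      (∀ k, MoE.UniformCoordScale μ (fun n ω => MoE.h3 (θ 0 n ω) (x n) k)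
        (fun n => √((s n).N : ℝ))) ∧
      (∀ k, MoE.CoordScale μ
        (fun n ω (p : Fin (s n).M × Fin (s n).N) => MoE.matQ (θ 0 n ω) k p.1 p.2)
        (fun n => 1 / √((s n).N : ℝ))) ∧
      (∀ k, MoE.UniformCoordScale μ
        (fun n ω i (p : Fin (s n).Ne × Fin (s n).N) => MoE.matW2 (θ 0 n ω) k i p.1 p.2)
        (fun n => 1 / √((s n).N : ℝ))) ∧
      (∀ k, MoE.UniformCoordScale μ
        (fun n ω i (p : Fin (s n).N × Fin (s n).Ne) => MoE.matW3 (θ 0 n ω) k i p.1 p.2)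
        (fun n => √((s n).N : ℝ))) ∧
      (∀ n, ∀ᵐ ω ∂μ n, MoE.vecW4 (θ 0 n ω) = 0 ∧ MoE.output (θ 0 n ω) (x n) = 0)) ∧
    -- (ii) the first step moves the readout only
    ((∀ n, ∀ᵐ ω ∂μ n,
        (∀ p : MoE.ParamIdx (s n) K, (∀ a, p ≠ .W4 a) → θ 1 n ω p = θ 0 n ω p) ∧
        MoE.vecW4 (θ 1 n ω) = (-(η / (s n).N * MoE.lossDeriv ℓ (θ 0 n ω) (x n))) •
          MoE.agg (θ 0 n ω) (x n) (Fin.last K)) ∧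
      MoE.CoordScale μ (fun n ω => MoE.vecW4 (θ 1 n ω)) (fun n => 1 / ((s n).N : ℝ)) ∧
      MoE.CoordScale μ (fun n ω (_ : Unit) => MoE.output (θ 1 n ω) (x n)) (fun _ => 1) ∧
      -- the gradients of the output at `t = 1`
      (∀ k, MoE.CoordScale μ (fun n ω => MoE.gradAgg (θ 1 n ω) (x n) k)
        (fun n => 1 / ((s n).N : ℝ))) ∧
      (∀ k, MoE.CoordScale μ (fun n ω => MoE.gradExpert (θ 1 n ω) (x n) k)
        (fun n => 1 / ((s n).N : ℝ))) ∧
      (∀ k, MoE.CoordScale μ (fun n ω => MoE.gradRouter (θ 1 n ω) (x n) k)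
        (fun n => 1 / ((s n).N : ℝ))) ∧
      (∀ k, MoE.UniformCoordScale μ (fun n ω => MoE.gradH3 (θ 1 n ω) (x n) k)
        (fun n => 1 / ((s n).N : ℝ) ^ 2)) ∧
      (∀ k, MoE.UniformCoordScale μ (fun n ω => MoE.gradH2 (θ 1 n ω) (x n) k)
        (fun n => 1 / ((s n).N : ℝ))) ∧
      (∀ k, MoE.CoordScale μ (fun n ω => MoE.gradPhi (θ 1 n ω) (x n) k)
        (fun n => 1 / ((s n).N : ℝ))) ∧
      (∀ k, MoE.CoordScale μ (fun n ω => MoE.gradPsi (θ 1 n ω) (x n) k)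
        (fun n => 1 / ((s n).N : ℝ))) ∧
      (∀ k, MoE.CoordScale μ
        (fun n ω (p : Fin (s n).M × Fin (s n).N) =>
          MoE.gradParam (θ 1 n ω) (x n) (.Q k p.1 p.2))
        (fun n => 1 / ((s n).N : ℝ))) ∧
      (∀ k, MoE.UniformCoordScale μ
        (fun n ω i (p : Fin (s n).Ne × Fin (s n).N) =>
          MoE.gradParam (θ 1 n ω) (x n) (.W2 k i p.1 p.2))
        (fun n => 1 / ((s n).N : ℝ))) ∧
      (∀ k, MoE.UniformCoordScale μ
        (fun n ω i (p : Fin (s n).N × Fin (s n).Ne) =>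
          MoE.gradParam (θ 1 n ω) (x n) (.W3 k i p.1 p.2))
        (fun n => 1 / ((s n).N : ℝ) ^ 2)) ∧
      MoE.CoordScale μ
        (fun n ω (a : Fin (s n).N) => MoE.gradParam (θ 1 n ω) (x n) (.W4 a)) (fun _ => 1) ∧
      -- the SGD updates inside the blocks
      (∀ k, MoE.CoordScale μ
        (fun n ω (p : Fin (s n).M × Fin (s n).N) =>
          θ 2 n ω (.Q k p.1 p.2) - θ 1 n ω (.Q k p.1 p.2))
        (fun n => 1 / ((s n).N : ℝ))) ∧
      (∀ k, MoE.UniformCoordScale μ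
        (fun n ω i (p : Fin (s n).Ne × Fin (s n).N) =>
          θ 2 n ω (.W2 k i p.1 p.2) - θ 1 n ω (.W2 k i p.1 p.2))
        (fun n => 1 / ((s n).N : ℝ))) ∧
      (∀ k, MoE.UniformCoordScale μ
        (fun n ω i (p : Fin (s n).N × Fin (s n).Ne) =>
          θ 2 n ω (.W3 k i p.1 p.2) - θ 1 n ω (.W3 k i p.1 p.2))
        (fun _ => 1))) ∧
    -- (iii) contraction reordering, for arbitrary parameters
    ((∀ n (ϑ : MoE.Params (s n) K) k i (v : Fin (s n).N → ℝ),
        MoE.h3 ϑ (x n) k i ⬝ᵥ v = (v ᵥ* MoE.matW3 ϑ k i) ⬝ᵥ MoE.h2 ϑ (x n) k i) ∧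
      (∀ n (ϑ : MoE.Params (s n) K) k i,
        MoE.gradPhi ϑ (x n) k i = 1 / ((s n).M : ℝ) *
          ((MoE.gradAgg ϑ (x n) k.succ ᵥ* MoE.matW3 ϑ k i) ⬝ᵥ MoE.h2 ϑ (x n) k i)) ∧
      -- the intermediate is of order one for the backpropagated gradient
      (∀ k : Fin K, MoE.UniformCoordScale μ
        (fun n ω i => MoE.gradAgg (θ 1 n ω) (x n) k.succ ᵥ* MoE.matW3 (θ 1 n ω) k i)
        (fun _ => 1)) ∧
      -- and for every vector of scale `1 / N` that is independent of the expert matrix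
      (∀ (k : Fin K) (v : ∀ n, Ω n → Fin (s n).M → Fin (s n).N → ℝ),
        (∀ n i, AEMeasurable (fun ω => v n ω i) (μ n)) →
        (∀ n i, IndepFun (fun ω => v n ω i)
          (fun ω (p : Fin (s n).N × Fin (s n).Ne) => MoE.matW3 (θ 0 n ω) k i p.1 p.2) (μ n)) →
        MoE.UniformCoordScale μ v (fun n => 1 / ((s n).N : ℝ)) →
        MoE.UniformCoordScale μ (fun n ω i => v n ω i ᵥ* MoE.matW3 (θ 0 n ω) k i)
          (fun _ => 1))) := by
  have hR : MoE.Regime s x := .of_isTheta hN hM hNe hD hx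
  have hL : ∀ n, HasLaw (θ₀ n) (MoE.initLaw (s n) K) (μ n) :=
    fun n => MoE.hasLaw_gaussPi (hlaw n) (hind n)
  have h0 : ∀ n, ∀ᵐ ω ∂μ n, θ 0 n ω = id (θ₀ n ω) := fun n => ae_of_all _ fun ω => hθ 0 n ω
  have hW4 : ∀ n, ∀ᵐ ω ∂μ n, MoE.vecW4 (θ₀ n ω) = 0 := fun n => MoE.ae_vecW4_eq_zero (hlaw n)
  -- The coefficient is deterministic because the initial output is almost surely zero. The results
  -- for `withReadout` with a deterministic sequence of coefficients thus describe the first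
  -- iterate.
  have h1 : ∀ n, ∀ᵐ ω ∂μ n, θ 1 n ω =
      MoE.withReadout (-(η / (s n).N * deriv ℓ 0)) (x n) (θ₀ n ω) := fun n =>
    (hW4 n).mono fun ω hω => by rw [hθ, MoE.sgd_one hℓ hω]
  have hχ0 : ∀ n, ∀ᵐ ω ∂μ n, MoE.lossDeriv ℓ (θ 0 n ω) (x n) = deriv ℓ 0 := fun n =>
    (hW4 n).mono fun ω hω => by rw [hθ, MoE.sgd, MoE.lossDeriv, MoE.output_eq_zero hω]
  -- Without this the readout would stay at zero and no gradient would reach the blocks at the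
  -- second step.
  have hd : deriv ℓ 0 ≠ 0 := (hχ 0 zero_le_one).ne_zero_of_ae_eq hχ0
  obtain ⟨hlow, hbdd⟩ := MoE.readout_coeff (s := s) hη hd
  have hG : ∀ k, _ := MoE.bwdG_scale (K := K) hR hlow hbdd
  refine ⟨⟨fun k => ?_, fun k => ?_, fun k => ?_, fun k => ?_, fun k => ?_, fun k => ?_, fun k => ?_,
    fun k => ?_, fun n => ?_⟩, ⟨fun n => ?_, ?_, ?_, fun k => ?_, fun k => ?_, fun k => ?_,
    fun k => ?_, fun k => ?_, fun k => ?_, fun k => ?_, fun k => ?_, fun k => ?_, fun k => ?_, ?_,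
    fun k => ?_, fun k => ?_, fun k => ?_⟩, fun n ϑ k i v => ?_, fun n ϑ k i => ?_, fun k => ?_,
    fun k v hv hi hs => ?_⟩
  · exact .of_ae_eq hL h0 (X := fun n ϑ (_ : Unit) => MoE.agg ϑ (x n) k) (MoE.agg_scale hR k)
  · exact .of_ae_eq hL h0 (X := fun n ϑ (_ : Unit) => MoE.psi ϑ (x n) k)
      (MoE.psi_scale hR (MoE.agg_scale hR _))
  · exact .of_ae_eq hL h0 (X := fun n ϑ (_ : Unit) => MoE.phi ϑ (x n) k)
      (MoE.phi_scale hR (MoE.agg_scale hR _))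
  · exact .of_ae_eq hL h0 (X := fun n ϑ => MoE.h2 ϑ (x n) k)
      (MoE.h2_scale hR (MoE.agg_scale hR _))
  · exact .of_ae_eq hL h0 (X := fun n ϑ => MoE.h3 ϑ (x n) k)
      (MoE.h3_scale hR (MoE.agg_scale hR _))
  · exact .of_ae_eq hL h0 (X := fun n ϑ (_ : Unit) (p : Fin (s n).M × Fin (s n).N) =>
      MoE.matQ ϑ k p.1 p.2) (MoE.matQ_scale hR k)
  · exact .of_ae_eq hL h0 (X := fun n ϑ i (p : Fin (s n).Ne × Fin (s n).N) =>
      MoE.matW2 ϑ k i p.1 p.2) (MoE.matW2_scale hR k)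
  · exact .of_ae_eq hL h0 (X := fun n ϑ i (p : Fin (s n).N × Fin (s n).Ne) =>
      MoE.matW3 ϑ k i p.1 p.2) (MoE.matW3_scale hR k)
  · filter_upwards [hW4 n] with ω hω
    rw [hθ]
    exact ⟨hω, MoE.output_eq_zero hω⟩
  · filter_upwards [h1 n, hχ0 n] with ω hω hω'
    rw [hω', hω, hθ 0 n ω]
    refine ⟨fun p hp => ?_, rfl⟩
    cases p with
    | W4 a => exact absurd rfl (hp a)
    | _ => rfl
  · exact .of_ae_eq hL h1 (X := fun n ϑ (_ : Unit) => MoE.vecW4 ϑ)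
      ((MoE.bwdG_last_scale hR hlow hbdd).congr fun n => ae_of_all _ fun ϑ _ a =>
        (MoE.bwdG_last _ _ _ _).symm)
  · exact .of_ae_eq hL h1 (X := fun n ϑ (_ _ : Unit) => MoE.output ϑ (x n))
      (MoE.output_scale hR hlow hbdd)
  · exact .of_ae_eq hL h1 (X := fun n ϑ (_ : Unit) => MoE.gradAgg ϑ (x n) k) (hG k)
  · exact .of_ae_eq hL h1 (X := fun n ϑ (_ : Unit) => MoE.gradExpert ϑ (x n) k)
      (MoE.gradExpert_scale hR (hG k.succ))
  · exact .of_ae_eq hL h1 (X := fun n ϑ (_ : Unit) => MoE.gradRouter ϑ (x n) k)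
      (MoE.gradRouter_scale hR (hG k.succ))
  · exact .of_ae_eq hL h1 (X := fun n ϑ => MoE.gradH3 ϑ (x n) k)
      (MoE.gradH3_scale hR (hG k.succ))
  · exact .of_ae_eq hL h1 (X := fun n ϑ => MoE.gradH2 ϑ (x n) k)
      (MoE.gradH2_scale hR (hG k.succ))
  · exact .of_ae_eq hL h1 (X := fun n ϑ (_ : Unit) => MoE.gradPhi ϑ (x n) k)
      (MoE.gradPhi_scale hR (hG k.succ))
  · exact .of_ae_eq hL h1 (X := fun n ϑ (_ : Unit) => MoE.gradPsi ϑ (x n) k)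
      (MoE.gradPsi_scale hR (hG k.succ))
  · exact .of_ae_eq hL h1 (X := fun n ϑ (_ : Unit) (p : Fin (s n).M × Fin (s n).N) =>
      MoE.gradParam ϑ (x n) (.Q k p.1 p.2)) (MoE.gradParam_Q_scale hR (hG k.succ))
  · exact .of_ae_eq hL h1 (X := fun n ϑ i (p : Fin (s n).Ne × Fin (s n).N) =>
      MoE.gradParam ϑ (x n) (.W2 k i p.1 p.2)) (MoE.gradParam_W2_scale hR (hG k.succ))
  · exact .of_ae_eq hL h1 (X := fun n ϑ i (p : Fin (s n).N × Fin (s n).Ne) =>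
      MoE.gradParam ϑ (x n) (.W3 k i p.1 p.2)) (MoE.gradParam_W3_scale hR (hG k.succ))
  · exact .of_ae_eq hL h1 (X := fun n ϑ (_ : Unit) (a : Fin (s n).N) =>
      MoE.gradParam ϑ (x n) (.W4 a)) (MoE.gradParam_W4_scale hR)
  · have h : MoE.UniformCoordScale _ _ _ := .of_ae_eq hL h1
      (X := fun n ϑ (_ : Unit) (p : Fin (s n).M × Fin (s n).N) =>
      MoE.gradParam ϑ (x n) (.Q k p.1 p.2)) (MoE.gradParam_Q_scale hR (hG k.succ))
    refine (h.sgdStep (hχ 1 le_rfl) hR.inv_N_nonneg (hR.lr_in_ge hη) (hR.lr_in_le hη)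
      (by simp) (by simp)).congr fun n => ae_of_all _ fun ω _ p => ?_
    beta_reduce
    rw [hθ 2, hθ 1, MoE.sgd_succ_apply hℓ, MoE.lr]
    ring
  · have h : MoE.UniformCoordScale _ _ _ := .of_ae_eq hL h1
      (X := fun n ϑ i (p : Fin (s n).Ne × Fin (s n).N) =>
      MoE.gradParam ϑ (x n) (.W2 k i p.1 p.2)) (MoE.gradParam_W2_scale hR (hG k.succ))
    refine (h.sgdStep (hχ 1 le_rfl) hR.inv_N_nonneg (hR.lr_in_ge hη) (hR.lr_in_le hη)
      (by simp) (by simp)).congr fun n => ae_of_all _ fun ω i p => ?_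
    rw [hθ 2, hθ 1, MoE.sgd_succ_apply hℓ, MoE.lr]
    ring
  · have h : MoE.UniformCoordScale _ _ _ := .of_ae_eq hL h1
      (X := fun n ϑ i (p : Fin (s n).N × Fin (s n).Ne) =>
      MoE.gradParam ϑ (x n) (.W3 k i p.1 p.2)) (MoE.gradParam_W3_scale hR (hG k.succ))
    refine (h.sgdStep (hχ 1 le_rfl) (Eventually.of_forall fun n => by positivity)
      (hR.lr_out_ge hη) (hR.lr_out_le hη) ?_ ?_).congr fun n => ae_of_all _ fun ω i p => ?_
    · exact hR.N_pos'.mono fun n hn => by field_simp; exact le_rfl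
    · exact hR.N_pos'.mono fun n hn => by field_simp; exact le_rfl
    · rw [hθ 2, hθ 1, MoE.sgd_succ_apply hℓ, MoE.lr]
      ring
  · rw [dotProduct_comm]
    exact Matrix.dotProduct_mulVec v (MoE.matW3 ϑ k i) (MoE.h2 ϑ (x n) k i)
  · exact MoE.gradPhi_eq k i
  · exact .of_ae_eq hL h1 (X := fun n ϑ i => MoE.gradAgg ϑ (x n) k.succ ᵥ* MoE.matW3 ϑ k i)
      (MoE.bwdP_scale hR (hG k.succ))
  · refine MoE.vecMul_scale hR (A := fun n ω i p => MoE.matW3 (θ 0 n ω) k i p.1 p.2)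
      (fun n i => ?_) hv hi hs
    simp_rw [hθ]
    exact MoE.hasLaw_gaussPi (X := fun (p : Fin (s n).N × Fin (s n).Ne) ω =>
      θ₀ n ω (.W3 k i p.1 p.2)) (fun p => hlaw n (.W3 k i p.1 p.2))
      ((hind n).precomp (g := fun p : Fin (s n).N × Fin (s n).Ne =>
        MoE.ParamIdx.W3 k i p.1 p.2) fun p q h => by simpa [Prod.ext_iff] using h)
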